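/- **Setting.** Let $\{F_\theta:\theta\in\mathbb R\}$ be an exponential family on $\mathbb R$ with densities $f_\theta(y)=\exp\{y\theta-b(\theta)+c(y)\}$ with respect to Lebesgue measure or the counting measure (with $f_\theta(y)=0$ where $c(y)=-\infty$). Let $m\ge 1$, let $W^{m,2}[0,1]$ be the space of functions $f:[0,1]\to\mathbb R$ for which $f,f',\dots,f^{(m-1)}$ exist and are absolutely continuous and $\int_0^1|f^{(m)}|^2<\infty$, and let $g_0\in W^{m,2}[0,1]$. For each $n$ let $t_1,\dots,t_n\in[0,1]$ be fixed design points (which may depend on $n$) and let $Y_1,\dots,Y_n$ be independent with $Y_i\sim F_{\theta_{0,i}}$, $\theta_{0,i}=g_0(t_i)$. Let $\widehat\alpha_n$ be random variables, which may depend on the data. For $\alpha>0$ put $l_\alpha(y,\theta)=\int f_\theta^{1+\alpha}-(1+\frac1\alpha)f_\theta^\alpha(y)$ (a sum in the case of counting measure), and for $\lambda>0$ consider the criterion $$L_n(g)=\frac1n\sum_{i=1}^n l_{\widehat\alpha_n}(Y_i,g(t_i))+\lambda\int_0^1|g^{(m)}(t)|^2\,dt,\qquad g\in W^{m,2}[0,1].\tag{5}$$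 Write $\|\cdot\|$ for the $L^2[0,1]$-norm, $\|f\|_{m,\lambda}^2=\|f\|^2+\lambda\|f^{(m)}\|^2$, and $u_\theta(y)=\partial\log f_\theta(y)/\partial\theta$. **Assumptions.** - (A1) The support $\mathcal Y=\overline{\{y:f_\theta(y)>0\}}$ does not depend on $\theta\in\mathbb R$. - (A2) $\widehat\alpha_n\to\alpha_0$ in probability for some $\alpha_0>0$. - (A3) The densities $\{f_\theta(y):\theta\in\mathbb R\}$ are uniformly bounded and there are $\delta>0$ and $M<\infty$ such that $\theta\mapsto f_\theta(y)$ is twice differentiable at $g_0(t)+u$ for all $t\in[0,1]$, $|u|<\delta$ and all $y$, and $$\sup_{t\in[0,1]}\ \sup_{|\alpha-\alpha_0|<\delta,\,|u|<\delta}\ \sup_{y\in\mathcal Y}\left|\frac{\partial f_\theta^\alpha(y)}{\partial\theta}\Big|_{\theta=g_0(t)+u}\log f_{g_0(t)+u}(y)\right|\le M.$$ - (A4) With $\delta$ as in (A3), put $$m_t(u,\alpha)=\int_{\mathcal Y}\frac{\partial^2 f_\theta^{1+\alpha}(y)}{\partial\theta^2}\Big|_{\theta=g_0(t)+u}dy,\qquad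 n_t(u,\alpha,y)=\frac{\partial^2 f_\theta^\alpha(y)}{\partial\theta^2}\Big|_{\theta=g_0(t)+u}$$ (the integral, which is assumed to exist, being a sum in the case of counting measure). For every $\alpha\in(\alpha_0-\delta,\alpha_0+\delta)$ and $y\in\mathcal Y$ the families $\{m_t(\cdot,\alpha):t\in[0,1]\}$ and $\{n_t(\cdot,\alpha,y):t\in[0,1]\}$ are equicontinuous at $u=0$, and there is $M'>0$ with $|m_t(u,\alpha)|+\sup_{y\in\mathcal Y}|n_t(u,\alpha,y)|\le M'$ for all $t\in[0,1]$, $|\alpha-\alpha_0|<\delta$, $|u|<\delta$. - (A5) With $\delta$ as in (A3), there are $0<c_0\le C_0<\infty$ such that $c_0\le\mathbb E\{f_{\theta_{0,i}}^\alpha(Y_i)|u_{\theta_{0,i}}(Y_i)|^2\}\le C_0$ for all $n$, all $i\le n$ and all $\alpha\in(\alpha_0-\delta,\alpha_0+\delta)$. - (A6) There are $n_0$ and $K$ such that for all $n\ge n_0$ and all absolutely continuous $f:[0,1]\to\mathbb R$ with $f'\in L^1[0,1]$, $$\left|\frac1n\sum_{i=1}^n f(t_i)-\int_0^1 f(t)\,dt\right|\le\frac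 Kn\int_0^1|f'(t)|\,dt.$$ **Theorem 1.** Assume (A1)–(A6), and let $\lambda=\lambda_n>0$ be deterministic with $\lambda\to0$, $n\lambda^{1/m}\to\infty$ and $n\lambda^{1/(2m)}\exp[-\lambda^{-1/m}]\to0$ as $n\to\infty$. Then $$\lim_{D\to\infty}\liminf_{n\to\infty}\Pr\Big[\text{there is a local minimizer }\widehat g_n\text{ of (5) over }W^{m,2}[0,1]\text{ with }\|\widehat g_n-g_0\|_{m,\lambda}^2\le D\big(n^{-1}\lambda^{-1/(2m)}+\lambda\big)\Big]=1,$$ where "local minimizer" refers to the topology of the norm $\|\cdot\|_{m,\lambda}$ (which does not depend on $\lambda>0$), and the probability may be taken as inner probability should the event not be measurable. -/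

import Mathlib

open MeasureTheory ProbabilityTheory Set Filter Topology

noncomputable section

/-- A one-parameter exponential family of distributions on `ℝ` with unit dispersion: every
`θ : ℝ` gives the density `exp (y θ - b θ + c y)` for `y ∈ carrier` (and `0` elsewhere) with
respect to a reference measure that is Lebesgue measure or the counting measure. The set
`carrier` plays the role of the points where `c y > -∞`. -/
structure ExponentialFamily where
  /-- the reference measure -/
  ref : Measure ℝ
  ref_eq : ref = volume ∨ ref = Measure.count
  /-- the set where the densities do not vanish -/
  carrier : Set ℝ
  measurableSet_carrier : MeasurableSet carrier
  b : ℝ → ℝ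
  c : ℝ → ℝ
  measurable_c : Measurable c
  lintegral_eq_one : ∀ θ : ℝ, ∫⁻ y, ENNReal.ofReal
    (carrier.indicator (fun y => Real.exp (y * θ - b θ + c y)) y) ∂ref = 1

namespace ExponentialFamily

/-- The density `f_θ(y)`. -/
def density (F : ExponentialFamily) (θ y : ℝ) : ℝ :=
  F.carrier.indicator (fun y => Real.exp (y * θ - F.b θ + F.c y)) y

/-- The distribution `F_θ`. -/
def law (F : ExponentialFamily) (θ : ℝ) : Measure ℝ :=
  F.ref.withDensity (fun y => ENNReal.ofReal (F.density θ y))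

/-- The score `u_θ(y)`, the derivative of the log-density in the canonical parameter. -/
def score (F : ExponentialFamily) (θ y : ℝ) : ℝ :=
  deriv (fun s => Real.log (F.density s y)) θ

/-- The density power divergence loss
`l_α(y, θ) = ∫ f_θ^{1+α} - (1 + 1/α) f_θ(y)^α`, for `α > 0`. -/
def dpdLoss (F : ExponentialFamily) (α y θ : ℝ) : ℝ :=
  (∫ x, F.density θ x ^ (1 + α) ∂F.ref) - (1 + 1 / α) * F.density θ y ^ α

/-- `m_t(u, α)`: the integral over `Y` of the second `θ`-derivative of `f_θ^{1+α}`
at `θ = g₀ t + u`. -/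
def mFun (F : ExponentialFamily) (Y : Set ℝ) (g₀ : ℝ → ℝ) (t u α : ℝ) : ℝ :=
  ∫ y in Y, iteratedDeriv 2 (fun θ => F.density θ y ^ (1 + α)) (g₀ t + u) ∂F.ref

/-- `n_t(u, α, y)`: the second `θ`-derivative of `f_θ(y)^α` at `θ = g₀ t + u`. -/
def nFun (F : ExponentialFamily) (g₀ : ℝ → ℝ) (t u α y : ℝ) : ℝ :=
  iteratedDeriv 2 (fun θ => F.density θ y ^ α) (g₀ t + u)

/-- The common support: the closure of `{y | f_θ(y) > 0}` is `Y` for every `θ`. -/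
def CommonSupport (F : ExponentialFamily) (Y : Set ℝ) : Prop :=
  ∀ θ : ℝ, closure {y | 0 < F.density θ y} = Y

/-- Uniform boundedness, twice differentiability near the true parameter, and the bound on
`∂f_θ^α(y)/∂θ · log f_θ(y)` near the true parameter. -/
def FirstOrderRegular (F : ExponentialFamily) (Y : Set ℝ) (g₀ : ℝ → ℝ) (α₀ δ : ℝ) : Prop :=
  (∃ B : ℝ, ∀ θ y, F.density θ y ≤ B) ∧
  (∀ t ∈ Icc (0 : ℝ) 1, ∀ y u : ℝ, |u| < δ →
    DifferentiableAt ℝ (fun θ => F.density θ y) (g₀ t + u) ∧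
    DifferentiableAt ℝ (deriv (fun θ => F.density θ y)) (g₀ t + u)) ∧
  ∃ M : ℝ, ∀ t ∈ Icc (0 : ℝ) 1, ∀ α u : ℝ, |α - α₀| < δ → |u| < δ → ∀ y ∈ Y,
    |deriv (fun θ => F.density θ y ^ α) (g₀ t + u) * Real.log (F.density (g₀ t + u) y)| ≤ M

/-- Equicontinuity at `u = 0` of the families `m_t(·, α)` and `n_t(·, α, y)`, `t ∈ [0,1]`
(the integrals `m_t` being well defined), and their local uniform boundedness. -/
def SecondOrderRegular (F : ExponentialFamily) (Y : Set ℝ) (g₀ : ℝ → ℝ) (α₀ δ : ℝ) : Prop :=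
  (∀ t ∈ Icc (0 : ℝ) 1, ∀ α u : ℝ, |α - α₀| < δ → |u| < δ →
    IntegrableOn (fun y => iteratedDeriv 2 (fun θ => F.density θ y ^ (1 + α)) (g₀ t + u))
      Y F.ref) ∧
  (∀ α : ℝ, |α - α₀| < δ →
    EquicontinuousAt (fun (t : Icc (0 : ℝ) 1) (u : ℝ) => F.mFun Y g₀ t u α) 0 ∧
    ∀ y ∈ Y, EquicontinuousAt (fun (t : Icc (0 : ℝ) 1) (u : ℝ) => F.nFun g₀ t u α y) 0) ∧
  ∃ M : ℝ, 0 < M ∧ ∀ t ∈ Icc (0 : ℝ) 1, ∀ α u : ℝ, |α - α₀| < δ → |u| < δ → ∀ y ∈ Y,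
    |F.mFun Y g₀ t u α| + |F.nFun g₀ t u α y| ≤ M

/-- The moments `E{f_θ^α(Y_i) |u_θ(Y_i)|²}`, at the true parameters `θ = g₀(t_i)`, are bounded
away from zero and infinity, uniformly in `n`, `i ≤ n` and `α` near `α₀`. -/
def InformationBounds (F : ExponentialFamily) {Ω : Type*} [MeasurableSpace Ω] (P : Measure Ω)
    (t : (n : ℕ) → Fin n → ℝ) (Y : (n : ℕ) → Fin n → Ω → ℝ) (g₀ : ℝ → ℝ) (α₀ δ : ℝ) : Prop :=
  ∃ c₀ C₀ : ℝ, 0 < c₀ ∧ c₀ ≤ C₀ ∧ ∀ α : ℝ, |α - α₀| < δ → ∀ (n : ℕ) (i : Fin n),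
    c₀ ≤ ∫ ω, F.density (g₀ (t n i)) (Y n i ω) ^ α * |F.score (g₀ (t n i)) (Y n i ω)| ^ 2 ∂P ∧
    ∫ ω, F.density (g₀ (t n i)) (Y n i ω) ^ α * |F.score (g₀ (t n i)) (Y n i ω)| ^ 2 ∂P ≤ C₀

end ExponentialFamily

/-- The `k`-th derivative on `[0,1]` (one-sided at the end points); it depends only on the
restriction of `f` to `[0,1]`. -/
def derivOn (k : ℕ) (f : ℝ → ℝ) : ℝ → ℝ := iteratedDerivWithin k f (Icc 0 1)

/-- The Sobolev space `W^{m,p}([0,1])`, for `m ≥ 1`: `f, f', …, f^{(m-1)}` exist on `[0,1]`,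
`f^{(m-1)}` is absolutely continuous (hence so are the lower derivatives, which are `C¹`), and
its almost everywhere derivative `f^{(m)}` is in `L^p`. Only the values of `f` on `[0,1]`
matter. -/
def MemSobolev (m : ℕ) (p : ENNReal) (f : ℝ → ℝ) : Prop :=
  ContDiffOn ℝ ((m - 1 : ℕ) : ℕ∞) f (Icc 0 1) ∧
  AbsolutelyContinuousOnInterval (derivOn (m - 1) f) 0 1 ∧
  MemLp (derivOn m f) p (volume.restrict (Icc 0 1))

/-- The norm `‖f‖_{m,lam} = (‖f‖² + lam ‖f^{(m)}‖²)^{1/2}`, with `L²([0,1])`-norms. -/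
def sobolevNorm (m : ℕ) (lam : ℝ) (f : ℝ → ℝ) : ℝ :=
  Real.sqrt ((∫ x in Icc (0 : ℝ) 1, f x ^ 2) + lam * ∫ x in Icc (0 : ℝ) 1, derivOn m f x ^ 2)

/-- Asymptotically quasi-uniform design: from some `n₀` on, the quadrature error of every
`f ∈ W^{1,1}([0,1])` is at most `K / n` times the `L¹`-norm of `f'`. -/
def QuasiUniformDesign (t : (n : ℕ) → Fin n → ℝ) : Prop :=
  ∃ (n₀ : ℕ) (K : ℝ), ∀ n ≥ n₀, ∀ f : ℝ → ℝ, MemSobolev 1 1 f →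
    |(1 / (n : ℝ)) * ∑ i, f (t n i) - ∫ x in Icc (0 : ℝ) 1, f x| ≤
      K / n * ∫ x in Icc (0 : ℝ) 1, |derivOn 1 f x|

/-- The penalized density power divergence criterion
`(1/n) ∑ l_α(y_i, g(t_i)) + lam ∫ |g^{(m)}|²`. -/
def dpdCriterion (F : ExponentialFamily) (m : ℕ) (lam α : ℝ) {n : ℕ} (t y : Fin n → ℝ)
    (g : ℝ → ℝ) : ℝ :=
  (1 / (n : ℝ)) * ∑ i, F.dpdLoss α (y i) (g (t i)) +
    lam * ∫ x in Icc (0 : ℝ) 1, |derivOn m g x| ^ 2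

/-- `g` is a local minimizer of `L` over `W^{m,2}([0,1])`. For `lam > 0` the norms
`‖·‖_{m,lam}` are equivalent, so the choice of `lam > 0` does not matter. -/
def IsSobolevLocalMin (m : ℕ) (lam : ℝ) (L : (ℝ → ℝ) → ℝ) (g : ℝ → ℝ) : Prop :=
  MemSobolev m 2 g ∧ ∃ r > 0, ∀ h : ℝ → ℝ, MemSobolev m 2 h →
    sobolevNorm m lam (fun x => h x - g x) < r → L g ≤ L h

/-- The inner probability of an event: it equals `P E` for measurable `E`, and for a general
`E` it is the largest probability of a measurable event contained in `E` (so at most `P E`,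
the outer probability). -/
def innerProb {Ω : Type*} [MeasurableSpace Ω] (P : Measure Ω) (E : Set Ω) : ENNReal :=
  1 - P Eᶜ

end

/-! Put `s = λ^{1/(2m)}` and `R² = D (1/(ns) + λ)`. It suffices that, with probability close to one,
the criterion on the sphere `‖g - g₀‖_{m,λ} = R` exceeds its value at `g₀`: a minimizer over the
closed ball exists by weak compactness (`exists_isMinOn_sobolev_ball`), it cannot lie on the sphere
because `g₀` is a competitor, and a minimizer in the open ball is a local minimizer.

Write `h = g - g₀` and expand each loss term to second order (`exists_dpdLoss_sub_ge`). The linear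
coefficient is a centred weighted score, because the integral term of the loss differentiates to `1
+ α` times the mean of that score. The quadratic coefficient, taken at the fixed exponent `α₀`, has
mean `(1 + α₀) E f^{α₀} u²` (`integral_lossDeriv₂`), which is bounded below. The remainder is a
polynomial weight in `y` times `(|h| + |α - α₀|) h²`. Smoothness and moments come from the
exponential family itself: `b` is a cumulant generating function, hence analytic, and all
exponential moments are finite.

The random sums are controlled for all `h` at once by Hilbert space geometry, without empirical
process theory. By interpolation (`exists_sobolev_one_le`), `‖h‖² + s²‖h'‖²` is at most a constant
times `‖h‖²_{m,λ}`. In this first-order norm, evaluation at a point is an inner product with a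
vector of squared norm at most `2/s` (`exists_evaluation_vectors`). So `(1/n) ∑ Zᵢ h(tᵢ)` is at most
the norm of the random vector `(1/n) ∑ Zᵢ e(tᵢ)` times the norm of `h`, and independence makes that
vector of order `(ns)^{-1/2}`. Uniformity over the data-driven exponent follows by integrating the
derivative in the exponent (`measure_exists_vecAverage_gt_le`). Applied to `h²`, the same device
bounds the fluctuations of the quadratic coefficients and of the weights by a relative error of
order `(ns²)^{-1/2}`, which vanishes since `ns² = nλ^{1/m}` tends to infinity. The design condition
replaces the average of `h(tᵢ)²` by `‖h‖²`.

Altogether (`dpdCriterion_sub_ge`) the increment on the sphere is at least a fixed multiple of `R²`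
minus a constant times `((ns)^{-1/2} + λ^{1/2}) R`, which is positive once `D` is large. The sup
norm of `h` tends to zero, so the expansion stays valid. -/

noncomputable section

/-! ### Square integrable functions and absolute continuity on the unit interval. -/

/-- Lebesgue measure on `[0,1]`. -/
abbrev unitVolume : Measure ℝ := volume.restrict (Icc (0 : ℝ) 1)

instance : IsProbabilityMeasure unitVolume := ⟨by simp [unitVolume]⟩

/-- The squared `L²([0,1])`-norm. -/
def sqNorm (f : ℝ → ℝ) : ℝ := ∫ x in Icc (0 : ℝ) 1, f x ^ 2

lemma sqNorm_nonneg (f : ℝ → ℝ) : 0 ≤ sqNorm f := integral_nonneg fun _ => sq_nonneg _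

lemma sqNorm_congr {f g : ℝ → ℝ} (h : f =ᵐ[unitVolume] g) : sqNorm f = sqNorm g :=
  integral_congr_ae (by filter_upwards [h] with x hx; rw [hx])

/-- `f` is absolutely continuous on `[0,1]`, with derivative `p ∈ L²([0,1])`. -/
structure HasL2Deriv (f p : ℝ → ℝ) : Prop where
  ac : AbsolutelyContinuousOnInterval f 0 1
  ae_hasDerivAt : ∀ᵐ x ∂unitVolume, HasDerivAt f (p x) x
  memLp : MemLp p 2 unitVolume

lemma MeasureTheory.MemLp.mul_integrable {f g : ℝ → ℝ} {μ : Measure ℝ} (hf : MemLp f 2 μ)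
    (hg : MemLp g 2 μ) : Integrable (fun x => f x * g x) μ := hf.integrable_mul hg

lemma integral_abs_mul_le {f g : ℝ → ℝ} (hf : MemLp f 2 unitVolume) (hg : MemLp g 2 unitVolume) :
    ∫ x in Icc (0 : ℝ) 1, |f x * g x| ≤ √(sqNorm f) * √(sqNorm g) := by
  have h := integral_mul_norm_le_Lp_mul_Lq (μ := unitVolume) (f := f) (g := g)
    Real.HolderConjugate.two_two (by simpa using hf) (by simpa using hg)
  simp only [Real.norm_eq_abs, ← abs_mul, Real.rpow_ofNat, sq_abs] at h
  rwa [← Real.sqrt_eq_rpow, ← Real.sqrt_eq_rpow] at h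

lemma abs_integral_mul_le {f g : ℝ → ℝ} (hf : MemLp f 2 unitVolume) (hg : MemLp g 2 unitVolume) :
    |∫ x in Icc (0 : ℝ) 1, f x * g x| ≤ √(sqNorm f) * √(sqNorm g) :=
  (abs_integral_le_integral_abs).trans (integral_abs_mul_le hf hg)

lemma AbsolutelyContinuousOnInterval.mono_unit {f : ℝ → ℝ}
    (hf : AbsolutelyContinuousOnInterval f 0 1) {x y : ℝ} (hx : x ∈ Icc (0 : ℝ) 1)
    (hy : y ∈ Icc (0 : ℝ) 1) : AbsolutelyContinuousOnInterval f x y :=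
  hf.mono (by rw [uIcc_of_le zero_le_one]; exact uIcc_subset_Icc hx hy)

lemma ae_uIoc_of_ae_unit {P : ℝ → Prop} (h : ∀ᵐ x ∂unitVolume, P x) {x y : ℝ}
    (hx : x ∈ Icc (0 : ℝ) 1) (hy : y ∈ Icc (0 : ℝ) 1) : ∀ᵐ z, z ∈ uIoc x y → P z := by
  rw [ae_restrict_iff' measurableSet_Icc] at h
  filter_upwards [h] with z hz hzm
  exact hz (uIcc_subset_Icc hx hy (uIoc_subset_uIcc hzm))

lemma AbsolutelyContinuousOnInterval.integral_eq_sub {f p : ℝ → ℝ}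
    (hf : AbsolutelyContinuousOnInterval f 0 1) (hp : ∀ᵐ x ∂unitVolume, HasDerivAt f (p x) x)
    {x y : ℝ} (hx : x ∈ Icc (0 : ℝ) 1) (hy : y ∈ Icc (0 : ℝ) 1) :
    ∫ z in x..y, p z = f y - f x := by
  rw [← (hf.mono_unit hx hy).integral_deriv_eq_sub]
  refine intervalIntegral.integral_congr_ae ?_
  filter_upwards [ae_uIoc_of_ae_unit hp hx hy] with z hz hzm
  exact (hz hzm).deriv.symm

lemma intervalIntegrable_of_integrable_unit {p : ℝ → ℝ} (hp : Integrable p unitVolume) {x y : ℝ}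
    (hx : x ∈ Icc (0 : ℝ) 1) (hy : y ∈ Icc (0 : ℝ) 1) : IntervalIntegrable p volume x y :=
  ⟨IntegrableOn.mono_set hp (Ioc_subset_Icc_self.trans (Icc_subset_Icc hx.1 hy.2)),
    IntegrableOn.mono_set hp (Ioc_subset_Icc_self.trans (Icc_subset_Icc hy.1 hx.2))⟩

lemma integral_unit_eq (p : ℝ → ℝ) : ∫ x in Icc (0 : ℝ) 1, p x = ∫ x in (0 : ℝ)..1, p x := by
  rw [intervalIntegral.integral_of_le zero_le_one, integral_Icc_eq_integral_Ioc]

lemma abs_intervalIntegral_le_unit {p : ℝ → ℝ} (hp : Integrable p unitVolume) {x y : ℝ}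
    (hx : x ∈ Icc (0 : ℝ) 1) (hy : y ∈ Icc (0 : ℝ) 1) :
    |∫ z in x..y, p z| ≤ ∫ z in Icc (0 : ℝ) 1, |p z| := by
  have h := intervalIntegral.norm_integral_le_integral_norm_uIoc (f := p) (a := x) (b := y)
    (μ := volume)
  refine h.trans ?_
  refine setIntegral_mono_set hp.abs (ae_of_all _ fun _ => abs_nonneg _) ?_
  exact (uIoc_subset_uIcc.trans (uIcc_subset_Icc hx hy)).eventuallyLE

namespace HasL2Deriv

variable {f p q : ℝ → ℝ}

lemma integrable_deriv (h : HasL2Deriv f p) : Integrable p unitVolume :=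
  h.memLp.integrable (by norm_num)

lemma continuousOn (h : HasL2Deriv f p) : ContinuousOn f (Icc 0 1) := by
  simpa using h.ac.continuousOn

lemma memLp_self (h : HasL2Deriv f p) (r : ENNReal) : MemLp f r unitVolume := by
  have hc := h.continuousOn
  obtain ⟨C, hC⟩ := isCompact_Icc.exists_bound_of_continuousOn hc
  refine MemLp.of_bound (hc.aestronglyMeasurable measurableSet_Icc) C ?_
  exact (ae_restrict_iff' measurableSet_Icc).2 (ae_of_all _ hC)

lemma integral_eq (h : HasL2Deriv f p) {x y : ℝ} (hx : x ∈ Icc (0 : ℝ) 1)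
    (hy : y ∈ Icc (0 : ℝ) 1) : ∫ z in x..y, p z = f y - f x :=
  h.ac.integral_eq_sub h.ae_hasDerivAt hx hy

lemma congr_deriv (h : HasL2Deriv f p) (hpq : p =ᵐ[unitVolume] q) : HasL2Deriv f q :=
  ⟨h.ac, by filter_upwards [h.ae_hasDerivAt, hpq] with x hx hxq; rwa [← hxq],
    (memLp_congr_ae hpq).1 h.memLp⟩

lemma sub {f₁ f₂ p₁ p₂ : ℝ → ℝ} (h₁ : HasL2Deriv f₁ p₁) (h₂ : HasL2Deriv f₂ p₂) :
    HasL2Deriv (fun x => f₁ x - f₂ x) (fun x => p₁ x - p₂ x) :=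
  ⟨h₁.ac.fun_sub h₂.ac, by
    filter_upwards [h₁.ae_hasDerivAt, h₂.ae_hasDerivAt] with x a b using a.sub b,
    h₁.memLp.sub h₂.memLp⟩

lemma mul {f₁ f₂ p₁ p₂ : ℝ → ℝ} (h₁ : HasL2Deriv f₁ p₁) (h₂ : HasL2Deriv f₂ p₂) :
    HasL2Deriv (fun x => f₁ x * f₂ x) (fun x => p₁ x * f₂ x + f₁ x * p₂ x) := by
  refine ⟨h₁.ac.fun_mul h₂.ac, ?_, ?_⟩
  · filter_upwards [h₁.ae_hasDerivAt, h₂.ae_hasDerivAt] with x a b using a.mul b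
  · exact ((h₂.memLp_self ⊤).mul h₁.memLp).add (h₂.memLp.mul (h₁.memLp_self ⊤))

lemma sq (h : HasL2Deriv f p) :
    HasL2Deriv (fun x => f x ^ 2) (fun x => 2 * (f x * p x)) := by
  have := h.mul h
  simp only [← pow_two] at this
  exact this.congr_deriv (ae_of_all _ fun x => by ring)

/-- Integrate `(f²)' = 2 f f'` from `x` to `t`, then average over `x` in the unit interval. -/
lemma sq_le (h : HasL2Deriv f p) {t : ℝ} (ht : t ∈ Icc (0 : ℝ) 1) :
    f t ^ 2 ≤ sqNorm f + 2 * ∫ x in Icc (0 : ℝ) 1, |f x * p x| := by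
  have key : ∀ x ∈ Icc (0 : ℝ) 1,
      f t ^ 2 ≤ f x ^ 2 + 2 * ∫ z in Icc (0 : ℝ) 1, |f z * p z| := by
    intro x hx
    have h1 := h.sq.integral_eq hx ht
    have h2 := abs_intervalIntegral_le_unit h.sq.integrable_deriv hx ht
    simp only [abs_mul (2 : ℝ), abs_two] at h2
    rw [integral_const_mul] at h2
    have := le_abs_self (∫ z in x..t, 2 * (f z * p z))
    linarith
  have h3 : Integrable (fun x => f x ^ 2) unitVolume := (h.memLp_self 2).integrable_sq
  have := integral_mono_ae (μ := unitVolume) (integrable_const (f t ^ 2))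
    (h3.add (integrable_const (2 * ∫ z in Icc (0 : ℝ) 1, |f z * p z|)))
    ((ae_restrict_iff' measurableSet_Icc).2 (ae_of_all _ key))
  simp only [Pi.add_apply] at this
  rw [integral_add h3 (integrable_const _)] at this
  simpa [sqNorm] using this

/-- The pointwise inequality `2|fp| ≤ f²/s + s p²`, integrated. -/
lemma two_mul_integral_abs_mul_le (h : HasL2Deriv f p) {s : ℝ} (hs : 0 < s) :
    2 * ∫ x in Icc (0 : ℝ) 1, |f x * p x| ≤ (sqNorm f + s ^ 2 * sqNorm p) / s := by
  have h1 : Integrable (fun x => f x ^ 2) unitVolume := (h.memLp_self 2).integrable_sq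
  have h2 : Integrable (fun x => p x ^ 2) unitVolume := h.memLp.integrable_sq
  have h0 : Integrable (fun x => |f x * p x|) unitVolume :=
    ((h.memLp_self 2).integrable_mul h.memLp).abs
  have : ∫ x in Icc (0 : ℝ) 1, 2 * |f x * p x| ≤
      ∫ x in Icc (0 : ℝ) 1, (f x ^ 2 / s + s * p x ^ 2) := by
    refine integral_mono (h0.const_mul 2) ((h1.div_const s).add (h2.const_mul s)) fun x => ?_
    have h3 : 0 ≤ (|f x| - s * |p x|) ^ 2 / s := by positivity
    have h4 : (|f x| - s * |p x|) ^ 2 / s = f x ^ 2 / s + s * p x ^ 2 - 2 * |f x * p x| := by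
      rw [abs_mul]; field_simp; ring_nf; simp only [sq_abs]; ring
    linarith
  rw [integral_const_mul, integral_add (h1.div_const s) (h2.const_mul s), integral_div,
    integral_const_mul] at this
  refine this.trans_eq ?_
  simp only [sqNorm]; field_simp

/-- The sup norm costs a factor `s^{-1/2}` relative to the first-order norm at scale `s`; `s ≤ 1`
absorbs the term `‖f‖²`. -/
lemma sq_le_of_scale (h : HasL2Deriv f p) {t : ℝ} (ht : t ∈ Icc (0 : ℝ) 1) {s : ℝ} (hs : 0 < s)
    (hs1 : s ≤ 1) : f t ^ 2 ≤ 2 / s * (sqNorm f + s ^ 2 * sqNorm p) := by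
  have h1 := h.sq_le ht
  have h2 := h.two_mul_integral_abs_mul_le hs
  have h3 := sqNorm_nonneg f
  have h4 : 0 ≤ s ^ 2 * sqNorm p := mul_nonneg (sq_nonneg _) (sqNorm_nonneg p)
  have h5 : sqNorm f ≤ (sqNorm f + s ^ 2 * sqNorm p) / s := by
    rw [le_div_iff₀ hs]; nlinarith
  calc f t ^ 2 ≤ (sqNorm f + s ^ 2 * sqNorm p) / s + (sqNorm f + s ^ 2 * sqNorm p) / s := by
        linarith
    _ = _ := by ring

/-- Multiplicative version by Cauchy–Schwarz, used for the boundary terms of an integration by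
parts. -/
lemma sq_le_sqrt (h : HasL2Deriv f p) {t : ℝ} (ht : t ∈ Icc (0 : ℝ) 1) :
    f t ^ 2 ≤ sqNorm f + 2 * (√(sqNorm f) * √(sqNorm p)) := by
  have h1 := h.sq_le ht
  have h2 := integral_abs_mul_le (h.memLp_self 2) h.memLp
  linarith

end HasL2Deriv

/-! ### Interpolation between a function and its second derivative. -/

lemma le_twenty_mul_of_sq_le {q Q : ℝ} (hq : 0 ≤ q) (hQ : 0 ≤ Q)
    (h : q ^ 2 ≤ 2 * √((Q ^ 2 + 2 * (Q * q)) * (q ^ 2 + 2 * (q * Q))) + Q ^ 2) :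
    q ≤ 20 * Q := by
  -- If `Q < q/20`, the square root is at most `2q²/5`, so the right side is below `4q²/5 + q²/400 <
  -- q²`.
  by_contra! hc
  have h1 : √((Q ^ 2 + 2 * (Q * q)) * (q ^ 2 + 2 * (q * Q))) ≤ q ^ 2 * (2 / 5) := by
    refine Real.sqrt_le_iff.2 ⟨by positivity, ?_⟩
    have e1 : Q ^ 2 + 2 * (Q * q) ≤ q ^ 2 * (41 / 400) := by nlinarith
    have e2 : q ^ 2 + 2 * (q * Q) ≤ q ^ 2 * (11 / 10) := by nlinarith
    calc _ ≤ (q ^ 2 * (41 / 400)) * (q ^ 2 * (11 / 10)) := by gcongr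
      _ ≤ _ := by nlinarith [sq_nonneg (q ^ 2)]
  nlinarith

/-- Interpolation of the first derivative between a function and its second derivative. -/
lemma HasL2Deriv.sqNorm_deriv_le {f p q : ℝ → ℝ} (hf : HasL2Deriv f p) (hp : HasL2Deriv p q)
    {s : ℝ} (hs : 0 < s) (hs1 : s ≤ 1) :
    s ^ 2 * sqNorm p ≤ 800 * (sqNorm f + s ^ 4 * sqNorm q) := by
  set x := √(sqNorm f) with hx
  set P := √(sqNorm p) with hP
  set z := √(sqNorm q) with hz
  have hx0 : 0 ≤ x := Real.sqrt_nonneg _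
  have hP0 : 0 ≤ P := Real.sqrt_nonneg _
  have hz0 : 0 ≤ z := Real.sqrt_nonneg _
  have hx2 : x ^ 2 = sqNorm f := Real.sq_sqrt (sqNorm_nonneg f)
  have hP2 : P ^ 2 = sqNorm p := Real.sq_sqrt (sqNorm_nonneg p)
  have hz2 : z ^ 2 = sqNorm q := Real.sq_sqrt (sqNorm_nonneg q)
  -- Integration by parts: `∫ p² = [f p] - ∫ f q`. The boundary values have no sign and are bounded
  -- by `sq_le_sqrt` applied to `f` and to `p`.
  have hparts : sqNorm p = (f 1 * p 1 - f 0 * p 0) - ∫ y in Icc (0 : ℝ) 1, f y * q y := by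
    have h1 := (hf.mul hp).integral_eq (x := 0) (y := 1) (by simp) (by simp)
    rw [← integral_unit_eq, integral_add (hf.memLp.mul_integrable (hp.memLp_self 2))
      ((hf.memLp_self 2).mul_integrable hp.memLp)] at h1
    simp only [sqNorm, pow_two]
    linarith
  have bdry : ∀ t ∈ Icc (0 : ℝ) 1,
      |f t * p t| ≤ √((x ^ 2 + 2 * (x * P)) * (P ^ 2 + 2 * (P * z))) := by
    intro t ht
    refine Real.abs_le_sqrt ?_
    rw [mul_pow]
    have h1 := hf.sq_le_sqrt ht
    have h2 := hp.sq_le_sqrt ht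
    rw [← hx, ← hP, ← hx2] at h1
    rw [← hP, ← hz, ← hP2] at h2
    gcongr
  have hint := abs_integral_mul_le (hf.memLp_self 2) hp.memLp
  rw [← hx, ← hz] at hint
  have main : P ^ 2 ≤ 2 * √((x ^ 2 + 2 * (x * P)) * (P ^ 2 + 2 * (P * z))) + x * z := by
    have b0 := bdry 0 (by simp)
    have b1 := bdry 1 (by simp)
    rw [abs_le] at b0 b1 hint
    linarith [b0.1, b1.2, hint.1]
  have hfin : s * P ≤ 20 * (x + s ^ 2 * z) := by
    refine le_twenty_mul_of_sq_le (by positivity) (by positivity) ?_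
    set Q := x + s ^ 2 * z with hQ
    have hQ0 : 0 ≤ Q := by positivity
    have e1 : x ≤ Q := by rw [hQ]; have : 0 ≤ s ^ 2 * z := by positivity
                          linarith
    have e2 : s ^ 2 * z ≤ Q := by rw [hQ]; linarith
    -- After squaring, the factor `s⁴` is split as `s · s³`: one power goes to the bracket of `f`,
    -- three to the bracket of `p`.
    have e3 : s ^ 2 * √((x ^ 2 + 2 * (x * P)) * (P ^ 2 + 2 * (P * z))) ≤
        √((Q ^ 2 + 2 * (Q * (s * P))) * ((s * P) ^ 2 + 2 * (s * P * Q))) := by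
      refine Real.le_sqrt_of_sq_le ?_
      rw [mul_pow, Real.sq_sqrt (by positivity)]
      have e4 : s * (x ^ 2 + 2 * (x * P)) ≤ Q ^ 2 + 2 * (Q * (s * P)) := by
        have a1 : s * x ^ 2 ≤ Q ^ 2 := by
          calc s * x ^ 2 ≤ 1 * Q ^ 2 := by gcongr
            _ = _ := one_mul _
        have a2 : x * (s * P) ≤ Q * (s * P) := by gcongr
        nlinarith
      have e5 : s ^ 3 * (P ^ 2 + 2 * (P * z)) ≤ (s * P) ^ 2 + 2 * (s * P * Q) := by
        have a1 : s * (s * P) ^ 2 ≤ 1 * (s * P) ^ 2 := by gcongr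
        have a2 : s * P * (s ^ 2 * z) ≤ s * P * Q := by gcongr
        nlinarith
      calc (s ^ 2) ^ 2 * ((x ^ 2 + 2 * (x * P)) * (P ^ 2 + 2 * (P * z)))
          = (s * (x ^ 2 + 2 * (x * P))) * (s ^ 3 * (P ^ 2 + 2 * (P * z))) := by ring
        _ ≤ _ := by gcongr
    have e6 : s ^ 2 * (x * z) ≤ Q ^ 2 := by
      calc s ^ 2 * (x * z) = x * (s ^ 2 * z) := by ring
        _ ≤ Q * Q := by gcongr
        _ = _ := by ring
    calc (s * P) ^ 2 = s ^ 2 * P ^ 2 := by ring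
      _ ≤ s ^ 2 * (2 * √((x ^ 2 + 2 * (x * P)) * (P ^ 2 + 2 * (P * z))) + x * z) := by gcongr
      _ ≤ _ := by nlinarith
  rw [← hP2, ← hx2, ← hz2]
  calc s ^ 2 * P ^ 2 = (s * P) ^ 2 := by ring
    -- The constant is `800 = 2 · 20²`.
    _ ≤ (20 * (x + s ^ 2 * z)) ^ 2 := by gcongr
    _ ≤ _ := by nlinarith [sq_nonneg (x - s ^ 2 * z)]

/-! ### Point evaluation as an inner product. -/

/-- The Hilbert space `L²([0,1]) × L²([0,1])`. -/
abbrev L2Pair : Type := WithLp 2 (Lp ℝ 2 unitVolume × Lp ℝ 2 unitVolume)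

/-- The pair of two square integrable functions. -/
def l2Pair {f p : ℝ → ℝ} (hf : MemLp f 2 unitVolume) (hp : MemLp p 2 unitVolume) : L2Pair :=
  WithLp.toLp 2 (hf.toLp f, hp.toLp p)

lemma inner_toLp {f p : ℝ → ℝ} (hf : MemLp f 2 unitVolume) (hp : MemLp p 2 unitVolume) :
    inner ℝ (hf.toLp f) (hp.toLp p) = ∫ x in Icc (0 : ℝ) 1, f x * p x := by
  rw [L2.inner_def]
  refine integral_congr_ae ?_
  filter_upwards [hf.coeFn_toLp, hp.coeFn_toLp] with x h1 h2
  rw [h1, h2]; simp [mul_comm]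

lemma inner_l2Pair {f p g q : ℝ → ℝ} (hf : MemLp f 2 unitVolume) (hp : MemLp p 2 unitVolume)
    (hg : MemLp g 2 unitVolume) (hq : MemLp q 2 unitVolume) :
    inner ℝ (l2Pair hf hp) (l2Pair hg hq) =
      (∫ x in Icc (0 : ℝ) 1, f x * g x) + ∫ x in Icc (0 : ℝ) 1, p x * q x := by
  rw [WithLp.prod_inner_apply]
  simp only [l2Pair]
  rw [inner_toLp, inner_toLp]

lemma norm_sq_l2Pair {f p : ℝ → ℝ} (hf : MemLp f 2 unitVolume) (hp : MemLp p 2 unitVolume) :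
    ‖l2Pair hf hp‖ ^ 2 = sqNorm f + sqNorm p := by
  rw [← real_inner_self_eq_norm_sq, inner_l2Pair]
  simp only [sqNorm, pow_two]

lemma setIntegral_indicator_mul {a b : ℝ} (ha : a ∈ Icc (0 : ℝ) 1) (hb : b ∈ Icc (0 : ℝ) 1)
    (hab : a ≤ b) (g p : ℝ → ℝ) :
    ∫ x in Icc (0 : ℝ) 1, (Ioc a b).indicator g x * p x = ∫ x in a..b, g x * p x := by
  rw [intervalIntegral.integral_of_le hab]
  simp_rw [← indicator_mul_left]
  rw [setIntegral_indicator measurableSet_Ioc, inter_eq_right.2]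
  exact Ioc_subset_Icc_self.trans (Icc_subset_Icc ha.1 hb.2)

lemma hasL2Deriv_of_hasDerivAt {f p : ℝ → ℝ} (h : ∀ x, HasDerivAt f (p x) x)
    (hp : Continuous p) : HasL2Deriv f p := by
  refine ⟨?_, ae_of_all _ h, ?_⟩
  · refine ContDiffOn.absolutelyContinuousOnInterval (ContDiff.contDiffOn ?_)
    rw [contDiff_one_iff_deriv]
    refine ⟨fun x => (h x).differentiableAt, ?_⟩
    have : deriv f = p := funext fun x => (h x).deriv
    rwa [this]
  · obtain ⟨C, hC⟩ := isCompact_Icc.exists_bound_of_continuousOn (hp.continuousOn (s := Icc 0 1))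
    exact MemLp.of_bound hp.aestronglyMeasurable C
      ((ae_restrict_iff' measurableSet_Icc).2 (ae_of_all _ hC))

lemma memLp_of_abs_le_one {f : ℝ → ℝ} (hm : Measurable f) {C : ℝ} (h : ∀ x, |f x| ≤ C) :
    MemLp f 2 unitVolume :=
  MemLp.of_bound hm.aestronglyMeasurable C (ae_of_all _ h)

/-- Point evaluation on `W^{1,2}([0,1])`, with the norm `(‖q‖² + s² ‖q'‖²)^{1/2}`, is represented by
vectors of squared norm `O(1/s)`. -/
theorem exists_evaluation_vectors {s : ℝ} (hs : 0 < s) (hs1 : s ≤ 1) :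
    ∃ e : ℝ → L2Pair, (∀ t ∈ Icc (0 : ℝ) 1, ‖e t‖ ^ 2 ≤ 2 / s) ∧
      ∀ q p : ℝ → ℝ, HasL2Deriv q p → ∃ v : L2Pair, ‖v‖ ^ 2 = sqNorm q + s ^ 2 * sqNorm p ∧
        ∀ t ∈ Icc (0 : ℝ) 1, inner ℝ (e t) v = q t := by
  have key : ∀ t : ℝ, ∃ e : L2Pair, t ∈ Icc (0 : ℝ) 1 → ‖e‖ ^ 2 ≤ 2 / s ∧
      ∀ q p : ℝ → ℝ, ∀ h : HasL2Deriv q p,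
        inner ℝ e (l2Pair (h.memLp_self 2) (h.memLp.const_mul s)) = q t := by
    intro t
    by_cases ht : t ∈ Icc (0 : ℝ) 1
    swap
    · exact ⟨0, fun h => absurd h ht⟩
    -- This choice of `a` makes `[a, a + s]` a window of length `s` inside the unit interval that
    -- contains `t`, also near the end points.
    set a := t * (1 - s) with ha
    have ha0 : 0 ≤ a := mul_nonneg ht.1 (by linarith)
    have hat : a ≤ t := by nlinarith [ht.1]
    have hta : t ≤ a + s := by nlinarith [ht.2]
    have has : a + s ≤ 1 := by nlinarith [ht.2]
    have hs' : s ≠ 0 := hs.ne'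
    have ham : a ∈ Icc (0 : ℝ) 1 := ⟨ha0, by linarith⟩
    have hasm : a + s ∈ Icc (0 : ℝ) 1 := ⟨by linarith, has⟩
    set k : ℝ → ℝ := (Ioc a (a + s)).indicator fun _ => 1 / s with hk
    -- Representation: `q(t)` is the mean of `q` over the window plus `(1/s)` times the integrals of
    -- `(x - a) q'` before `t` and `(x - a - s) q'` after `t`. The kernels carry `1/s²` because they
    -- are paired with `s q'`.
    set κ₁ : ℝ → ℝ := (Ioc a t).indicator fun x => (x - a) / s ^ 2 with hκ₁
    set κ₂ : ℝ → ℝ := (Ioc t (a + s)).indicator fun x => (x - a - s) / s ^ 2 with hκ₂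
    have mk : Measurable k := measurable_const.indicator measurableSet_Ioc
    have mκ₁ : Measurable κ₁ :=
      Measurable.indicator (by fun_prop) measurableSet_Ioc
    have mκ₂ : Measurable κ₂ :=
      Measurable.indicator (by fun_prop) measurableSet_Ioc
    have bk : ∀ x, |k x| ≤ 1 / s := by
      intro x
      rw [hk, indicator_apply]
      split_ifs
      · rw [abs_of_pos (by positivity)]
      · simp; positivity
    have bκ₁ : ∀ x, |κ₁ x| ≤ 1 / s := by
      intro x
      rw [hκ₁, indicator_apply]
      split_ifs with hx
      · rw [abs_of_nonneg (div_nonneg (by linarith [hx.1]) (by positivity)),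
          div_le_div_iff₀ (by positivity) hs]
        nlinarith [hx.1, hx.2]
      · simp; positivity
    have bκ₂ : ∀ x, |κ₂ x| ≤ 1 / s := by
      intro x
      rw [hκ₂, indicator_apply]
      split_ifs with hx
      · rw [abs_div, abs_of_nonpos (by linarith [hx.2]), abs_of_pos (by positivity : 0 < s ^ 2),
          div_le_div_iff₀ (by positivity) hs]
        nlinarith [hx.1, hx.2]
      · simp; positivity
    have lk := memLp_of_abs_le_one mk bk
    have l1 := memLp_of_abs_le_one mκ₁ bκ₁
    have l2 := memLp_of_abs_le_one mκ₂ bκ₂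
    have nk : sqNorm k = 1 / s := by
      have : ∀ x, k x ^ 2 = (Ioc a (a + s)).indicator (fun _ => 1 / s ^ 2) x * 1 := by
        intro x; simp only [hk, indicator_apply]; split_ifs <;> simp
      simp only [sqNorm, this]
      rw [setIntegral_indicator_mul ham hasm (by linarith)]
      simp; field_simp
    -- The two kernels have disjoint supports and are bounded by `1/s` on the window, so their sum
    -- is dominated pointwise by `k`.
    have nκ : sqNorm (fun x => κ₁ x + κ₂ x) ≤ 1 / s := by
      rw [← nk]
      refine integral_mono (l1.add l2).integrable_sq lk.integrable_sq fun x => ?_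
      have b1 := bκ₁ x
      have b2 := bκ₂ x
      simp only [sq_le_sq, hk, hκ₁, hκ₂, indicator_apply, mem_Ioc] at b1 b2 ⊢
      have hpos : |1 / s| = 1 / s := abs_of_pos (by positivity)
      by_cases h1 : a < x ∧ x ≤ t
      · have h2 : ¬ (t < x ∧ x ≤ a + s) := fun h => by linarith [h.1, h1.2]
        have h3 : a < x ∧ x ≤ a + s := ⟨h1.1, h1.2.trans hta⟩
        rw [if_pos h1] at b1
        rwa [if_pos h1, if_neg h2, if_pos h3, add_zero, hpos]
      · by_cases h2 : t < x ∧ x ≤ a + s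
        · have h3 : a < x ∧ x ≤ a + s := ⟨by linarith [h2.1], h2.2⟩
          rw [if_pos h2] at b2
          rwa [if_neg h1, if_pos h2, if_pos h3, zero_add, hpos]
        · simp only [h1, h2, if_false, add_zero, abs_zero]
          exact abs_nonneg _
    refine ⟨l2Pair lk (l1.add l2), fun _ => ⟨?_, fun q p h => ?_⟩⟩
    · rw [norm_sq_l2Pair, nk]
      have : (κ₁ + κ₂) = fun x => κ₁ x + κ₂ x := rfl
      rw [this]
      calc _ ≤ 1 / s + 1 / s := by gcongr
        _ = _ := by ring
    · rw [inner_l2Pair]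
      have i1 : ∫ x in Icc (0 : ℝ) 1, k x * q x = (1 / s) * ∫ x in a..(a + s), q x := by
        rw [hk, setIntegral_indicator_mul ham hasm (by linarith),
          intervalIntegral.integral_const_mul]
      have hsp : MemLp (fun x => s * p x) 2 unitVolume := h.memLp.const_mul s
      have i2 : ∫ x in Icc (0 : ℝ) 1, (κ₁ + κ₂) x * (s * p x) =
          (1 / s) * (∫ x in a..t, (x - a) * p x) + (1 / s) * ∫ x in t..(a + s), (x - a - s) * p x := by
        simp only [Pi.add_apply, add_mul]
        rw [integral_add (l1.mul_integrable hsp) (l2.mul_integrable hsp), hκ₁, hκ₂,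
          setIntegral_indicator_mul ham ht hat, setIntegral_indicator_mul ht hasm hta,
          ← intervalIntegral.integral_const_mul, ← intervalIntegral.integral_const_mul]
        congr 1 <;> congr 1 <;> ext x <;> field_simp
      have j1 := ((hasL2Deriv_of_hasDerivAt (f := fun x => x - a) (p := fun _ => 1)
        (fun x => (hasDerivAt_id x).sub_const a) continuous_const).mul h).integral_eq ham ht
      have j2 := ((hasL2Deriv_of_hasDerivAt (f := fun x => x - a - s) (p := fun _ => 1)
        (fun x => ((hasDerivAt_id x).sub_const a).sub_const s) continuous_const).mul
          h).integral_eq ht hasm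
      have qi : ∀ {x y : ℝ}, x ∈ Icc (0 : ℝ) 1 → y ∈ Icc (0 : ℝ) 1 →
          IntervalIntegrable q volume x y := fun hx hy =>
        intervalIntegrable_of_integrable_unit ((h.memLp_self 2).integrable (by norm_num)) hx hy
      have pi : ∀ {x y : ℝ} (c : ℝ → ℝ), Continuous c → x ∈ Icc (0 : ℝ) 1 → y ∈ Icc (0 : ℝ) 1 →
          IntervalIntegrable (fun z => c z * p z) volume x y := fun c hc hx hy =>
        (intervalIntegrable_of_integrable_unit h.integrable_deriv hx hy).continuousOn_mul
          hc.continuousOn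
      simp only [one_mul] at j1 j2
      rw [intervalIntegral.integral_add (qi ham ht) (pi _ (by fun_prop) ham ht)] at j1
      rw [intervalIntegral.integral_add (qi ht hasm) (pi _ (by fun_prop) ht hasm)] at j2
      have j3 := intervalIntegral.integral_add_adjacent_intervals (qi ham ht) (qi ht hasm)
      rw [i1, i2, ← j3, ← mul_add, ← mul_add]
      rw [one_div, inv_mul_eq_iff_eq_mul₀ hs']
      linarith
  choose e he using key
  refine ⟨e, fun t ht => (he t ht).1, fun q p h =>
    ⟨l2Pair (h.memLp_self 2) (h.memLp.const_mul s), ?_, fun t ht => (he t ht).2 q p h⟩⟩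
  rw [norm_sq_l2Pair]
  simp only [sqNorm, mul_pow, integral_const_mul]

/-! ### Derivatives on the unit interval and the Sobolev spaces. -/

lemma uniqueDiffOn_unit : UniqueDiffOn ℝ (Icc (0 : ℝ) 1) := uniqueDiffOn_Icc zero_lt_one

lemma derivOn_zero (f : ℝ → ℝ) : derivOn 0 f = f := iteratedDerivWithin_zero

lemma derivOn_one (f : ℝ → ℝ) : derivOn 1 f = derivWithin f (Icc 0 1) := iteratedDerivWithin_one

lemma derivOn_succ (k : ℕ) (f : ℝ → ℝ) : derivOn (k + 1) f = derivOn k (derivOn 1 f) := by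
  rw [derivOn_one]; exact iteratedDerivWithin_succ'

lemma derivOn_congr {f g : ℝ → ℝ} (h : EqOn f g (Icc 0 1)) (k : ℕ) :
    EqOn (derivOn k f) (derivOn k g) (Icc 0 1) := iteratedDerivWithin_congr h

lemma AbsolutelyContinuousOnInterval.congr_unit {f g : ℝ → ℝ}
    (hf : AbsolutelyContinuousOnInterval f 0 1) (h : EqOn f g (Icc 0 1)) :
    AbsolutelyContinuousOnInterval g 0 1 := by
  rw [absolutelyContinuousOnInterval_iff] at hf ⊢
  intro ε hε
  obtain ⟨δ, hδ, H⟩ := hf ε hε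
  refine ⟨δ, hδ, fun E hE hd => ?_⟩
  convert H E hE hd using 1
  refine Finset.sum_congr rfl fun i hi => ?_
  have h1 := hE.1 i hi
  rw [uIcc_of_le zero_le_one] at h1
  rw [h h1.1, h h1.2]

lemma ae_unit_of_forall {P : ℝ → Prop} (h : ∀ x ∈ Icc (0 : ℝ) 1, P x) :
    ∀ᵐ x ∂unitVolume, P x := (ae_restrict_iff' measurableSet_Icc).2 (ae_of_all _ h)

lemma ae_unit_mem_Ioo : ∀ᵐ x ∂unitVolume, x ∈ Ioo (0 : ℝ) 1 := by
  rw [unitVolume, ← restrict_Ioo_eq_restrict_Icc]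
  exact ae_restrict_mem measurableSet_Ioo

lemma HasL2Deriv.derivOn_ae_eq {f p : ℝ → ℝ} (h : HasL2Deriv f p) :
    p =ᵐ[unitVolume] derivOn 1 f := by
  filter_upwards [h.ae_hasDerivAt, ae_unit_mem_Ioo] with x hx hxm
  rw [derivOn_one]
  exact (hx.hasDerivWithinAt.derivWithin (uniqueDiffOn_unit x (Ioo_subset_Icc_self hxm))).symm

lemma HasL2Deriv.self_derivOn {f p : ℝ → ℝ} (h : HasL2Deriv f p) : HasL2Deriv f (derivOn 1 f) :=
  h.congr_deriv h.derivOn_ae_eq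

lemma AbsolutelyContinuousOnInterval.ae_hasDerivAt_derivOn {f : ℝ → ℝ}
    (h : AbsolutelyContinuousOnInterval f 0 1) :
    ∀ᵐ x ∂unitVolume, HasDerivAt f (derivOn 1 f x) x := by
  have h1 : ∀ᵐ x ∂unitVolume, DifferentiableAt ℝ f x := by
    rw [ae_restrict_iff' measurableSet_Icc]
    filter_upwards [h.ae_differentiableAt] with x hx hxm
    exact hx (by rwa [uIcc_of_le zero_le_one])
  filter_upwards [h1, ae_unit_mem_Ioo] with x hx hxm
  rw [derivOn_one, hx.derivWithin (uniqueDiffOn_unit x (Ioo_subset_Icc_self hxm))]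
  exact hx.hasDerivAt

lemma memSobolev_one_iff {f : ℝ → ℝ} : MemSobolev 1 2 f ↔ HasL2Deriv f (derivOn 1 f) := by
  constructor
  · rintro ⟨-, h2, h3⟩
    rw [Nat.sub_self, derivOn_zero] at h2
    exact ⟨h2, h2.ae_hasDerivAt_derivOn, h3⟩
  · intro h
    refine ⟨?_, by simpa [derivOn_zero] using h.ac, h.memLp⟩
    simpa using (contDiffOn_zero (𝕜 := ℝ)).2 h.continuousOn

/-- Inductions on the order peel off the innermost derivative: the order drops by one and `f` is
replaced by `derivOn 1 f`. -/
lemma memSobolev_succ_iff {k : ℕ} {f : ℝ → ℝ} : MemSobolev (k + 2) 2 f ↔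
    DifferentiableOn ℝ f (Icc 0 1) ∧ MemSobolev (k + 1) 2 (derivOn 1 f) := by
  simp only [MemSobolev, Nat.add_sub_cancel, show k + 2 - 1 = k + 1 from rfl, ← derivOn_succ]
  rw [show (((k + 1 : ℕ) : ℕ∞) : WithTop ℕ∞) = ((k : ℕ∞) : WithTop ℕ∞) + 1 by push_cast; rfl,
    contDiffOn_succ_iff_derivWithin uniqueDiffOn_unit]
  rw [derivOn_one]
  simp [and_assoc]

lemma MemSobolev.hasL2Deriv {m : ℕ} (hm : 1 ≤ m) {f : ℝ → ℝ} (h : MemSobolev m 2 f) :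
    HasL2Deriv f (derivOn 1 f) := by
  obtain rfl | hm' := hm.eq_or_lt
  · exact memSobolev_one_iff.1 h
  · obtain ⟨k, rfl⟩ : ∃ k, m = k + 2 := ⟨m - 2, by omega⟩
    have h1 : ContDiffOn ℝ 1 f (Icc 0 1) := h.1.of_le (by
      norm_cast; omega)
    have hc : ContinuousOn (derivOn 1 f) (Icc 0 1) := by
      rw [derivOn_one]
      exact h1.continuousOn_derivWithin uniqueDiffOn_unit le_rfl
    have hac : AbsolutelyContinuousOnInterval f 0 1 :=
      ContDiffOn.absolutelyContinuousOnInterval (by rwa [uIcc_of_le zero_le_one])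
    refine ⟨hac, hac.ae_hasDerivAt_derivOn, ?_⟩
    obtain ⟨C, hC⟩ := isCompact_Icc.exists_bound_of_continuousOn hc
    exact MemLp.of_bound (hc.aestronglyMeasurable measurableSet_Icc) C (ae_unit_of_forall hC)

lemma MemSobolev.memLp_derivOn {m : ℕ} {f : ℝ → ℝ} (h : MemSobolev m 2 f) :
    MemLp (derivOn m f) 2 unitVolume := h.2.2

lemma MemSobolev.congr {m : ℕ} {f g : ℝ → ℝ} (hf : MemSobolev m 2 f)
    (h : EqOn f g (Icc 0 1)) : MemSobolev m 2 g :=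
  ⟨hf.1.congr fun _ hx => (h hx).symm, hf.2.1.congr_unit (derivOn_congr h _),
    (memLp_congr_ae (ae_unit_of_forall (derivOn_congr h m))).1 hf.2.2⟩

lemma derivOn_ae_congr {f g : ℝ → ℝ} (h : EqOn f g (Icc 0 1)) (k : ℕ) :
    derivOn k f =ᵐ[unitVolume] derivOn k g := ae_unit_of_forall (derivOn_congr h k)

/-- Lower derivatives subtract everywhere on the interval; the derivative of top order exists only
almost everywhere, hence the almost everywhere identity. -/
lemma MemSobolev.sub_aux {k : ℕ} : ∀ {f g : ℝ → ℝ}, MemSobolev (k + 1) 2 f →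
    MemSobolev (k + 1) 2 g → MemSobolev (k + 1) 2 (fun x => f x - g x) ∧
      derivOn (k + 1) (fun x => f x - g x) =ᵐ[unitVolume]
        fun x => derivOn (k + 1) f x - derivOn (k + 1) g x := by
  induction k with
  | zero =>
    intro f g hf hg
    have h := (memSobolev_one_iff.1 hf).sub (memSobolev_one_iff.1 hg)
    exact ⟨memSobolev_one_iff.2 h.self_derivOn, h.derivOn_ae_eq.symm⟩
  | succ k ih =>
    intro f g hf hg
    rw [memSobolev_succ_iff] at hf hg
    obtain ⟨h1, h2⟩ := ih hf.2 hg.2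
    have he : EqOn (fun x => derivOn 1 f x - derivOn 1 g x)
        (derivOn 1 fun x => f x - g x) (Icc 0 1) := by
      intro x hx
      simp only [derivOn_one]
      exact (derivWithin_fun_sub (hf.1 x hx) (hg.1 x hx)).symm
    refine ⟨memSobolev_succ_iff.2 ⟨hf.1.sub hg.1, h1.congr he⟩, ?_⟩
    simp only [derivOn_succ (k + 1)]
    exact (derivOn_ae_congr he _).symm.trans h2

lemma MemSobolev.sub {m : ℕ} (hm : 1 ≤ m) {f g : ℝ → ℝ} (hf : MemSobolev m 2 f)
    (hg : MemSobolev m 2 g) : MemSobolev m 2 (fun x => f x - g x) := by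
  obtain ⟨k, rfl⟩ : ∃ k, m = k + 1 := ⟨m - 1, by omega⟩
  exact (MemSobolev.sub_aux hf hg).1

lemma derivOn_sub {m : ℕ} (hm : 1 ≤ m) {f g : ℝ → ℝ} (hf : MemSobolev m 2 f)
    (hg : MemSobolev m 2 g) : derivOn m (fun x => f x - g x) =ᵐ[unitVolume]
      fun x => derivOn m f x - derivOn m g x := by
  obtain ⟨k, rfl⟩ : ∃ k, m = k + 1 := ⟨m - 1, by omega⟩
  exact (MemSobolev.sub_aux hf hg).2

/-! ### Interpolation of higher order and the Sobolev norms. -/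

/-- Interpolation of the first derivative between a function and its derivative of order `m`. -/
theorem exists_sqNorm_derivOn_one_le (k : ℕ) : ∃ C : ℝ, 1 ≤ C ∧ ∀ f : ℝ → ℝ,
    MemSobolev (k + 1) 2 f → ∀ s : ℝ, 0 < s → s ≤ 1 →
      s ^ 2 * sqNorm (derivOn 1 f) ≤ C * (sqNorm f + s ^ (2 * (k + 1)) *
        sqNorm (derivOn (k + 1) f)) := by
  induction k with
  | zero =>
    refine ⟨1, le_rfl, fun f _ s _ _ => ?_⟩
    have := sqNorm_nonneg f
    simp only [zero_add, mul_one, one_mul]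
    linarith
  | succ k ih =>
    obtain ⟨C, hC1, hC⟩ := ih
    -- The second-order interpolation is applied at scale `η s`, and the second derivative is
    -- removed by the induction hypothesis for `f'`. With this `η` the returning term `s²‖f'‖²` has
    -- coefficient at most `1/2` and is absorbed on the left.
    set η : ℝ := 1 / (1600 * C) with hη
    have hη0 : 0 < η := by positivity
    have hη1 : η ≤ 1 := by rw [hη, div_le_one (by positivity)]; linarith
    have hηC : 800 * η ^ 2 * C ≤ 1 / 2 := by
      have : η * C = 1 / 1600 := by rw [hη]; field_simp
      nlinarith
    refine ⟨1600 / η ^ 2, ?_, fun f hf s hs hs1 => ?_⟩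
    · rw [le_div_iff₀ (by positivity)]; nlinarith
    have hf' := (memSobolev_succ_iff.1 hf).2
    have h1 := hC _ hf' s hs hs1
    have h2 := (hf.hasL2Deriv (by omega)).sqNorm_deriv_le (hf'.hasL2Deriv (by omega))
      (s := η * s) (by positivity) (by nlinarith)
    rw [← derivOn_succ (k + 1)] at h1
    set A := sqNorm f
    set B := sqNorm (derivOn 1 f)
    set E := sqNorm (derivOn 1 (derivOn 1 f))
    set G := sqNorm (derivOn (k + 1 + 1) f)
    have hA : 0 ≤ A := sqNorm_nonneg _
    have hB : 0 ≤ B := sqNorm_nonneg _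
    have hG : 0 ≤ G := sqNorm_nonneg _
    have h3 : s ^ 2 * B ≤ 800 / η ^ 2 * A + 800 * η ^ 2 * (s ^ 2 * (s ^ 2 * E)) := by
      have : s ^ 2 * B = (η * s) ^ 2 * B / η ^ 2 := by field_simp
      rw [this, div_le_iff₀ (by positivity)]
      refine h2.trans_eq ?_
      field_simp
    have h4 : 800 * η ^ 2 * (s ^ 2 * (s ^ 2 * E)) ≤
        (1 / 2) * (s ^ 2 * B + s ^ (2 * (k + 1 + 1)) * G) := by
      calc 800 * η ^ 2 * (s ^ 2 * (s ^ 2 * E))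
          ≤ 800 * η ^ 2 * (s ^ 2 * (C * (B + s ^ (2 * (k + 1)) * G))) := by gcongr
        _ = (800 * η ^ 2 * C) * (s ^ 2 * B + s ^ (2 * (k + 1 + 1)) * G) := by ring
        _ ≤ _ := by gcongr
    have h5 : 1 ≤ 1600 / η ^ 2 := by rw [le_div_iff₀ (by positivity)]; nlinarith
    have h6 : 0 ≤ s ^ (2 * (k + 1 + 1)) * G := by positivity
    have h7 : 1600 / η ^ 2 * A = 2 * (800 / η ^ 2 * A) := by ring
    rw [mul_add, h7]
    nlinarith [mul_le_mul_of_nonneg_right h5 h6]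

/-- The norm `(‖f‖² + s² ‖f'‖²)^{1/2}` is controlled by `‖f‖_{m, s^{2m}}`. -/
theorem exists_sobolev_one_le {m : ℕ} (hm : 1 ≤ m) : ∃ C : ℝ, 1 ≤ C ∧ ∀ f : ℝ → ℝ,
    MemSobolev m 2 f → ∀ s : ℝ, 0 < s → s ≤ 1 →
      sqNorm f + s ^ 2 * sqNorm (derivOn 1 f) ≤
        C * (sqNorm f + s ^ (2 * m) * sqNorm (derivOn m f)) := by
  obtain ⟨k, rfl⟩ : ∃ k, m = k + 1 := ⟨m - 1, by omega⟩
  obtain ⟨C, hC1, hC⟩ := exists_sqNorm_derivOn_one_le k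
  refine ⟨C + 1, by linarith, fun f hf s hs hs1 => ?_⟩
  have := hC f hf s hs hs1
  have h2 : 0 ≤ s ^ (2 * (k + 1)) * sqNorm (derivOn (k + 1) f) :=
    mul_nonneg (by positivity) (sqNorm_nonneg _)
  linarith

lemma sobolevNorm_sq {m : ℕ} {lam : ℝ} (hl : 0 ≤ lam) (f : ℝ → ℝ) :
    sobolevNorm m lam f ^ 2 = sqNorm f + lam * sqNorm (derivOn m f) :=
  Real.sq_sqrt (add_nonneg (sqNorm_nonneg f) (mul_nonneg hl (sqNorm_nonneg _)))

lemma sobolevNorm_nonneg (m : ℕ) (lam : ℝ) (f : ℝ → ℝ) : 0 ≤ sobolevNorm m lam f :=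
  Real.sqrt_nonneg _

/-- The triangle inequality of `L2Pair` for `(f, √lam · p)`. The sums are required only almost
everywhere, since that is how derivatives of top order add. -/
lemma sqrt_sqNorm_add_le {F F₁ F₂ p p₁ p₂ : ℝ → ℝ} {lam : ℝ} (hl : 0 ≤ lam)
    (hF₁ : MemLp F₁ 2 unitVolume) (hF₂ : MemLp F₂ 2 unitVolume)
    (hp₁ : MemLp p₁ 2 unitVolume) (hp₂ : MemLp p₂ 2 unitVolume)
    (hF : F =ᵐ[unitVolume] fun x => F₁ x + F₂ x) (hp : p =ᵐ[unitVolume] fun x => p₁ x + p₂ x) :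
    √(sqNorm F + lam * sqNorm p) ≤
      √(sqNorm F₁ + lam * sqNorm p₁) + √(sqNorm F₂ + lam * sqNorm p₂) := by
  have key : ∀ {f q : ℝ → ℝ} (hf : MemLp f 2 unitVolume) (hq : MemLp q 2 unitVolume),
      √(sqNorm f + lam * sqNorm q) = ‖l2Pair hf (hq.const_mul (√lam))‖ := by
    intro f q hf hq
    have : sqNorm (fun x => √lam * q x) = lam * sqNorm q := by
      simp only [sqNorm, mul_pow, integral_const_mul, Real.sq_sqrt hl]
    rw [← this, ← norm_sq_l2Pair hf (hq.const_mul (√lam)), Real.sqrt_sq (norm_nonneg _)]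
  rw [sqNorm_congr (g := F₁ + F₂) hF, sqNorm_congr (g := p₁ + p₂) hp, key (hF₁.add hF₂) (hp₁.add hp₂),
    key hF₁ hp₁, key hF₂ hp₂]
  refine le_of_eq_of_le ?_ (norm_add_le _ _)
  congr 1
  simp only [l2Pair]
  rw [← WithLp.toLp_add, Prod.mk_add_mk, ← MemLp.toLp_add, ← MemLp.toLp_add]
  congr 3
  ext x; simp; ring

lemma MemSobolev.memLp_self {m : ℕ} (hm : 1 ≤ m) {f : ℝ → ℝ} (h : MemSobolev m 2 f)
    (r : ENNReal) : MemLp f r unitVolume := (h.hasL2Deriv hm).memLp_self r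

lemma sobolevNorm_sub_le {m : ℕ} (hm : 1 ≤ m) {lam : ℝ} (hl : 0 ≤ lam) {f g h : ℝ → ℝ}
    (hf : MemSobolev m 2 f) (hg : MemSobolev m 2 g) (hh : MemSobolev m 2 h) :
    sobolevNorm m lam (fun x => f x - h x) ≤
      sobolevNorm m lam (fun x => f x - g x) + sobolevNorm m lam (fun x => g x - h x) := by
  refine sqrt_sqNorm_add_le hl ((hf.sub hm hg).memLp_self hm 2) ((hg.sub hm hh).memLp_self hm 2)
    (hf.sub hm hg).memLp_derivOn (hg.sub hm hh).memLp_derivOn (ae_of_all _ fun x => by simp) ?_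
  filter_upwards [derivOn_sub hm hf hh, derivOn_sub hm hf hg, derivOn_sub hm hg hh] with x a b c
  rw [a, b, c]; ring

/-! ### Weak compactness and minimizers over Sobolev balls. -/

/-- Bounded sequences in `L²([0,1])` have weakly convergent subsequences. -/
lemma exists_weak_limit {p : ℕ → ℝ → ℝ} (hp : ∀ k, MemLp (p k) 2 unitVolume) {B : ℝ}
    (hB : ∀ k, sqNorm (p k) ≤ B) : ∃ z : ℝ → ℝ, MemLp z 2 unitVolume ∧ ∃ φ : ℕ → ℕ,
      StrictMono φ ∧ ∀ q, MemLp q 2 unitVolume →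
        Tendsto (fun k => ∫ x in Icc (0 : ℝ) 1, p (φ k) x * q x) atTop
          (𝓝 (∫ x in Icc (0 : ℝ) 1, z x * q x)) := by
  have : Fact ((2 : ENNReal) ≠ ⊤) := ⟨by norm_num⟩
  -- Sequential Banach–Alaoglu in the dual of the separable space `L²`, transported by the Riesz
  -- isometry.
  let E := Lp ℝ 2 unitVolume
  let x : ℕ → WeakDual ℝ E := fun k =>
    StrongDual.toWeakDual (InnerProductSpace.toDual ℝ E ((hp k).toLp (p k)))
  have hx : ∀ k, x k ∈ WeakDual.toStrongDual ⁻¹' Metric.closedBall (0 : StrongDual ℝ E) (√B) := by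
    intro k
    simp only [mem_preimage, mem_closedBall_zero_iff]
    change ‖InnerProductSpace.toDual ℝ E ((hp k).toLp (p k))‖ ≤ √B
    rw [LinearIsometryEquiv.norm_map]
    refine Real.le_sqrt_of_sq_le ?_
    rw [← real_inner_self_eq_norm_sq, inner_toLp]
    simpa only [sqNorm, pow_two] using hB k
  obtain ⟨y, -, φ, hφ, hlim⟩ := WeakDual.isSeqCompact_closedBall ℝ E 0 (√B) hx
  let Z : E := (InnerProductSpace.toDual ℝ E).symm (WeakDual.toStrongDual y)
  refine ⟨Z, Lp.memLp Z, φ, hφ, fun q hq => ?_⟩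
  have h1 := (WeakDual.eval_continuous (hq.toLp q)).tendsto y |>.comp hlim
  have h2 : y (hq.toLp q) = ∫ t in Icc (0 : ℝ) 1, Z t * q t := by
    have e1 : inner ℝ Z (hq.toLp q) = y (hq.toLp q) :=
      InnerProductSpace.toDual_symm_apply
    have e2 := inner_toLp (Lp.memLp Z) hq
    rw [Lp.toLp_coeFn] at e2
    rw [← e1, e2]
  rw [h2] at h1
  refine h1.congr fun k => ?_
  have e1 : x (φ k) (hq.toLp q) = inner ℝ ((hp (φ k)).toLp (p (φ k))) (hq.toLp q) := rfl
  simp only [Function.comp_apply]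
  rw [e1, inner_toLp]

lemma hasL2Deriv_integral {z : ℝ → ℝ} (hz : MemLp z 2 unitVolume) (a : ℝ) :
    HasL2Deriv (fun x => a + ∫ t in (0 : ℝ)..x, z t) z := by
  have hi : IntervalIntegrable z volume 0 1 :=
    intervalIntegrable_of_integrable_unit (hz.integrable (by norm_num)) (by simp) (by simp)
  refine ⟨?_, ?_, hz⟩
  · have hc : AbsolutelyContinuousOnInterval (fun _ : ℝ => a) 0 1 :=
      (hasL2Deriv_of_hasDerivAt (fun x => hasDerivAt_const x a) continuous_const).ac
    exact hc.fun_add (hi.absolutelyContinuousOnInterval_intervalIntegral (by simp))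
  · rw [ae_restrict_iff' measurableSet_Icc]
    filter_upwards [hi.ae_hasDerivAt_integral] with x hx hxm
    rw [uIcc_of_le zero_le_one] at hx
    exact (hx hxm 0 (by simp)).const_add a

lemma HasL2Deriv.eq_add_integral {f p : ℝ → ℝ} (h : HasL2Deriv f p) {x : ℝ}
    (hx : x ∈ Icc (0 : ℝ) 1) : f x = f 0 + ∫ t in (0 : ℝ)..x, p t := by
  rw [h.integral_eq (by simp) hx]; ring

/-- Weak compactness of bounded sets of `W^{m,2}([0,1])`: a bounded sequence has a subsequence
converging pointwise, with weakly convergent derivatives of order `m`. -/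
theorem exists_sobolev_limit (k : ℕ) : ∀ {g : ℕ → ℝ → ℝ} {B : ℝ},
    (∀ j, MemSobolev (k + 1) 2 (g j)) →
    (∀ j, sqNorm (g j) + sqNorm (derivOn (k + 1) (g j)) ≤ B) →
    ∃ (G : ℝ → ℝ) (φ : ℕ → ℕ), StrictMono φ ∧ MemSobolev (k + 1) 2 G ∧
      (∀ x ∈ Icc (0 : ℝ) 1, Tendsto (fun j => g (φ j) x) atTop (𝓝 (G x))) ∧
      ∀ q, MemLp q 2 unitVolume →
        Tendsto (fun j => ∫ x in Icc (0 : ℝ) 1, derivOn (k + 1) (g (φ j)) x * q x) atTop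
          (𝓝 (∫ x in Icc (0 : ℝ) 1, derivOn (k + 1) G x * q x)) := by
  have zero_subseq : ∀ {k : ℕ} {g : ℕ → ℝ → ℝ} {B : ℝ},
      (∀ j, MemSobolev (k + 1) 2 (g j)) →
      (∀ j, sqNorm (g j) + sqNorm (derivOn (k + 1) (g j)) ≤ B) →
      ∃ C : ℝ, ∀ j, ∀ t ∈ Icc (0 : ℝ) 1, |g j t| ≤ C := by
    intro k g B hg hB
    obtain ⟨C, hC1, hC⟩ := exists_sobolev_one_le (m := k + 1) (by omega)
    refine ⟨√(2 * (C * B)), fun j t ht => Real.abs_le_sqrt ?_⟩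
    have h1 := ((hg j).hasL2Deriv (by omega)).sq_le_of_scale ht one_pos le_rfl
    have h2 := hC _ (hg j) 1 one_pos le_rfl
    simp only [one_pow, one_mul, div_one] at h1 h2
    have h3 : C * (sqNorm (g j) + sqNorm (derivOn (k + 1) (g j))) ≤ C * B := by
      gcongr; exact hB j
    linarith
  induction k with
  | zero =>
    intro g B hg hB
    obtain ⟨C, hC⟩ := zero_subseq hg hB
    obtain ⟨z, hz, φ₁, hφ₁, hw⟩ := exists_weak_limit (p := fun j => derivOn 1 (g j)) (B := B)
      (fun j => (hg j).memLp_derivOn) (fun j => by linarith [hB j, sqNorm_nonneg (g j)])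
    obtain ⟨a, -, φ₂, hφ₂, ha⟩ := tendsto_subseq_of_bounded (Metric.isBounded_Icc (-C) C)
      (x := fun j => g (φ₁ j) 0) (fun j => abs_le.1 (hC (φ₁ j) 0 (by simp)))
    have hG := hasL2Deriv_integral hz a
    refine ⟨_, φ₁ ∘ φ₂, hφ₁.comp hφ₂, memSobolev_one_iff.2 hG.self_derivOn, ?_, ?_⟩
    · intro x hx
      -- Testing weak convergence against the indicator of `(0, x]`, together with convergence of
      -- the values at `0`, gives pointwise convergence.
      have hq : MemLp ((Ioc 0 x).indicator fun _ => (1 : ℝ)) 2 unitVolume :=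
        memLp_of_abs_le_one (C := 1) (measurable_const.indicator measurableSet_Ioc) fun y => by
          rw [indicator_apply]; split_ifs <;> simp
      have e : ∀ p : ℝ → ℝ, ∫ y in Icc (0 : ℝ) 1, p y * (Ioc 0 x).indicator (fun _ => (1 : ℝ)) y =
          ∫ y in (0 : ℝ)..x, p y := by
        intro p
        simp_rw [mul_comm (p _)]
        rw [setIntegral_indicator_mul (by simp) hx hx.1]
        simp
      have h1 := (hw _ hq).comp hφ₂.tendsto_atTop
      simp only [e] at h1
      refine (ha.add h1).congr fun j => ?_
      simp only [Function.comp_apply]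
      exact (((memSobolev_one_iff.1 (hg _))).eq_add_integral hx).symm
    · intro q hq
      have h1 := (hw _ hq).comp hφ₂.tendsto_atTop
      have e : ∫ x in Icc (0 : ℝ) 1, z x * q x = ∫ x in Icc (0 : ℝ) 1,
          derivOn 1 (fun x => a + ∫ t in (0 : ℝ)..x, z t) x * q x := by
        refine integral_congr_ae ?_
        filter_upwards [hG.derivOn_ae_eq] with x hx
        rw [hx]
      rw [e] at h1
      exact h1
  | succ k ih =>
    intro g B hg hB
    obtain ⟨C, hC⟩ := zero_subseq hg hB
    have hg' : ∀ j, MemSobolev (k + 1) 2 (derivOn 1 (g j)) := fun j =>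
      (memSobolev_succ_iff.1 (hg j)).2
    obtain ⟨C₁, hC₁1, hC₁⟩ := exists_sobolev_one_le (m := k + 1 + 1) (by omega)
    have hB' : ∀ j, sqNorm (derivOn 1 (g j)) + sqNorm (derivOn (k + 1) (derivOn 1 (g j))) ≤
        C₁ * B + B := by
      intro j
      have h1 := hC₁ _ (hg j) 1 one_pos le_rfl
      simp only [one_pow, one_mul] at h1
      have h2 : C₁ * (sqNorm (g j) + sqNorm (derivOn (k + 1 + 1) (g j))) ≤ C₁ * B := by
        gcongr; exact hB j
      rw [← derivOn_succ]
      linarith [hB j, sqNorm_nonneg (g j)]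
    obtain ⟨C', hC'⟩ := zero_subseq hg' hB'
    obtain ⟨w, φ₁, hφ₁, hw, hlim, hweak⟩ := ih hg' hB'
    obtain ⟨a, -, φ₂, hφ₂, ha⟩ := tendsto_subseq_of_bounded (Metric.isBounded_Icc (-C) C)
      (x := fun j => g (φ₁ j) 0) (fun j => abs_le.1 (hC (φ₁ j) 0 (by simp)))
    have hwc : ContinuousOn w (Icc 0 1) := (hw.hasL2Deriv (by omega)).continuousOn
    -- The limit of the derivatives is extended continuously beyond the interval, so that its
    -- primitive is differentiable at the end points too.
    set W : ℝ → ℝ := IccExtend zero_le_one ((Icc (0 : ℝ) 1).domRestrict w) with hW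
    have hWc : Continuous W := (hwc.domRestrict).Icc_extend'
    have hWw : EqOn w W (Icc 0 1) := fun x hx => by
      rw [hW, IccExtend_of_mem _ _ hx]; rfl
    set G : ℝ → ℝ := fun x => a + ∫ t in (0 : ℝ)..x, W t with hG
    have hGd : ∀ x, HasDerivAt G (W x) x := fun x =>
      ((hWc.integral_hasStrictDerivAt 0 x).hasDerivAt).const_add a
    have hGW : EqOn W (derivOn 1 G) (Icc 0 1) := fun x hx => by
      rw [derivOn_one]
      exact ((hGd x).hasDerivWithinAt.derivWithin (uniqueDiffOn_unit x hx)).symm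
    have hwG := hWw.trans hGW
    refine ⟨G, φ₁ ∘ φ₂, hφ₁.comp hφ₂, memSobolev_succ_iff.2
      ⟨fun x _ => (hGd x).differentiableAt.differentiableWithinAt, hw.congr hwG⟩, ?_, ?_⟩
    · intro x hx
      have h0x : uIoc 0 x ⊆ Icc (0 : ℝ) 1 :=
        uIoc_subset_uIcc.trans (uIcc_subset_Icc (by simp) hx)
      have h1 : Tendsto (fun j => ∫ t in (0 : ℝ)..x, derivOn 1 (g (φ₁ (φ₂ j))) t) atTop
          (𝓝 (∫ t in (0 : ℝ)..x, W t)) := by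
        refine intervalIntegral.tendsto_integral_filter_of_dominated_convergence (fun _ => C')
          (Eventually.of_forall fun j => ?_) (Eventually.of_forall fun j => ae_of_all _ fun t ht =>
            hC' _ t (h0x ht)) intervalIntegrable_const (ae_of_all _ fun t ht => ?_)
        · exact (((hg' _).memLp_self (by omega) 2).1).mono_measure
            (Measure.restrict_mono_set _ h0x)
        · rw [← hWw (h0x ht)]
          exact (hlim t (h0x ht)).comp hφ₂.tendsto_atTop
      refine (ha.add h1).congr fun j => ?_
      exact (((hg _).hasL2Deriv (by omega)).eq_add_integral hx).symm
    · intro q hq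
      have h1 := (hweak q hq).comp hφ₂.tendsto_atTop
      have e : ∫ x in Icc (0 : ℝ) 1, derivOn (k + 1) w x * q x = ∫ x in Icc (0 : ℝ) 1,
          derivOn (k + 1 + 1) G x * q x := by
        refine integral_congr_ae ?_
        filter_upwards [derivOn_ae_congr hwG (k + 1)] with x hx
        rw [hx, ← derivOn_succ]
      rw [e] at h1
      simp only [derivOn_succ (k + 1)] at h1 ⊢
      exact h1

lemma sqNorm_le_two_mul {f g h : ℝ → ℝ} (hf : MemLp f 2 unitVolume) (hg : MemLp g 2 unitVolume)
    (hh : h =ᵐ[unitVolume] fun x => f x - g x) : sqNorm f ≤ 2 * sqNorm h + 2 * sqNorm g := by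
  rw [sqNorm_congr hh]
  simp only [sqNorm]
  have h1 : Integrable (fun x => (f x - g x) ^ 2) unitVolume := (hf.sub hg).integrable_sq
  rw [← integral_const_mul, ← integral_const_mul,
    ← integral_add (h1.const_mul 2) (hg.integrable_sq.const_mul 2)]
  refine integral_mono hf.integrable_sq ((h1.const_mul 2).add (hg.integrable_sq.const_mul 2))
    fun x => ?_
  simp only
  nlinarith [sq_nonneg (f x - 2 * g x)]

/-- Expand `∫ (f - g)² ≥ 0`. The left side is affine in `f` and equals `‖g‖²` at `f = g`, which
gives weak lower semicontinuity of the squared norm. -/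
lemma two_mul_integral_mul_sub_le {f g : ℝ → ℝ} (hf : MemLp f 2 unitVolume)
    (hg : MemLp g 2 unitVolume) :
    2 * (∫ x in Icc (0 : ℝ) 1, f x * g x) - sqNorm g ≤ sqNorm f := by
  have h1 : 0 ≤ ∫ x in Icc (0 : ℝ) 1, (f x - g x) ^ 2 := integral_nonneg fun x => sq_nonneg _
  have e : ∀ x, (f x - g x) ^ 2 = f x ^ 2 - 2 * (f x * g x) + g x ^ 2 := fun x => by ring
  simp only [e] at h1
  have i1 : Integrable (fun x => f x ^ 2 - 2 * (f x * g x)) unitVolume :=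
    hf.integrable_sq.sub ((hf.mul_integrable hg).const_mul 2)
  rw [integral_add i1 hg.integrable_sq,
    integral_sub hf.integrable_sq ((hf.mul_integrable hg).const_mul 2), integral_const_mul] at h1
  simp only [sqNorm]
  linarith

lemma sqNorm_eq_integral_mul (f : ℝ → ℝ) : sqNorm f = ∫ x in Icc (0 : ℝ) 1, f x * f x := by
  simp only [sqNorm, pow_two]

lemma sobolevNorm_self_sub {m : ℕ} (hm : 1 ≤ m) {lam : ℝ} (hl : 0 ≤ lam) {g₀ : ℝ → ℝ}
    (hg₀ : MemSobolev m 2 g₀) : sobolevNorm m lam (fun x => g₀ x - g₀ x) = 0 := by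
  have h1 : sqNorm (fun x => g₀ x - g₀ x) = 0 := by simp [sqNorm]
  have h2 : sqNorm (derivOn m fun x => g₀ x - g₀ x) = 0 := by
    rw [sqNorm_congr (derivOn_sub hm hg₀ hg₀)]; simp [sqNorm]
  have h3 : sobolevNorm m lam (fun x => g₀ x - g₀ x) ^ 2 = 0 := by
    rw [sobolevNorm_sq hl, h1, h2]; simp
  exact pow_eq_zero_iff two_ne_zero |>.1 h3

/-- A continuous function of finitely many point values plus the roughness penalty attains its
minimum over closed balls of `W^{m,2}([0,1])`. -/
theorem exists_isMinOn_sobolev_ball {m : ℕ} (hm : 1 ≤ m) {lam R : ℝ} (hl : 0 < lam) (hR : 0 ≤ R)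
    {g₀ : ℝ → ℝ} (hg₀ : MemSobolev m 2 g₀) {n : ℕ} {t : Fin n → ℝ}
    (ht : ∀ i, t i ∈ Icc (0 : ℝ) 1) {Φ : (Fin n → ℝ) → ℝ} (hΦ : Continuous Φ) :
    ∃ g : ℝ → ℝ, MemSobolev m 2 g ∧ sobolevNorm m lam (fun x => g x - g₀ x) ≤ R ∧
      ∀ h : ℝ → ℝ, MemSobolev m 2 h → sobolevNorm m lam (fun x => h x - g₀ x) ≤ R →
        Φ (fun i => g (t i)) + lam * sqNorm (derivOn m g) ≤
          Φ (fun i => h (t i)) + lam * sqNorm (derivOn m h) := by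
  obtain ⟨k, rfl⟩ : ∃ k, m = k + 1 := ⟨m - 1, by omega⟩
  set L : (ℝ → ℝ) → ℝ := fun h => Φ (fun i => h (t i)) + lam * sqNorm (derivOn (k + 1) h) with hL
  -- The infimum is taken in the extended reals, so no lower bound on `Φ` is needed beforehand; one
  -- follows when the limit attains it.
  set A : Set EReal := {y | ∃ h : ℝ → ℝ, MemSobolev (k + 1) 2 h ∧
    sobolevNorm (k + 1) lam (fun x => h x - g₀ x) ≤ R ∧ y = ((L h : ℝ) : EReal)} with hA
  have hself := sobolevNorm_self_sub hm hl.le hg₀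
  have hAne : A.Nonempty := ⟨_, g₀, hg₀, by rw [hself]; exact hR, rfl⟩
  obtain ⟨u, -, hulim, hu⟩ := exists_seq_tendsto_sInf hAne (OrderBot.bddBelow A)
  choose g hg hgR hgu using hu
  have hgR' : ∀ j, sqNorm (fun x => g j x - g₀ x) +
      lam * sqNorm (derivOn (k + 1) fun x => g j x - g₀ x) ≤ R ^ 2 := fun j => by
    rw [← sobolevNorm_sq hl.le]
    exact pow_le_pow_left₀ (sobolevNorm_nonneg _ _ _) (hgR j) 2
  have hg₀L := hg₀.memLp_self hm 2
  have hgB : ∀ j, sqNorm (g j) + sqNorm (derivOn (k + 1) (g j)) ≤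
      2 * R ^ 2 + 2 * sqNorm g₀ + (2 * (R ^ 2 / lam) + 2 * sqNorm (derivOn (k + 1) g₀)) := by
    intro j
    have h1 := sqNorm_le_two_mul ((hg j).memLp_self hm 2) hg₀L
      (h := fun x => g j x - g₀ x) (ae_of_all _ fun x => rfl)
    have h2 := sqNorm_le_two_mul (hg j).memLp_derivOn hg₀.memLp_derivOn (derivOn_sub hm (hg j) hg₀)
    have h3 := sqNorm_nonneg (fun x => g j x - g₀ x)
    have h4 := sqNorm_nonneg (derivOn (k + 1) fun x => g j x - g₀ x)
    have h5 : sqNorm (derivOn (k + 1) fun x => g j x - g₀ x) ≤ R ^ 2 / lam := by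
      rw [le_div_iff₀ hl]; linarith [hgR' j]
    have h6 : sqNorm (fun x => g j x - g₀ x) ≤ R ^ 2 := by
      nlinarith [hgR' j, mul_nonneg hl.le h4]
    linarith
  obtain ⟨G, φ, hφ, hG, hpt, hweak⟩ := exists_sobolev_limit k hg hgB
  have hGD := hG.memLp_derivOn
  have hgD := fun j => (hg j).memLp_derivOn
  refine ⟨G, hG, ?_, fun h hh hhR => ?_⟩
  · have hGg := (hG.sub hm hg₀).memLp_self hm 2
    have hDsub : sqNorm (derivOn (k + 1) fun x => G x - g₀ x) =
        sqNorm (fun x => derivOn (k + 1) G x - derivOn (k + 1) g₀ x) :=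
      sqNorm_congr (derivOn_sub hm hG hg₀)
    have hd : MemLp (fun x => derivOn (k + 1) G x - derivOn (k + 1) g₀ x) 2 unitVolume :=
      hGD.sub hg₀.memLp_derivOn
    obtain ⟨C, hC⟩ : ∃ C : ℝ, ∀ j, ∀ x ∈ Icc (0 : ℝ) 1, |g j x - g₀ x| ≤ C := by
      obtain ⟨C, hC1, hC⟩ := exists_sobolev_one_le hm
      refine ⟨√(2 * (C * (R ^ 2 + R ^ 2 / lam))), fun j x hx => Real.abs_le_sqrt ?_⟩
      have hs := (hg j).sub hm hg₀
      have h1 := (hs.hasL2Deriv hm).sq_le_of_scale hx one_pos le_rfl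
      have h2 := hC _ hs 1 one_pos le_rfl
      simp only [one_pow, one_mul, div_one] at h1 h2
      have h3 := sqNorm_nonneg (fun x => g j x - g₀ x)
      have h4 := sqNorm_nonneg (derivOn (k + 1) fun x => g j x - g₀ x)
      have h5 : sqNorm (derivOn (k + 1) fun x => g j x - g₀ x) ≤ R ^ 2 / lam := by
        rw [le_div_iff₀ hl]; linarith [hgR' j]
      have h6 : sqNorm (fun x => g j x - g₀ x) ≤ R ^ 2 := by
        nlinarith [hgR' j, mul_nonneg hl.le h4]
      refine h1.trans ((mul_le_mul_of_nonneg_left h2 zero_le_two).trans ?_)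
      gcongr
    -- The limit stays in the ball: the `L²` part converges by dominated convergence, and the
    -- penalty part is weakly lower semicontinuous.
    have l1 : Tendsto (fun j => sqNorm fun x => g (φ j) x - g₀ x) atTop
        (𝓝 (sqNorm fun x => G x - g₀ x)) := by
      refine tendsto_integral_of_dominated_convergence (fun _ => C ^ 2)
        (fun j => (((hg _).sub hm hg₀).memLp_self hm 2).integrable_sq.1) (integrable_const _)
        (fun j => ae_unit_of_forall fun x hx => ?_) (ae_unit_of_forall fun x hx => ?_)
      · rw [Real.norm_eq_abs, abs_pow]
        exact pow_le_pow_left₀ (abs_nonneg _) (hC _ x hx) 2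
      · exact ((hpt x hx).sub_const _).pow 2
    have l2 := (hweak _ hd).sub_const
      (∫ x in Icc (0 : ℝ) 1, derivOn (k + 1) g₀ x *
        (derivOn (k + 1) G x - derivOn (k + 1) g₀ x))
    have e2 : ∀ {p : ℝ → ℝ}, MemLp p 2 unitVolume →
        (∫ x in Icc (0 : ℝ) 1, p x * (derivOn (k + 1) G x - derivOn (k + 1) g₀ x)) -
        (∫ x in Icc (0 : ℝ) 1, derivOn (k + 1) g₀ x *
          (derivOn (k + 1) G x - derivOn (k + 1) g₀ x)) =
        ∫ x in Icc (0 : ℝ) 1, (p x - derivOn (k + 1) g₀ x) *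
          (derivOn (k + 1) G x - derivOn (k + 1) g₀ x) := by
      intro p hp
      rw [← integral_sub (hp.mul_integrable hd) (hg₀.memLp_derivOn.mul_integrable hd)]
      simp only [sub_mul]
    simp only [e2 (hgD _), e2 hGD, ← sqNorm_eq_integral_mul] at l2
    have l3 := l1.add (((l2.const_mul 2).sub_const
      (sqNorm fun x => derivOn (k + 1) G x - derivOn (k + 1) g₀ x)).const_mul lam)
    have l4 := le_of_tendsto' l3 (b := R ^ 2) fun j => by
      refine le_trans ?_ (hgR' (φ j))
      gcongr
      rw [sqNorm_congr (derivOn_sub hm (hg (φ j)) hg₀)]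
      exact two_mul_integral_mul_sub_le ((hgD _).sub hg₀.memLp_derivOn) hd
    refine Real.sqrt_le_iff.2 ⟨hR, ?_⟩
    change sqNorm (fun x => G x - g₀ x) +
      lam * sqNorm (derivOn (k + 1) fun x => G x - g₀ x) ≤ R ^ 2
    rw [hDsub]
    linarith
  · have l1 : Tendsto (fun j => Φ fun i => g (φ j) (t i)) atTop (𝓝 (Φ fun i => G (t i))) :=
      (hΦ.tendsto _).comp (tendsto_pi_nhds.2 fun i => hpt _ (ht i))
    have l2 := ((hweak _ hGD).const_mul 2).sub_const (sqNorm (derivOn (k + 1) G))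
    rw [← sqNorm_eq_integral_mul] at l2
    have l3 := l1.add (l2.const_mul lam)
    have e3 : Φ (fun i => G (t i)) + lam * (2 * sqNorm (derivOn (k + 1) G) -
        sqNorm (derivOn (k + 1) G)) = L G := by rw [hL]; ring
    rw [e3] at l3
    have l4 : Tendsto (fun j => ((Φ (fun i => g (φ j) (t i)) + lam * (2 *
        (∫ x in Icc (0 : ℝ) 1, derivOn (k + 1) (g (φ j)) x * derivOn (k + 1) G x) -
          sqNorm (derivOn (k + 1) G)) : ℝ) : EReal)) atTop (𝓝 ((L G : ℝ) : EReal)) :=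
      (continuous_coe_real_ereal.tendsto _).comp l3
    have l5 : ((L G : ℝ) : EReal) ≤ sInf A := by
      refine le_of_tendsto_of_tendsto' l4 (hulim.comp hφ.tendsto_atTop) fun j => ?_
      rw [Function.comp_apply, hgu, EReal.coe_le_coe_iff]
      simp only [hL]
      gcongr
      exact two_mul_integral_mul_sub_le (hgD _) hGD
    exact EReal.coe_le_coe_iff.1 (l5.trans (sInf_le ⟨h, hh, hhR, rfl⟩))

/-! ### Moments and smoothness in the exponential family. -/

namespace ExponentialFamily

variable (F : ExponentialFamily)

/-- The polynomial weight dominating the derivatives of the density powers. -/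
def weight (y : ℝ) : ℝ := (1 + |y|) ^ 3

lemma one_le_weight (y : ℝ) : 1 ≤ weight y := one_le_pow₀ (by linarith [abs_nonneg y])

lemma weight_nonneg (y : ℝ) : 0 ≤ weight y := zero_le_one.trans (one_le_weight y)

lemma one_add_abs_pow_le_weight {k : ℕ} (hk : k ≤ 3) (y : ℝ) : (1 + |y|) ^ k ≤ weight y :=
  pow_le_pow_right₀ (by linarith [abs_nonneg y]) hk

lemma measurable_weight : Measurable weight := by unfold weight; fun_prop

lemma density_of_mem {y : ℝ} (hy : y ∈ F.carrier) (θ : ℝ) :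
    F.density θ y = Real.exp (y * θ - F.b θ + F.c y) := indicator_of_mem hy _

lemma density_of_notMem {y : ℝ} (hy : y ∉ F.carrier) (θ : ℝ) : F.density θ y = 0 :=
  indicator_of_notMem hy _

lemma density_nonneg (θ y : ℝ) : 0 ≤ F.density θ y :=
  indicator_nonneg (fun _ _ => (Real.exp_pos _).le) _

lemma measurable_density (θ : ℝ) : Measurable (F.density θ) := by
  have := F.measurable_c
  exact Measurable.indicator (by fun_prop) F.measurableSet_carrier

lemma lintegral_density (θ : ℝ) : ∫⁻ y, ENNReal.ofReal (F.density θ y) ∂F.ref = 1 :=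
  F.lintegral_eq_one θ

lemma integrable_density (θ : ℝ) : Integrable (F.density θ) F.ref := by
  refine ⟨(F.measurable_density θ).aestronglyMeasurable, ?_⟩
  rw [hasFiniteIntegral_iff_ofReal (ae_of_all _ (F.density_nonneg θ)), lintegral_density]
  exact ENNReal.one_lt_top

lemma integral_density (θ : ℝ) : ∫ y, F.density θ y ∂F.ref = 1 := by
  rw [integral_eq_lintegral_of_nonneg_ae (ae_of_all _ (F.density_nonneg θ))
    (F.measurable_density θ).aestronglyMeasurable, lintegral_density, ENNReal.toReal_one]

instance isProbabilityMeasure_law (θ : ℝ) : IsProbabilityMeasure (F.law θ) :=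
  ⟨by rw [law, withDensity_apply _ MeasurableSet.univ, setLIntegral_univ, lintegral_density]⟩

lemma integral_law (θ : ℝ) (g : ℝ → ℝ) :
    ∫ y, g y ∂F.law θ = ∫ y, F.density θ y * g y ∂F.ref := by
  rw [law, integral_withDensity_eq_integral_toReal_smul (F.measurable_density θ).ennreal_ofReal
    (ae_of_all _ fun _ => ENNReal.ofReal_lt_top)]
  simp only [ENNReal.toReal_ofReal (F.density_nonneg θ _), smul_eq_mul]

lemma integrable_law_iff (θ : ℝ) (g : ℝ → ℝ) :
    Integrable g (F.law θ) ↔ Integrable (fun y => F.density θ y * g y) F.ref := by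
  rw [law, integrable_withDensity_iff_integrable_smul' (F.measurable_density θ).ennreal_ofReal
    (ae_of_all _ fun _ => ENNReal.ofReal_lt_top)]
  simp only [ENNReal.toReal_ofReal (F.density_nonneg θ _), smul_eq_mul]

lemma density_eq_exp_mul (θ θ' y : ℝ) :
    F.density θ y = Real.exp (y * (θ - θ') - F.b θ + F.b θ') * F.density θ' y := by
  by_cases hy : y ∈ F.carrier
  · rw [density_of_mem F hy, density_of_mem F hy, ← Real.exp_add]; ring_nf
  · rw [density_of_notMem F hy, density_of_notMem F hy, mul_zero]

/-- Exponential tilting shifts the natural parameter. As every real parameter is admissible, all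
exponential moments are finite. -/
lemma density_mul_exp (θ s y : ℝ) :
    F.density θ y * Real.exp (s * y) = Real.exp (F.b (θ + s) - F.b θ) * F.density (θ + s) y := by
  rw [F.density_eq_exp_mul (θ + s) θ, ← mul_assoc, ← Real.exp_add, mul_comm]
  congr 2; ring

lemma integrable_exp_law (θ s : ℝ) : Integrable (fun y => Real.exp (s * y)) (F.law θ) := by
  rw [integrable_law_iff]
  simp only [density_mul_exp]
  exact (F.integrable_density _).const_mul _

lemma cgf_law_zero (θ : ℝ) : cgf id (F.law 0) θ = F.b θ - F.b 0 := by
  rw [cgf, mgf, integral_law]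
  simp only [id, density_mul_exp, zero_add]
  rw [integral_const_mul, integral_density, mul_one, Real.log_exp]

/-- Up to an additive constant `b` is the cumulant generating function of the law at parameter `0`,
which is analytic because its moment generating function is finite everywhere. -/
lemma contDiff_b : ContDiff ℝ 3 F.b := by
  have h : integrableExpSet id (F.law 0) = univ :=
    eq_univ_of_forall fun s => F.integrable_exp_law 0 s
  have h1 : ∀ θ, AnalyticAt ℝ (cgf id (F.law 0)) θ := fun θ =>
    analyticAt_cgf (by rw [h, interior_univ]; trivial)
  have h2 : F.b = fun θ => cgf id (F.law 0) θ + F.b 0 := by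
    ext θ; rw [cgf_law_zero]; ring
  rw [h2]
  exact (contDiff_iff_contDiffAt.2 fun θ => (h1 θ).contDiffAt).add contDiff_const

/-- The mean `b'`. -/
def b₁ : ℝ → ℝ := deriv F.b

/-- The variance `b''`. -/
def b₂ : ℝ → ℝ := deriv F.b₁

/-- The third derivative of `b`. -/
def b₃ : ℝ → ℝ := deriv F.b₂

lemma contDiff_b₁ : ContDiff ℝ 2 F.b₁ :=
  (contDiff_succ_iff_deriv (n := 2).1 (by simpa using! F.contDiff_b)).2.2

lemma contDiff_b₂ : ContDiff ℝ 1 F.b₂ :=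
  (contDiff_succ_iff_deriv (n := 1).1 (by simpa using! F.contDiff_b₁)).2.2

lemma continuous_b₃ : Continuous F.b₃ := (contDiff_one_iff_deriv.1 F.contDiff_b₂).2

lemma hasDerivAt_b (θ : ℝ) : HasDerivAt F.b (F.b₁ θ) θ :=
  (F.contDiff_b.differentiable (by norm_num) θ).hasDerivAt

lemma hasDerivAt_b₁ (θ : ℝ) : HasDerivAt F.b₁ (F.b₂ θ) θ :=
  (F.contDiff_b₁.differentiable (by norm_num) θ).hasDerivAt

lemma hasDerivAt_b₂ (θ : ℝ) : HasDerivAt F.b₂ (F.b₃ θ) θ :=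
  (F.contDiff_b₂.differentiable (by norm_num) θ).hasDerivAt

lemma continuous_density (y : ℝ) : Continuous fun θ => F.density θ y := by
  have := F.contDiff_b.continuous
  by_cases hy : y ∈ F.carrier
  · simp only [density_of_mem F hy]; fun_prop
  · simp only [density_of_notMem F hy]; fun_prop

lemma score_of_mem {y : ℝ} (hy : y ∈ F.carrier) (θ : ℝ) : F.score θ y = y - F.b₁ θ := by
  simp only [score, density_of_mem F hy, Real.log_exp]
  have := (((hasDerivAt_id θ).const_mul y).sub (F.hasDerivAt_b θ)).add_const (F.c y)
  simpa using this.deriv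

/-- On compact parameter sets the densities have a common envelope with finite moments. -/
lemma exists_density_le (A₁ A₂ : ℝ) : ∃ C : ℝ, 0 ≤ C ∧ ∀ θ ∈ Icc A₁ A₂, ∀ y,
    F.density θ y ≤ C * (F.density A₁ y + F.density A₂ y) := by
  obtain ⟨M, hM⟩ := isCompact_Icc.exists_bound_of_continuousOn
    (F.contDiff_b.continuous.continuousOn (s := Icc A₁ A₂))
  refine ⟨Real.exp (2 * M), (Real.exp_pos _).le, fun θ hθ y => ?_⟩
  have h1 := F.density_nonneg A₁ y
  have h2 := F.density_nonneg A₂ y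
  have hA : A₁ ≤ A₂ := hθ.1.trans hθ.2
  have m0 := abs_le.1 (hM θ hθ)
  have m1 := abs_le.1 (hM A₁ ⟨le_rfl, hA⟩)
  have m2 := abs_le.1 (hM A₂ ⟨hA, le_rfl⟩)
  have hC := (Real.exp_pos (2 * M)).le
  rw [mul_add]
  -- `y θ` is monotone in `θ`, so its maximum over the interval is at the left end for `y ≤ 0` and
  -- at the right end for `y ≥ 0`.
  rcases le_total y 0 with hy | hy
  · rw [F.density_eq_exp_mul θ A₁]
    have : Real.exp (y * (θ - A₁) - F.b θ + F.b A₁) ≤ Real.exp (2 * M) := by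
      apply Real.exp_le_exp.2
      have := mul_nonpos_of_nonpos_of_nonneg hy (sub_nonneg.2 hθ.1)
      linarith [m0.1, m1.2]
    nlinarith [mul_le_mul_of_nonneg_right this h1, mul_nonneg hC h2]
  · rw [F.density_eq_exp_mul θ A₂]
    have : Real.exp (y * (θ - A₂) - F.b θ + F.b A₂) ≤ Real.exp (2 * M) := by
      apply Real.exp_le_exp.2
      have := mul_nonpos_of_nonneg_of_nonpos hy (sub_nonpos.2 hθ.2)
      linarith [m0.1, m2.2]
    nlinarith [mul_le_mul_of_nonneg_right this h2, mul_nonneg hC h1]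

lemma one_add_abs_pow_le_exp (k : ℕ) (y : ℝ) :
    (1 + |y|) ^ k ≤ k.factorial * Real.exp 1 * (Real.exp (1 * y) + Real.exp (-1 * y)) := by
  have h1 := Real.pow_div_factorial_le_exp (1 + |y|) (by positivity) k
  rw [div_le_iff₀ (by positivity), Real.exp_add] at h1
  have h2 : Real.exp |y| ≤ Real.exp (1 * y) + Real.exp (-1 * y) := by
    rcases abs_cases y with h | h
    · rw [h.1, one_mul]; linarith [Real.exp_pos (-1 * y)]
    · rw [h.1, neg_one_mul]; linarith [Real.exp_pos (1 * y)]
  calc (1 + |y|) ^ k ≤ k.factorial * Real.exp 1 * Real.exp |y| := by linarith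
    _ ≤ _ := by gcongr

lemma integrable_pow_law (k : ℕ) (θ : ℝ) : Integrable (fun y => (1 + |y|) ^ k) (F.law θ) := by
  refine Integrable.mono' (((F.integrable_exp_law θ 1).add
    (F.integrable_exp_law θ (-1))).const_mul (k.factorial * Real.exp 1))
    (by fun_prop) (ae_of_all _ fun y => ?_)
  rw [Real.norm_eq_abs, abs_of_nonneg (by positivity)]
  exact one_add_abs_pow_le_exp k y

lemma integrable_density_mul_pow (k : ℕ) (θ : ℝ) :
    Integrable (fun y => F.density θ y * (1 + |y|) ^ k) F.ref :=
  (F.integrable_law_iff θ _).1 (F.integrable_pow_law k θ)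

lemma exists_moment_le (A₁ A₂ : ℝ) (k : ℕ) : ∃ C : ℝ, 0 ≤ C ∧ ∀ θ ∈ Icc A₁ A₂,
    ∫ y, (1 + |y|) ^ k ∂F.law θ ≤ C := by
  obtain ⟨C, hC0, hC⟩ := F.exists_density_le A₁ A₂
  have i1 := F.integrable_density_mul_pow k A₁
  have i2 := F.integrable_density_mul_pow k A₂
  refine ⟨∫ y, C * (F.density A₁ y * (1 + |y|) ^ k + F.density A₂ y * (1 + |y|) ^ k) ∂F.ref,
    integral_nonneg fun y => ?_, fun θ hθ => ?_⟩
  · have h1 := F.density_nonneg A₁ y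
    have h2 := F.density_nonneg A₂ y
    simp only [Pi.zero_apply]
    positivity
  · rw [integral_law]
    refine integral_mono (F.integrable_density_mul_pow k θ) ((i1.add i2).const_mul C) fun y => ?_
    simp only
    rw [← add_mul, ← mul_assoc]
    exact mul_le_mul_of_nonneg_right (hC θ hθ y) (by positivity)

/-- Near zero a positive power beats the logarithm, with constant `1/a ≤ 1/p`; above `1` the
logarithm is at most the bound `D`. Taking `D ≥ 1` makes `D ^ a` increasing in the exponent. -/
lemma rpow_mul_log_le {p q B : ℝ} (hp : 0 < p) : ∃ E : ℝ, 0 ≤ E ∧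
    ∀ x, 0 ≤ x → x ≤ B → ∀ a ∈ Icc p q, x ^ a ≤ E ∧ x ^ a * |Real.log x| ≤ E := by
  set D := max B 1 with hD
  have hD1 : 1 ≤ D := le_max_right _ _
  have hD0 : 0 ≤ D := by linarith
  refine ⟨D ^ q * D + 1 / p, by positivity, fun x hx hxB a ha => ?_⟩
  have ha0 : 0 < a := hp.trans_le ha.1
  have hxD : x ≤ D := hxB.trans (le_max_left _ _)
  have h1 : x ^ a ≤ D ^ q :=
    (Real.rpow_le_rpow hx hxD ha0.le).trans (Real.rpow_le_rpow_of_exponent_le hD1 ha.2)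
  have hDq : 0 ≤ D ^ q := by positivity
  have hp1 : 0 ≤ 1 / p := by positivity
  constructor
  · nlinarith
  · rcases hx.eq_or_lt with rfl | hx
    · simp; positivity
    rcases le_total x 1 with h | h
    · have := Real.abs_log_mul_self_rpow_lt x a hx h ha0
      rw [abs_mul, abs_of_nonneg (by positivity : 0 ≤ x ^ a)] at this
      have h3 : 1 / a ≤ 1 / p := one_div_le_one_div_of_le hp ha.1
      have h4 : 0 ≤ D ^ q * D := by positivity
      linarith
    · have h2 : |Real.log x| ≤ D := by
        rw [abs_of_nonneg (Real.log_nonneg h)]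
        linarith [Real.log_le_self hx.le]
      have := mul_le_mul h1 h2 (abs_nonneg _) hDq
      linarith

end ExponentialFamily

/-! ### Taylor expansion of second order. -/

lemma abs_sub_sub_le_of_hasDerivAt {g g₁ : ℝ → ℝ} {A₁ A₂ c κ x₀ x : ℝ}
    (hg : ∀ x ∈ Icc A₁ A₂, HasDerivAt g (g₁ x) x) (hx₀ : x₀ ∈ Icc A₁ A₂) (hx : x ∈ Icc A₁ A₂)
    (h : ∀ z ∈ uIcc x₀ x, |g₁ z - c| ≤ κ) : |g x - g x₀ - c * (x - x₀)| ≤ κ * |x - x₀| := by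
  have hsub : uIcc x₀ x ⊆ Icc A₁ A₂ := uIcc_subset_Icc hx₀ hx
  have := (convex_uIcc x₀ x).norm_image_sub_le_of_norm_hasDerivWithin_le
    (f := fun z => g z - c * z) (f' := fun z => g₁ z - c) (C := κ)
    (fun z hz => ((hg z (hsub hz)).sub
      (by simpa using (hasDerivAt_id z).const_mul c)).hasDerivWithinAt) h
    left_mem_uIcc right_mem_uIcc
  simp only [Real.norm_eq_abs] at this
  convert this using 2; ring

/-- Second order Taylor expansion with a remainder controlled by the oscillation of the second
derivative. -/
lemma abs_taylor_two_le {g g₁ g₂ : ℝ → ℝ} {A₁ A₂ c κ x₀ x : ℝ}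
    (hg : ∀ x ∈ Icc A₁ A₂, HasDerivAt g (g₁ x) x) (hg₁ : ∀ x ∈ Icc A₁ A₂, HasDerivAt g₁ (g₂ x) x)
    (hx₀ : x₀ ∈ Icc A₁ A₂) (hx : x ∈ Icc A₁ A₂) (hκ : 0 ≤ κ)
    (h : ∀ z ∈ uIcc x₀ x, |g₂ z - c| ≤ κ) :
    |g x - g x₀ - g₁ x₀ * (x - x₀) - c / 2 * (x - x₀) ^ 2| ≤ κ * (x - x₀) ^ 2 := by
  have hsub : uIcc x₀ x ⊆ Icc A₁ A₂ := uIcc_subset_Icc hx₀ hx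
  have h1 : ∀ z ∈ uIcc x₀ x, |g₁ z - g₁ x₀ - c * (z - x₀)| ≤ κ * |x - x₀| := by
    intro z hz
    refine (abs_sub_sub_le_of_hasDerivAt hg₁ hx₀ (hsub hz) fun y hy =>
      h y (uIcc_subset_uIcc left_mem_uIcc hz hy)).trans ?_
    exact mul_le_mul_of_nonneg_left (abs_sub_left_of_mem_uIcc hz) hκ
  -- The mean value inequality once more, now for `g - (c/2)(· - x₀)²`. Since `c` need not be `g₂
  -- x₀`, it may later be a second derivative at another exponent.
  have h2 := abs_sub_sub_le_of_hasDerivAt (A₁ := A₁) (A₂ := A₂)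
    (g := fun z => g z - c / 2 * (z - x₀) ^ 2) (g₁ := fun z => g₁ z - c * (z - x₀))
    (c := g₁ x₀) (κ := κ * |x - x₀|) (x₀ := x₀) (x := x)
    (fun z hz => (hg z hz).sub (by
      have := ((((hasDerivAt_id z).sub_const x₀).pow 2).const_mul (c / 2))
      refine this.congr_deriv ?_
      simp; ring)) hx₀ hx (fun z hz => by
        have := h1 z hz
        rwa [show g₁ z - g₁ x₀ - c * (z - x₀) = g₁ z - c * (z - x₀) - g₁ x₀ by ring] at this)
  rw [mul_assoc, abs_mul_abs_self] at h2
  convert h2 using 2 <;> ring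

/-! ### Derivatives of the density powers in the parameter and in the exponent. -/

namespace ExponentialFamily

variable (F : ExponentialFamily)

/-- The second derivative of `f_θ(y)^a` in `θ`. -/
def powDeriv₂ (a θ y : ℝ) : ℝ := F.density θ y ^ a * (a ^ 2 * (y - F.b₁ θ) ^ 2 - a * F.b₂ θ)

lemma log_density {y : ℝ} (hy : y ∈ F.carrier) (θ : ℝ) :
    Real.log (F.density θ y) = y * θ - F.b θ + F.c y := by
  rw [F.density_of_mem hy, Real.log_exp]

lemma density_rpow {y : ℝ} (hy : y ∈ F.carrier) (θ a : ℝ) :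
    F.density θ y ^ a = Real.exp (a * Real.log (F.density θ y)) := by
  rw [Real.rpow_def_of_pos (by rw [F.density_of_mem hy]; exact Real.exp_pos _), mul_comm]

lemma density_rpow_of_notMem {y : ℝ} (hy : y ∉ F.carrier) (θ : ℝ) {a : ℝ} (ha : 0 < a) :
    F.density θ y ^ a = 0 := by
  rw [F.density_of_notMem hy, Real.zero_rpow ha.ne']

lemma hasDerivAt_log_density {y : ℝ} (hy : y ∈ F.carrier) (θ : ℝ) :
    HasDerivAt (fun θ => Real.log (F.density θ y)) (y - F.b₁ θ) θ := by
  simp only [F.log_density hy]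
  simpa using (((hasDerivAt_id θ).const_mul y).sub (F.hasDerivAt_b θ)).add_const (F.c y)

lemma hasDerivAt_density_rpow {y : ℝ} (hy : y ∈ F.carrier) (a θ : ℝ) :
    HasDerivAt (fun θ => F.density θ y ^ a) (a * F.density θ y ^ a * (y - F.b₁ θ)) θ := by
  simp only [F.density_rpow hy]
  refine ((F.hasDerivAt_log_density hy θ).const_mul a).exp.congr_deriv ?_
  ring

lemma hasDerivAt_density_rpow_deriv {y : ℝ} (hy : y ∈ F.carrier) (a θ : ℝ) :
    HasDerivAt (fun θ => a * F.density θ y ^ a * (y - F.b₁ θ)) (F.powDeriv₂ a θ y) θ := by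
  refine (((F.hasDerivAt_density_rpow hy a θ).const_mul a).mul
    ((F.hasDerivAt_b₁ θ).const_sub y)).congr_deriv ?_
  simp only [powDeriv₂]; ring

lemma hasDerivAt_powDeriv₂ {y : ℝ} (hy : y ∈ F.carrier) (a θ : ℝ) :
    HasDerivAt (fun θ => F.powDeriv₂ a θ y) (F.density θ y ^ a *
      (a ^ 3 * (y - F.b₁ θ) ^ 3 - 3 * a ^ 2 * (y - F.b₁ θ) * F.b₂ θ - a * F.b₃ θ)) θ := by
  refine ((F.hasDerivAt_density_rpow hy a θ).mul
    (((((F.hasDerivAt_b₁ θ).const_sub y).pow 2).const_mul (a ^ 2)).sub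
      ((F.hasDerivAt_b₂ θ).const_mul a))).congr_deriv ?_
  simp; ring

lemma hasDerivAt_rpow_exponent {y : ℝ} (hy : y ∈ F.carrier) (a θ : ℝ) :
    HasDerivAt (fun a => F.density θ y ^ a)
      (F.density θ y ^ a * Real.log (F.density θ y)) a := by
  simp only [F.density_rpow hy]
  refine ((hasDerivAt_id a).mul_const (Real.log (F.density θ y))).exp.congr_deriv ?_
  simp

lemma hasDerivAt_powDeriv₂_exponent {y : ℝ} (hy : y ∈ F.carrier) (a θ : ℝ) :
    HasDerivAt (fun a => F.powDeriv₂ a θ y)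
      (F.density θ y ^ a * Real.log (F.density θ y) *
        (a ^ 2 * (y - F.b₁ θ) ^ 2 - a * F.b₂ θ) +
        F.density θ y ^ a * (2 * a * (y - F.b₁ θ) ^ 2 - F.b₂ θ)) a := by
  refine ((F.hasDerivAt_rpow_exponent hy a θ).mul
    ((((hasDerivAt_id a).pow 2).mul_const ((y - F.b₁ θ) ^ 2)).sub
      ((hasDerivAt_id a).mul_const (F.b₂ θ)))).congr_deriv ?_
  simp

/-- A common bound for the exponents and for the derivatives of `b` on a compact set. -/
structure DerivBound (A₁ A₂ p q M : ℝ) : Prop where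
  one_le : 1 ≤ M
  pos : 0 < p
  exponent_le : q ≤ M
  abs_sub_le : ∀ θ ∈ Icc A₁ A₂, ∀ y, |y - F.b₁ θ| ≤ M * (1 + |y|)
  abs_b₂_le : ∀ θ ∈ Icc A₁ A₂, |F.b₂ θ| ≤ M
  abs_b₃_le : ∀ θ ∈ Icc A₁ A₂, |F.b₃ θ| ≤ M

lemma exists_derivBound (A₁ A₂ : ℝ) {p : ℝ} (hp : 0 < p) (q : ℝ) :
    ∃ M, F.DerivBound A₁ A₂ p q M := by
  obtain ⟨M₁, h₁⟩ := (isCompact_Icc (a := A₁) (b := A₂)).exists_bound_of_continuousOn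
    F.contDiff_b₁.continuous.continuousOn
  obtain ⟨M₂, h₂⟩ := (isCompact_Icc (a := A₁) (b := A₂)).exists_bound_of_continuousOn
    F.contDiff_b₂.continuous.continuousOn
  obtain ⟨M₃, h₃⟩ := (isCompact_Icc (a := A₁) (b := A₂)).exists_bound_of_continuousOn
    F.continuous_b₃.continuousOn
  set M := 1 + |q| + |M₁| + |M₂| + |M₃| with hM
  have a0 := abs_nonneg q
  have a1 := abs_nonneg M₁
  have a2 := abs_nonneg M₂
  have a3 := abs_nonneg M₃
  refine ⟨M, by linarith, hp, by linarith [le_abs_self q], fun θ hθ y => ?_, fun θ hθ => ?_,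
    fun θ hθ => ?_⟩
  · have e1 : |y - F.b₁ θ| ≤ |y| + |F.b₁ θ| := abs_sub _ _
    have e2 : |F.b₁ θ| ≤ M₁ := h₁ θ hθ
    have e3 := le_abs_self M₁
    have e4 : 1 ≤ M := by linarith
    nlinarith [abs_nonneg y]
  · exact (h₂ θ hθ).trans (by linarith [le_abs_self M₂])
  · exact (h₃ θ hθ).trans (by linarith [le_abs_self M₃])

variable {F} {A₁ A₂ p q M : ℝ}

/-- These are the polynomial factors multiplying density powers in the third and second parameter
derivatives and in the exponent derivative of the latter. Their degree in `y` is at most three,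
which is the reason for the cubic weight. -/
lemma DerivBound.poly_bounds (h : F.DerivBound A₁ A₂ p q M) {a θ y : ℝ} (ha : a ∈ Icc p q)
    (hθ : θ ∈ Icc A₁ A₂) :
    |a ^ 3 * (y - F.b₁ θ) ^ 3 - 3 * a ^ 2 * (y - F.b₁ θ) * F.b₂ θ - a * F.b₃ θ| ≤
        5 * M ^ 6 * weight y ∧
      |a ^ 2 * (y - F.b₁ θ) ^ 2 - a * F.b₂ θ| ≤ 2 * M ^ 6 * weight y ∧
      |2 * a * (y - F.b₁ θ) ^ 2 - F.b₂ θ| ≤ 3 * M ^ 6 * weight y := by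
  have hM := h.one_le
  have hM0 : 0 ≤ M := by linarith
  have ha0 : 0 ≤ a := h.pos.le.trans ha.1
  have haM : a ≤ M := ha.2.trans h.exponent_le
  have h1 := h.abs_sub_le θ hθ y
  have h2 := h.abs_b₂_le θ hθ
  have h3 := h.abs_b₃_le θ hθ
  have hw : ∀ {k j : ℕ}, j ≤ 6 → k ≤ 3 → M ^ j * (1 + |y|) ^ k ≤ M ^ 6 * weight y :=
    fun hj hk => mul_le_mul (pow_le_pow_right₀ hM hj) (one_add_abs_pow_le_weight hk y)
      (by positivity) (by positivity)
  have t1 : |a ^ 3 * (y - F.b₁ θ) ^ 3| ≤ M ^ 6 * weight y := by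
    rw [abs_mul, abs_pow, abs_pow, abs_of_nonneg ha0]
    calc a ^ 3 * |y - F.b₁ θ| ^ 3 ≤ M ^ 3 * (M * (1 + |y|)) ^ 3 := by gcongr
      _ = M ^ 6 * (1 + |y|) ^ 3 := by ring
      _ ≤ _ := hw le_rfl le_rfl
  have t2 : |3 * a ^ 2 * (y - F.b₁ θ) * F.b₂ θ| ≤ 3 * (M ^ 6 * weight y) := by
    rw [abs_mul, abs_mul, abs_of_nonneg (by positivity : 0 ≤ 3 * a ^ 2)]
    calc 3 * a ^ 2 * |y - F.b₁ θ| * |F.b₂ θ| ≤ 3 * M ^ 2 * (M * (1 + |y|)) * M := by gcongr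
      _ = 3 * (M ^ 4 * (1 + |y|) ^ 1) := by ring
      _ ≤ _ := mul_le_mul_of_nonneg_left (hw (by norm_num) (by norm_num)) (by norm_num)
  have t3 : |a * F.b₃ θ| ≤ M ^ 6 * weight y := by
    rw [abs_mul, abs_of_nonneg ha0]
    calc a * |F.b₃ θ| ≤ M * M := by gcongr
      _ = M ^ 2 * (1 + |y|) ^ 0 := by ring
      _ ≤ _ := hw (by norm_num) (by norm_num)
  have t4 : |a ^ 2 * (y - F.b₁ θ) ^ 2| ≤ M ^ 6 * weight y := by
    rw [abs_mul, abs_pow, abs_pow, abs_of_nonneg ha0]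
    calc a ^ 2 * |y - F.b₁ θ| ^ 2 ≤ M ^ 2 * (M * (1 + |y|)) ^ 2 := by gcongr
      _ = M ^ 4 * (1 + |y|) ^ 2 := by ring
      _ ≤ _ := hw (by norm_num) (by norm_num)
  have t5 : |a * F.b₂ θ| ≤ M ^ 6 * weight y := by
    rw [abs_mul, abs_of_nonneg ha0]
    calc a * |F.b₂ θ| ≤ M * M := by gcongr
      _ = M ^ 2 * (1 + |y|) ^ 0 := by ring
      _ ≤ _ := hw (by norm_num) (by norm_num)
  have t6 : |2 * a * (y - F.b₁ θ) ^ 2| ≤ 2 * (M ^ 6 * weight y) := by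
    rw [abs_mul, abs_pow, abs_of_nonneg (by positivity : 0 ≤ 2 * a)]
    calc 2 * a * |y - F.b₁ θ| ^ 2 ≤ 2 * M * (M * (1 + |y|)) ^ 2 := by gcongr
      _ = 2 * (M ^ 3 * (1 + |y|) ^ 2) := by ring
      _ ≤ _ := mul_le_mul_of_nonneg_left (hw (by norm_num) (by norm_num)) (by norm_num)
  have t7 : |F.b₂ θ| ≤ M ^ 6 * weight y :=
    h2.trans (by simpa using hw (j := 1) (k := 0) (by norm_num) (by norm_num))
  refine ⟨?_, ?_, ?_⟩
  · have := (abs_sub (a ^ 3 * (y - F.b₁ θ) ^ 3 - 3 * a ^ 2 * (y - F.b₁ θ) * F.b₂ θ) (a * F.b₃ θ))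
    have := abs_sub (a ^ 3 * (y - F.b₁ θ) ^ 3) (3 * a ^ 2 * (y - F.b₁ θ) * F.b₂ θ)
    linarith
  · have := abs_sub (a ^ 2 * (y - F.b₁ θ) ^ 2) (a * F.b₂ θ)
    linarith
  · have := abs_sub (2 * a * (y - F.b₁ θ) ^ 2) (F.b₂ θ)
    linarith

/-- `E` bounds the density powers at `y` and their products with the log-density. -/
def PowBound (F : ExponentialFamily) (A₁ A₂ p q y E : ℝ) : Prop :=
  ∀ a ∈ Icc p q, ∀ θ ∈ Icc A₁ A₂, F.density θ y ^ a ≤ E ∧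
    F.density θ y ^ a * |Real.log (F.density θ y)| ≤ E

lemma density_rpow_nonneg (F : ExponentialFamily) (θ y a : ℝ) : 0 ≤ F.density θ y ^ a :=
  Real.rpow_nonneg (F.density_nonneg θ y) a

lemma DerivBound.abs_powDeriv₂_le (h : F.DerivBound A₁ A₂ p q M) {y E a θ : ℝ}
    (hE : PowBound F A₁ A₂ p q y E) (ha : a ∈ Icc p q) (hθ : θ ∈ Icc A₁ A₂) :
    |F.powDeriv₂ a θ y| ≤ 2 * M ^ 6 * (E * weight y) := by
  rw [powDeriv₂, abs_mul, abs_of_nonneg (F.density_rpow_nonneg θ y a)]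
  have h1 := (h.poly_bounds (y := y) ha hθ).2.1
  have h2 := (hE a ha θ hθ).1
  calc _ ≤ E * (2 * M ^ 6 * weight y) :=
        mul_le_mul h2 h1 (abs_nonneg _) ((F.density_rpow_nonneg θ y a).trans h2)
    _ = _ := by ring

/-- Move the parameter at fixed exponent, then the exponent at fixed parameter. The second move
produces a logarithm of the density, hence the second half of `PowBound`. -/
lemma DerivBound.abs_powDeriv₂_sub_le (h : F.DerivBound A₁ A₂ p q M) {y E a a₀ θ θ₀ : ℝ}
    (hy : y ∈ F.carrier) (hE : PowBound F A₁ A₂ p q y E) (ha : a ∈ Icc p q) (ha₀ : a₀ ∈ Icc p q)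
    (hθ : θ ∈ Icc A₁ A₂) (hθ₀ : θ₀ ∈ Icc A₁ A₂) :
    |F.powDeriv₂ a θ y - F.powDeriv₂ a₀ θ₀ y| ≤
      5 * M ^ 6 * (E * weight y) * (|θ - θ₀| + |a - a₀|) := by
  have hnn := F.density_rpow_nonneg
  have hE0 : 0 ≤ E := (hnn θ y a).trans (hE a ha θ hθ).1
  have e1 : |F.powDeriv₂ a θ y - F.powDeriv₂ a θ₀ y| ≤
      5 * M ^ 6 * (E * weight y) * |θ - θ₀| := by
    have := abs_sub_sub_le_of_hasDerivAt (c := 0) (κ := 5 * M ^ 6 * (E * weight y))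
      (fun x _ => F.hasDerivAt_powDeriv₂ hy a x) hθ₀ hθ (fun z hz => ?_)
    · simpa using this
    · have hz' := uIcc_subset_Icc hθ₀ hθ hz
      rw [sub_zero, abs_mul, abs_of_nonneg (hnn z y a)]
      calc _ ≤ E * (5 * M ^ 6 * weight y) :=
            mul_le_mul (hE a ha z hz').1 (h.poly_bounds ha hz').1 (abs_nonneg _) hE0
        _ = _ := by ring
  have e2 : |F.powDeriv₂ a θ₀ y - F.powDeriv₂ a₀ θ₀ y| ≤
      5 * M ^ 6 * (E * weight y) * |a - a₀| := by
    have := abs_sub_sub_le_of_hasDerivAt (c := 0) (κ := 5 * M ^ 6 * (E * weight y))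
      (fun x _ => F.hasDerivAt_powDeriv₂_exponent hy x θ₀) ha₀ ha (fun z hz => ?_)
    · simpa using this
    · have hz' := uIcc_subset_Icc ha₀ ha hz
      rw [sub_zero]
      refine (abs_add_le _ _).trans ?_
      rw [abs_mul, abs_mul, abs_mul, abs_of_nonneg (hnn θ₀ y z)]
      calc _ ≤ E * (2 * M ^ 6 * weight y) + E * (3 * M ^ 6 * weight y) :=
            add_le_add
              (mul_le_mul (hE z hz' θ₀ hθ₀).2 (h.poly_bounds hz' hθ₀).2.1 (abs_nonneg _) hE0)
              (mul_le_mul (hE z hz' θ₀ hθ₀).1 (h.poly_bounds hz' hθ₀).2.2 (abs_nonneg _) hE0)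
        _ = _ := by ring
  calc _ ≤ |F.powDeriv₂ a θ y - F.powDeriv₂ a θ₀ y| +
        |F.powDeriv₂ a θ₀ y - F.powDeriv₂ a₀ θ₀ y| := _root_.abs_sub_le _ _ _
    _ ≤ _ := by rw [mul_add]; exact add_le_add e1 e2

/-- Second order expansion of the density powers in the parameter. -/
lemma DerivBound.abs_pow_taylor_le (h : F.DerivBound A₁ A₂ p q M) {y E a a₀ θ θ₀ : ℝ}
    (hE : PowBound F A₁ A₂ p q y E) (ha : a ∈ Icc p q) (ha₀ : a₀ ∈ Icc p q)
    (hθ : θ ∈ Icc A₁ A₂) (hθ₀ : θ₀ ∈ Icc A₁ A₂) :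
    |F.density θ y ^ a - F.density θ₀ y ^ a - a * F.density θ₀ y ^ a * (y - F.b₁ θ₀) * (θ - θ₀) -
      F.powDeriv₂ a₀ θ₀ y / 2 * (θ - θ₀) ^ 2| ≤
      5 * M ^ 6 * (E * weight y) * (|θ - θ₀| + |a - a₀|) * (θ - θ₀) ^ 2 := by
  have hE0 : 0 ≤ E := (F.density_rpow_nonneg θ y a).trans (hE a ha θ hθ).1
  have hM := h.one_le
  have hw := weight_nonneg y
  by_cases hy : y ∈ F.carrier
  · refine abs_taylor_two_le (fun x _ => F.hasDerivAt_density_rpow hy a x)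
      (fun x _ => F.hasDerivAt_density_rpow_deriv hy a x) hθ₀ hθ (by positivity) fun z hz => ?_
    have hz' := uIcc_subset_Icc hθ₀ hθ hz
    refine (h.abs_powDeriv₂_sub_le hy hE ha ha₀ hz' hθ₀).trans ?_
    exact mul_le_mul_of_nonneg_left (add_le_add_left (abs_sub_left_of_mem_uIcc hz) _)
      (by positivity)
  -- Off the carrier every density power vanishes, since the exponents are positive, and so does the
  -- whole left side.
  · simp only [powDeriv₂, F.density_rpow_of_notMem hy _ (h.pos.trans_le ha.1),
      F.density_rpow_of_notMem hy _ (h.pos.trans_le ha₀.1)]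
    simp only [mul_zero, zero_mul, sub_zero, zero_div, abs_zero]
    positivity

end ExponentialFamily

/-! ### Expansion of the density power divergence loss. -/

namespace ExponentialFamily

variable (F : ExponentialFamily)

/-- The weighted score `f_θ(y)^a u_θ(y)`. -/
def powScore (a θ y : ℝ) : ℝ := F.density θ y ^ a * (y - F.b₁ θ)

/-- The derivative of the weighted score in the exponent. -/
def powScoreDeriv (a θ y : ℝ) : ℝ :=
  F.density θ y ^ a * Real.log (F.density θ y) * (y - F.b₁ θ)

/-- The second derivative of the density power divergence loss in the parameter. -/
def lossDeriv₂ (α θ y : ℝ) : ℝ :=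
  (∫ x, F.powDeriv₂ (1 + α) θ x ∂F.ref) - (1 + 1 / α) * F.powDeriv₂ α θ y

lemma measurable_powDeriv₂ (a θ : ℝ) : Measurable (F.powDeriv₂ a θ) := by
  have := F.measurable_density θ
  unfold powDeriv₂; fun_prop

lemma measurable_powScore (a θ : ℝ) : Measurable (F.powScore a θ) := by
  have := F.measurable_density θ
  unfold powScore; fun_prop

lemma measurable_powScoreDeriv_uncurry (θ : ℝ) :
    Measurable fun z : ℝ × ℝ => F.powScoreDeriv z.1 θ z.2 := by
  have := F.measurable_density θ
  unfold powScoreDeriv; fun_prop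

lemma measurable_lossDeriv₂ (α θ : ℝ) : Measurable (F.lossDeriv₂ α θ) := by
  have := F.measurable_powDeriv₂ α θ
  unfold lossDeriv₂; fun_prop

/-- The envelope of the densities over a compact set of parameters. -/
def envelope (C A₁ A₂ y : ℝ) : ℝ := C * (F.density A₁ y + F.density A₂ y)

lemma integrable_envelope_mul_weight (C A₁ A₂ : ℝ) :
    Integrable (fun y => F.envelope C A₁ A₂ y * weight y) F.ref := by
  have := ((F.integrable_density_mul_pow 3 A₁).add
    (F.integrable_density_mul_pow 3 A₂)).const_mul C
  refine this.congr (ae_of_all _ fun y => ?_)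
  simp only [envelope, weight, Pi.add_apply]; ring

lemma density_rpow_one_add {θ y a : ℝ} (ha : 0 < a) :
    F.density θ y ^ (1 + a) = F.density θ y * F.density θ y ^ a := by
  rw [Real.rpow_add' (F.density_nonneg θ y) (by linarith), Real.rpow_one]

/-- Raising the exponent by one contributes a factor `f_θ`, dominated by the envelope. Thus the
pointwise estimates for `f^a` become integrable ones for `f^{1+a}`, with the bound `E` depending on
`y`. -/
lemma exists_powBound {B : ℝ} (hB : ∀ θ y, F.density θ y ≤ B) (A₁ A₂ : ℝ) {p : ℝ} (hp : 0 < p)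
    (q : ℝ) : ∃ E C : ℝ, 0 ≤ E ∧ 0 ≤ C ∧ (∀ y, PowBound F A₁ A₂ p q y E) ∧
      ∀ y, PowBound F A₁ A₂ (1 + p) (1 + q) y (E * F.envelope C A₁ A₂ y) := by
  obtain ⟨E, hE0, hE⟩ := rpow_mul_log_le (p := p) (q := q) (B := B) hp
  obtain ⟨C, hC0, hC⟩ := F.exists_density_le A₁ A₂
  refine ⟨E, C, hE0, hC0, fun y a ha θ _ => hE _ (F.density_nonneg θ y) (hB θ y) a ha,
    fun y a ha θ hθ => ?_⟩
  obtain ⟨a', rfl⟩ : ∃ a', a = 1 + a' := ⟨a - 1, by ring⟩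
  have ha' : a' ∈ Icc p q := ⟨by linarith [ha.1], by linarith [ha.2]⟩
  have h1 := hE _ (F.density_nonneg θ y) (hB θ y) a' ha'
  have h2 := hC θ hθ y
  have h0 := F.density_nonneg θ y
  rw [F.density_rpow_one_add (hp.trans_le ha'.1), mul_assoc, mul_comm E]
  exact ⟨mul_le_mul h2 h1.1 (F.density_rpow_nonneg _ _ _) (h0.trans h2),
    mul_le_mul h2 h1.2 (mul_nonneg (F.density_rpow_nonneg _ _ _) (abs_nonneg _)) (h0.trans h2)⟩

/-- Up to the factor `1 + a`, the right side is the expected derivative of `∫ f_θ^{1+a}`. It centres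
the score in the expansion of the loss. -/
lemma integral_powScore_law {a θ : ℝ} (ha : 0 < a) :
    ∫ y, F.powScore a θ y ∂F.law θ = ∫ y, F.density θ y ^ (1 + a) * (y - F.b₁ θ) ∂F.ref := by
  rw [integral_law]
  simp only [F.density_rpow_one_add ha, powScore, mul_assoc]

variable {F}

lemma DerivBound.abs_powScore_le {A₁ A₂ p q M y E a θ : ℝ} (h : F.DerivBound A₁ A₂ p q M)
    (hE : PowBound F A₁ A₂ p q y E) (ha : a ∈ Icc p q) (hθ : θ ∈ Icc A₁ A₂) :
    |F.powScore a θ y| ≤ M * (E * weight y) ∧ |F.powScoreDeriv a θ y| ≤ M * (E * weight y) := by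
  have h1 : |y - F.b₁ θ| ≤ M * weight y := (h.abs_sub_le θ hθ y).trans
    (mul_le_mul_of_nonneg_left (by simpa using one_add_abs_pow_le_weight (k := 1) (by norm_num) y)
      (by linarith [h.one_le]))
  have h2 := hE a ha θ hθ
  have h0 := F.density_rpow_nonneg θ y a
  have e : M * (E * weight y) = E * (M * weight y) := by ring
  rw [powScore, powScoreDeriv, abs_mul, abs_mul, abs_mul, abs_of_nonneg h0, e]
  exact ⟨mul_le_mul h2.1 h1 (abs_nonneg _) (h0.trans h2.1),
    mul_le_mul h2.2 h1 (abs_nonneg _) (h0.trans h2.1)⟩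

variable (F)

/-- Integrability of the derivatives of `f_θ^{1+α}`. -/
lemma integrable_pow_derivs {B : ℝ} (hB : ∀ θ y, F.density θ y ≤ B) {a : ℝ} (ha : 0 < a) (θ : ℝ) :
    Integrable (fun x => F.density θ x ^ (1 + a)) F.ref ∧
    Integrable (F.powScore (1 + a) θ) F.ref ∧ Integrable (F.powDeriv₂ (1 + a) θ) F.ref := by
  obtain ⟨E, C, hE0, hC0, -, hP⟩ := F.exists_powBound hB θ θ ha a
  obtain ⟨M, hM⟩ := F.exists_derivBound θ θ (p := 1 + a) (by linarith) (1 + a)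
  have hi := (F.integrable_envelope_mul_weight C θ θ).const_mul E
  have hθ : θ ∈ Icc θ θ := ⟨le_rfl, le_rfl⟩
  have ha' : 1 + a ∈ Icc (1 + a) (1 + a) := ⟨le_rfl, le_rfl⟩
  refine ⟨?_, ?_, ?_⟩
  · refine hi.mono' (((F.measurable_density θ).pow_const _).aestronglyMeasurable)
      (ae_of_all _ fun x => ?_)
    have h0 := F.density_rpow_nonneg θ x (1 + a)
    have h1 := (hP x _ ha' θ hθ).1
    rw [Real.norm_eq_abs, abs_of_nonneg h0, ← mul_assoc]
    exact h1.trans (le_mul_of_one_le_right (h0.trans h1) (one_le_weight x))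
  · refine (hi.const_mul M).mono' (F.measurable_powScore _ _).aestronglyMeasurable
      (ae_of_all _ fun x => ?_)
    have := (hM.abs_powScore_le (hP x) ha' hθ).1
    rwa [mul_assoc E] at this
  · refine (hi.const_mul (2 * M ^ 6)).mono' (F.measurable_powDeriv₂ _ _).aestronglyMeasurable
      (ae_of_all _ fun x => ?_)
    have := hM.abs_powDeriv₂_le (hP x) ha' hθ
    rwa [mul_assoc E] at this

/-- Uniform bounds for the weighted scores and the second derivative of the loss. -/
theorem exists_weight_bounds {B : ℝ} (hB : ∀ θ y, F.density θ y ≤ B) (A₁ A₂ : ℝ) {p : ℝ}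
    (hp : 0 < p) (q : ℝ) : ∃ C : ℝ, 0 ≤ C ∧ ∀ θ ∈ Icc A₁ A₂, ∀ a ∈ Icc p q, ∀ y,
      |F.powScore a θ y| ≤ C * weight y ∧ |F.powScoreDeriv a θ y| ≤ C * weight y ∧
      |F.lossDeriv₂ a θ y| ≤ C * weight y := by
  obtain ⟨E, C, hE0, hC0, hP, hP'⟩ := F.exists_powBound hB A₁ A₂ hp q
  obtain ⟨M, hM⟩ := F.exists_derivBound A₁ A₂ hp q
  obtain ⟨M', hM'⟩ := F.exists_derivBound A₁ A₂ (p := 1 + p) (by linarith) (1 + q)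
  have hi := (F.integrable_envelope_mul_weight C A₁ A₂).const_mul E
  set J := ∫ y, E * (F.envelope C A₁ A₂ y * weight y) ∂F.ref with hJ
  have hJ0 : 0 ≤ J := integral_nonneg fun y => by
    have h1 := F.density_nonneg A₁ y
    have h2 := F.density_nonneg A₂ y
    have h3 := weight_nonneg y
    simp only [envelope, Pi.zero_apply]; positivity
  have hM0 := hM.one_le
  have hM0' := hM'.one_le
  refine ⟨M * E + 2 * M' ^ 6 * J + (1 + 1 / p) * (2 * M ^ 6 * E), by positivity,
    fun θ hθ a ha y => ?_⟩
  have hw := weight_nonneg y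
  have ha0 : 0 < a := hp.trans_le ha.1
  have hps := hM.abs_powScore_le (hP y) ha hθ
  have n1 : 0 ≤ M * E * weight y := by positivity
  have n2 : 0 ≤ 2 * M' ^ 6 * J * weight y := by positivity
  have n3 : 0 ≤ (1 + 1 / p) * (2 * M ^ 6 * E) * weight y := by positivity
  refine ⟨by linarith [hps.1], by linarith [hps.2], ?_⟩
  have e1 : |∫ x, F.powDeriv₂ (1 + a) θ x ∂F.ref| ≤ 2 * M' ^ 6 * J := by
    rw [hJ, ← integral_const_mul]
    rw [← Real.norm_eq_abs]
    refine norm_integral_le_of_norm_le (hi.const_mul _) (ae_of_all _ fun x => ?_)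
    rw [Real.norm_eq_abs]
    have := hM'.abs_powDeriv₂_le (a := 1 + a) (hP' x)
      ⟨by linarith [ha.1], by linarith [ha.2]⟩ hθ
    rwa [mul_assoc E] at this
  have e2 := hM.abs_powDeriv₂_le (hP y) ha hθ
  have e3 : 1 + 1 / a ≤ 1 + 1 / p := by
    have := one_div_le_one_div_of_le hp ha.1
    linarith
  have e4 : |(1 + 1 / a) * F.powDeriv₂ a θ y| ≤ (1 + 1 / p) * (2 * M ^ 6 * (E * weight y)) := by
    rw [abs_mul, abs_of_nonneg (by positivity : 0 ≤ 1 + 1 / a)]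
    exact mul_le_mul e3 e2 (abs_nonneg _) (by positivity)
  have e5 : 2 * M' ^ 6 * J ≤ 2 * M' ^ 6 * J * weight y :=
    le_mul_of_one_le_right (by positivity) (one_le_weight y)
  have := abs_sub (∫ x, F.powDeriv₂ (1 + a) θ x ∂F.ref) ((1 + 1 / a) * F.powDeriv₂ a θ y)
  rw [lossDeriv₂]
  linarith

/-- Quadratic lower bound for the increments of the density power divergence loss. -/
theorem exists_dpdLoss_sub_ge {B : ℝ} (hB : ∀ θ y, F.density θ y ≤ B) (A₁ A₂ : ℝ) {p : ℝ}
    (hp : 0 < p) (q : ℝ) : ∃ C : ℝ, 0 ≤ C ∧ ∀ θ ∈ Icc A₁ A₂, ∀ θ₀ ∈ Icc A₁ A₂,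
      ∀ α ∈ Icc p q, ∀ α₀ ∈ Icc p q, ∀ y,
        -((1 + α) * (F.powScore α θ₀ y - ∫ x, F.powScore α θ₀ x ∂F.law θ₀) * (θ - θ₀)) +
            F.lossDeriv₂ α₀ θ₀ y / 2 * (θ - θ₀) ^ 2 -
            C * weight y * (|θ - θ₀| + |α - α₀|) * (θ - θ₀) ^ 2 ≤
          F.dpdLoss α y θ - F.dpdLoss α y θ₀ := by
  obtain ⟨E, C, hE0, hC0, hP, hP'⟩ := F.exists_powBound hB A₁ A₂ hp q
  obtain ⟨M, hM⟩ := F.exists_derivBound A₁ A₂ hp q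
  obtain ⟨M', hM'⟩ := F.exists_derivBound A₁ A₂ (p := 1 + p) (by linarith) (1 + q)
  have hi := (F.integrable_envelope_mul_weight C A₁ A₂).const_mul E
  set J := ∫ y, E * (F.envelope C A₁ A₂ y * weight y) ∂F.ref with hJ
  have hJ0 : 0 ≤ J := integral_nonneg fun y => by
    have h1 := F.density_nonneg A₁ y
    have h2 := F.density_nonneg A₂ y
    have h3 := weight_nonneg y
    simp only [envelope, Pi.zero_apply]; positivity
  have hM0 := hM.one_le
  have hM0' := hM'.one_le
  refine ⟨5 * M' ^ 6 * J + (1 + 1 / p) * (5 * M ^ 6 * E) + 1 / p ^ 2 * (M ^ 6 * E), by positivity,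
    fun θ hθ θ₀ hθ₀ α hα α₀ hα₀ y => ?_⟩
  have hα0 : 0 < α := hp.trans_le hα.1
  have hα₀0 : 0 < α₀ := hp.trans_le hα₀.1
  set u := θ - θ₀ with hu
  set r := |u| + |α - α₀| with hr
  have hr0 : 0 ≤ r := by positivity
  have hw := one_le_weight y
  obtain ⟨i1, -, -⟩ := F.integrable_pow_derivs hB hα0 θ
  obtain ⟨i2, i3, -⟩ := F.integrable_pow_derivs hB hα0 θ₀
  obtain ⟨-, -, i4⟩ := F.integrable_pow_derivs hB hα₀0 θ₀
  have hint : (∫ x, F.density θ₀ x ^ (1 + α) ∂F.ref) +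
      (1 + α) * (∫ x, F.powScore α θ₀ x ∂F.law θ₀) * u +
      (∫ x, F.powDeriv₂ (1 + α₀) θ₀ x ∂F.ref) / 2 * u ^ 2 - 5 * M' ^ 6 * J * r * u ^ 2 ≤
      ∫ x, F.density θ x ^ (1 + α) ∂F.ref := by
    rw [F.integral_powScore_law hα0]
    have j1 : Integrable (fun x => F.powScore (1 + α) θ₀ x * ((1 + α) * u)) F.ref :=
      i3.mul_const _
    have j2 : Integrable (fun x => F.powDeriv₂ (1 + α₀) θ₀ x * (u ^ 2 / 2)) F.ref :=
      i4.mul_const _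
    have j3 : Integrable (fun x => E * (F.envelope C A₁ A₂ x * weight x) *
      (5 * M' ^ 6 * r * u ^ 2)) F.ref := hi.mul_const _
    have j4 : Integrable (fun x => F.density θ₀ x ^ (1 + α) +
      F.powScore (1 + α) θ₀ x * ((1 + α) * u)) F.ref := i2.add j1
    have j5 : Integrable (fun x => F.density θ₀ x ^ (1 + α) +
      F.powScore (1 + α) θ₀ x * ((1 + α) * u) + F.powDeriv₂ (1 + α₀) θ₀ x * (u ^ 2 / 2))
      F.ref := j4.add j2
    have hmono := integral_mono (j5.sub j3) i1 fun x => by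
      have := hM'.abs_pow_taylor_le (a := 1 + α) (a₀ := 1 + α₀) (hP' x)
        ⟨by linarith [hα.1], by linarith [hα.2]⟩ ⟨by linarith [hα₀.1], by linarith [hα₀.2]⟩ hθ hθ₀
      rw [add_sub_add_left_eq_sub, ← hu, ← hr] at this
      have := (abs_le.1 this).1
      simp only [Pi.sub_apply, powScore]
      linarith
    rw [integral_sub' j5 j3, integral_add j4 j2, integral_add i2 j1, integral_mul_const,
      integral_mul_const, integral_mul_const, ← hJ] at hmono
    simp only [powScore] at hmono
    linarith
  have hpt := (abs_le.1 (hM.abs_pow_taylor_le (hP y) hα hα₀ hθ hθ₀)).2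
  rw [← hu, ← hr] at hpt
  have hd2 := hM.abs_powDeriv₂_le (hP y) hα₀ hθ₀
  -- The quadratic coefficient is to be taken at the fixed exponent `α₀`, so its prefactor `1 + 1/α`
  -- is exchanged for `1 + 1/α₀` at a cost of order `|α - α₀|`.
  have hinv : |1 / α - 1 / α₀| ≤ 1 / p ^ 2 * |α - α₀| := by
    rw [div_sub_div _ _ hα0.ne' hα₀0.ne', abs_div, abs_of_pos (mul_pos hα0 hα₀0), one_mul, mul_one,
      abs_sub_comm, div_eq_inv_mul, ← one_div]
    gcongr
    rw [pow_two]
    exact mul_le_mul hα.1 hα₀.1 hp.le hα0.le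
  have hinvle : 1 + 1 / α ≤ 1 + 1 / p := by
    have := one_div_le_one_div_of_le hp hα.1
    linarith
  have hdiff : (1 / α - 1 / α₀) * F.powDeriv₂ α₀ θ₀ y ≤
      1 / p ^ 2 * r * (2 * M ^ 6 * (E * weight y)) := by
    refine (le_abs_self _).trans ?_
    rw [abs_mul]
    refine mul_le_mul (hinv.trans ?_) hd2 (abs_nonneg _) (by positivity)
    gcongr
    exact le_add_of_nonneg_left (abs_nonneg _)
  have hmul := mul_le_mul_of_nonneg_left hpt (by positivity : 0 ≤ 1 + 1 / α)
  have hmul2 := mul_le_mul_of_nonneg_right hinvle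
    (by positivity : 0 ≤ 5 * M ^ 6 * (E * weight y) * r * u ^ 2)
  have hdiff2 := mul_le_mul_of_nonneg_right hdiff (by positivity : 0 ≤ u ^ 2 / 2)
  -- The deterministic error of the integral term is put under the weight, which is at least one.
  have hJw : 5 * M' ^ 6 * J * r * u ^ 2 ≤ 5 * M' ^ 6 * J * r * u ^ 2 * weight y :=
    le_mul_of_one_le_right (by positivity) hw
  have e1 : (1 + 1 / α) * (α * F.density θ₀ y ^ α * (y - F.b₁ θ₀) * u) =
      (1 + α) * F.powScore α θ₀ y * u := by
    simp only [powScore]; field_simp; ring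
  simp only [dpdLoss, lossDeriv₂]
  have e2 : (1 + 1 / α) * (F.powDeriv₂ α₀ θ₀ y / 2 * u ^ 2) =
      (1 + 1 / α₀) * F.powDeriv₂ α₀ θ₀ y / 2 * u ^ 2 +
      (1 / α - 1 / α₀) * F.powDeriv₂ α₀ θ₀ y * (u ^ 2 / 2) := by ring
  rw [mul_sub, mul_sub, mul_sub, e1, e2] at hmul
  linarith

/-- The terms with `b''` cancel between the integral and the pointwise part, and `(1 + α)² - α(1 +
α) = 1 + α` remains. -/
lemma integral_lossDeriv₂ {B : ℝ} (hB : ∀ θ y, F.density θ y ≤ B) {α : ℝ} (hα : 0 < α) (θ : ℝ) :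
    ∫ y, F.lossDeriv₂ α θ y ∂F.law θ =
      (1 + α) * ∫ y, F.density θ y ^ α * (y - F.b₁ θ) ^ 2 ∂F.law θ := by
  obtain ⟨i1, -, i3⟩ := F.integrable_pow_derivs hB hα θ
  -- Integrability of the weighted squared score is obtained by solving the formula for `powDeriv₂`
  -- at exponent `1 + α`.
  have i4 : Integrable (fun y => F.density θ y ^ (1 + α) * (y - F.b₁ θ) ^ 2) F.ref := by
    have := (i3.add (i1.mul_const ((1 + α) * F.b₂ θ))).const_mul (1 / (1 + α) ^ 2)
    refine this.congr (ae_of_all _ fun y => ?_)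
    simp only [Pi.add_apply, powDeriv₂]
    field_simp
    ring
  have e1 : ∀ y, F.density θ y * F.powDeriv₂ α θ y =
      α ^ 2 * (F.density θ y ^ (1 + α) * (y - F.b₁ θ) ^ 2) -
        α * F.b₂ θ * F.density θ y ^ (1 + α) := by
    intro y; rw [F.density_rpow_one_add hα, powDeriv₂]; ring
  have i5 : Integrable (F.powDeriv₂ α θ) (F.law θ) := by
    rw [integrable_law_iff]
    simp only [e1]
    exact (i4.const_mul _).sub (i1.const_mul _)
  have e2 : ∫ y, F.powDeriv₂ (1 + α) θ y ∂F.ref =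
      (1 + α) ^ 2 * (∫ y, F.density θ y ^ (1 + α) * (y - F.b₁ θ) ^ 2 ∂F.ref) -
        (1 + α) * F.b₂ θ * ∫ y, F.density θ y ^ (1 + α) ∂F.ref := by
    rw [← integral_const_mul, ← integral_const_mul, ← integral_sub (i4.const_mul _)
      (i1.const_mul _)]
    refine integral_congr_ae (ae_of_all _ fun y => ?_)
    simp only [powDeriv₂]; ring
  have e3 : ∫ y, F.powDeriv₂ α θ y ∂F.law θ =
      α ^ 2 * (∫ y, F.density θ y ^ (1 + α) * (y - F.b₁ θ) ^ 2 ∂F.ref) -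
        α * F.b₂ θ * ∫ y, F.density θ y ^ (1 + α) ∂F.ref := by
    rw [integral_law, ← integral_const_mul, ← integral_const_mul, ← integral_sub (i4.const_mul _)
      (i1.const_mul _)]
    simp only [e1]
  have e4 : ∫ y, F.density θ y ^ α * (y - F.b₁ θ) ^ 2 ∂F.law θ =
      ∫ y, F.density θ y ^ (1 + α) * (y - F.b₁ θ) ^ 2 ∂F.ref := by
    rw [integral_law]
    simp only [F.density_rpow_one_add hα, mul_assoc]
  simp only [lossDeriv₂]
  rw [integral_sub (integrable_const _) (i5.const_mul _), integral_const, integral_const_mul, e3,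
    e4, e2]
  generalize ∫ y, F.density θ y ^ (1 + α) * (y - F.b₁ θ) ^ 2 ∂F.ref = X
  generalize ∫ y, F.density θ y ^ (1 + α) ∂F.ref = Z
  simp only [probReal_univ, smul_eq_mul, one_mul]
  field_simp
  ring

lemma continuous_dpdLoss {B : ℝ} (hB : ∀ θ y, F.density θ y ≤ B) {α : ℝ} (hα : 0 < α) (y : ℝ) :
    Continuous fun θ => F.dpdLoss α y θ := by
  have h1 : Continuous fun θ => ∫ x, F.density θ x ^ (1 + α) ∂F.ref := by
    refine continuous_iff_continuousAt.2 fun θ => ?_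
    obtain ⟨E, C, hE0, hC0, -, hP⟩ := F.exists_powBound hB (θ - 1) (θ + 1) hα α
    refine continuousAt_of_dominated
      (Eventually.of_forall fun s => ((F.measurable_density s).pow_const _).aestronglyMeasurable)
      (bound := fun x => E * F.envelope C (θ - 1) (θ + 1) x)
      (by
        filter_upwards [Icc_mem_nhds (sub_one_lt θ) (lt_add_one θ)] with s hs
        refine ae_of_all _ fun x => ?_
        rw [Real.norm_eq_abs, abs_of_nonneg (F.density_rpow_nonneg _ _ _)]
        exact (hP x _ ⟨le_rfl, le_rfl⟩ s hs).1)
      (((F.integrable_density _).add (F.integrable_density _)).const_mul C |>.const_mul E)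
      (ae_of_all _ fun x =>
        ((F.continuous_density x).rpow_const fun _ => Or.inr (by linarith)).continuousAt)
  have h2 : Continuous fun θ => F.density θ y ^ α :=
    (F.continuous_density y).rpow_const fun _ => Or.inr hα.le
  exact h1.sub (continuous_const.mul h2)

end ExponentialFamily

/-! ### Averages of independent variables with Hilbert space coefficients. -/

section RandomVectors

variable {Ω : Type*} [MeasurableSpace Ω] {P : Measure Ω} [IsProbabilityMeasure P]
  {H : Type*} [NormedAddCommGroup H] [InnerProductSpace ℝ H] {n : ℕ}

/-- The weighted average `(1/n) ∑ cᵢ eᵢ`. -/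
def vecAverage (e : Fin n → H) (c : Fin n → ℝ) : H := (1 / (n : ℝ)) • ∑ i, c i • e i

lemma continuous_vecAverage (e : Fin n → H) : Continuous (vecAverage e) := by
  unfold vecAverage; fun_prop

lemma inner_vecAverage (e : Fin n → H) (c : Fin n → ℝ) (v : H) :
    inner ℝ (vecAverage e c) v = (1 / (n : ℝ)) * ∑ i, c i * inner ℝ (e i) v := by
  simp [vecAverage, inner_smul_left, sum_inner]

lemma norm_sq_vecAverage (e : Fin n → H) (c : Fin n → ℝ) :
    ‖vecAverage e c‖ ^ 2 = (1 / (n : ℝ)) ^ 2 * ∑ i, ∑ j, c i * c j * inner ℝ (e i) (e j) := by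
  rw [← real_inner_self_eq_norm_sq, inner_vecAverage, pow_two, mul_assoc]
  congr 1
  rw [Finset.mul_sum]
  refine Finset.sum_congr rfl fun i _ => ?_
  rw [real_inner_comm, inner_vecAverage, Finset.mul_sum, Finset.mul_sum, Finset.mul_sum]
  refine Finset.sum_congr rfl fun j _ => ?_
  rw [real_inner_comm]; ring

variable {Y : Fin n → Ω → ℝ} {ν : Fin n → Measure ℝ}

/-- Averages of independent centred variables, with coefficients in a Hilbert space, are of the
order `n^{-1/2}`. -/
lemma lintegral_enorm_vecAverage_le (hY : ∀ i, HasLaw (Y i) (ν i) P) (hind : iIndepFun Y P)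
    {e : Fin n → H} {κ σ : ℝ} (hκ : 0 < κ) (hσ : 0 < σ) (he : ∀ i, ‖e i‖ ^ 2 ≤ κ) (hn : 0 < n)
    {ζ : Fin n → ℝ → ℝ} (hζm : ∀ i, Measurable (ζ i)) (hζ0 : ∀ i, ∫ y, ζ i y ∂ν i = 0)
    (hζi : ∀ i, Integrable (fun y => ζ i y ^ 2) (ν i)) (hζ2 : ∀ i, ∫ y, ζ i y ^ 2 ∂ν i ≤ σ) :
    ∫⁻ ω, ‖vecAverage e fun i => ζ i (Y i ω)‖ₑ ∂P ≤ ENNReal.ofReal (√(σ * κ / n)) := by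
  have hn' : (0 : ℝ) < n := by exact_mod_cast hn
  have hYm : ∀ i, AEMeasurable (Y i) P := fun i => (hY i).aemeasurable
  have hL : ∀ i, MemLp (fun ω => ζ i (Y i ω)) 2 P := by
    intro i
    have : MemLp (ζ i) 2 (P.map (Y i)) := by
      rw [(hY i).map_eq]
      exact (memLp_two_iff_integrable_sq (hζm i).aestronglyMeasurable).2 (hζi i)
    exact this.comp_of_map (hYm i)
  have hE : ∀ i, ∫ ω, ζ i (Y i ω) * ζ i (Y i ω) ∂P ≤ σ := by
    intro i
    refine le_of_eq_of_le ?_ (hζ2 i)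
    rw [← (hY i).integral_comp (((hζm i).pow_const 2).aestronglyMeasurable)]
    simp only [Function.comp_def, pow_two]
  -- Independence and centring remove the off-diagonal terms of the squared norm; only `n` diagonal
  -- terms survive the factor `1/n²`.
  have hE0 : ∀ i j, i ≠ j → ∫ ω, ζ i (Y i ω) * ζ j (Y j ω) ∂P = 0 := by
    intro i j hij
    have h1 := (hind.indepFun hij).comp (hζm i) (hζm j)
    have h2 := h1.integral_fun_mul_eq_mul_integral (hL i).1 (hL j).1
    have h3 : ∫ ω, (ζ i ∘ Y i) ω ∂P = 0 := by
      rw [(hY i).integral_comp (hζm i).aestronglyMeasurable, hζ0]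
    rw [h3, zero_mul] at h2
    exact h2
  have hint : ∀ i j, Integrable (fun ω => ζ i (Y i ω) * ζ j (Y j ω) * inner ℝ (e i) (e j)) P :=
    fun i j => ((hL i).integrable_mul (hL j)).mul_const _
  have hnint : Integrable (fun ω => ‖vecAverage e fun i => ζ i (Y i ω)‖ ^ 2) P := by
    simp only [norm_sq_vecAverage]
    exact (integrable_finsetSum _ fun i _ => integrable_finsetSum _ fun j _ =>
      hint i j).const_mul _
  have h2 : ∫ ω, ‖vecAverage e fun i => ζ i (Y i ω)‖ ^ 2 ∂P ≤ σ * κ / n := by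
    simp only [norm_sq_vecAverage]
    rw [integral_const_mul, integral_finsetSum _ fun i _ => integrable_finsetSum _ fun j _ =>
      hint i j]
    have : ∀ i, ∫ ω, ∑ j, ζ i (Y i ω) * ζ j (Y j ω) * inner ℝ (e i) (e j) ∂P ≤ σ * κ := by
      intro i
      rw [integral_finsetSum _ fun j _ => hint i j, Finset.sum_eq_single i]
      · rw [integral_mul_const, real_inner_self_eq_norm_sq]
        exact mul_le_mul (hE i) (he i) (sq_nonneg _) hσ.le
      · intro j _ hij
        rw [integral_mul_const, hE0 i j hij.symm, zero_mul]
      · simp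
    calc _ ≤ (1 / (n : ℝ)) ^ 2 * ∑ _i : Fin n, σ * κ := by
          gcongr with i _; exact this i
      _ = _ := by simp; field_simp
  -- The first moment follows from the second through `‖v‖ ≤ (c + ‖v‖²/c)/2`, with `c` equal to the
  -- root mean square bound.
  set c := √(σ * κ / n) with hc
  have hc0 : 0 < c := Real.sqrt_pos.2 (by positivity)
  have hc2 : c ^ 2 = σ * κ / n := Real.sq_sqrt (by positivity)
  calc ∫⁻ ω, ‖vecAverage e fun i => ζ i (Y i ω)‖ₑ ∂P
      ≤ ∫⁻ ω, ENNReal.ofReal ((c + ‖vecAverage e fun i => ζ i (Y i ω)‖ ^ 2 / c) / 2) ∂P := by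
        refine lintegral_mono fun ω => ?_
        rw [← ofReal_norm]
        refine ENNReal.ofReal_le_ofReal ?_
        rw [le_div_iff₀ two_pos, ← sub_nonneg]
        have : c + ‖vecAverage e fun i => ζ i (Y i ω)‖ ^ 2 / c -
            ‖vecAverage e fun i => ζ i (Y i ω)‖ * 2 =
            (c - ‖vecAverage e fun i => ζ i (Y i ω)‖) ^ 2 / c := by field_simp; ring
        rw [this]; positivity
    _ = ENNReal.ofReal (∫ ω, (c + ‖vecAverage e fun i => ζ i (Y i ω)‖ ^ 2 / c) / 2 ∂P) := by
        have hi : Integrable (fun ω =>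
            (c + ‖vecAverage e fun i => ζ i (Y i ω)‖ ^ 2 / c) / 2) P :=
          ((integrable_const c).add (hnint.div_const c)).div_const 2
        exact (ofReal_integral_eq_lintegral_ofReal hi (ae_of_all _ fun ω => by
          simp only [Pi.zero_apply]; positivity)).symm
    _ ≤ ENNReal.ofReal c := by
        refine ENNReal.ofReal_le_ofReal ?_
        rw [integral_div, integral_add (integrable_const c) (hnint.div_const c), integral_div]
        simp only [integral_const, probReal_univ, smul_eq_mul, one_mul]
        rw [div_le_iff₀ two_pos]
        have : (∫ ω, ‖vecAverage e fun i => ζ i (Y i ω)‖ ^ 2 ∂P) / c ≤ c := by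
          rw [div_le_iff₀ hc0, ← pow_two, hc2]; exact h2
        linarith

lemma aemeasurable_vecAverage {Ω' : Type*} [MeasurableSpace Ω'] {μ : Measure Ω'} (e : Fin n → H)
    {c : Fin n → Ω' → ℝ} (hc : ∀ i, AEMeasurable (c i) μ) :
    AEMeasurable (fun ω => ‖vecAverage e fun i => c i ω‖ₑ) μ :=
  (continuous_vecAverage e).enorm.measurable.comp_aemeasurable (aemeasurable_pi_lambda _ hc)

/-- Tail bound for averages of independent centred variables. -/
lemma measure_vecAverage_ge_le (hY : ∀ i, HasLaw (Y i) (ν i) P) (hind : iIndepFun Y P)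
    {e : Fin n → H} {κ σ : ℝ} (hκ : 0 < κ) (hσ : 0 < σ) (he : ∀ i, ‖e i‖ ^ 2 ≤ κ) (hn : 0 < n)
    {ζ : Fin n → ℝ → ℝ} (hζm : ∀ i, Measurable (ζ i)) (hζ0 : ∀ i, ∫ y, ζ i y ∂ν i = 0)
    (hζi : ∀ i, Integrable (fun y => ζ i y ^ 2) (ν i)) (hζ2 : ∀ i, ∫ y, ζ i y ^ 2 ∂ν i ≤ σ)
    {x : ℝ} (hx : 0 < x) :
    P {ω | x ≤ ‖vecAverage e fun i => ζ i (Y i ω)‖} ≤ ENNReal.ofReal (√(σ * κ / n) / x) := by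
  have h1 := lintegral_enorm_vecAverage_le hY hind hκ hσ he hn hζm hζ0 hζi hζ2
  have h2 := meas_ge_le_lintegral_div (μ := P)
    (f := fun ω => ‖vecAverage e fun i => ζ i (Y i ω)‖ₑ)
    (aemeasurable_vecAverage e fun i => (hζm i).comp_aemeasurable (hY i).aemeasurable)
    (ε := ENNReal.ofReal x) (by simpa using hx) ENNReal.ofReal_ne_top
  rw [ENNReal.ofReal_div_of_pos hx]
  refine le_trans (measure_mono fun ω hω => ?_) (h2.trans (ENNReal.div_le_div_right h1 _))
  simp only [mem_ofPred_eq, ← ofReal_norm] at hω ⊢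
  exact ENNReal.ofReal_le_ofReal hω

/-- Tail bound for averages of independent centred variables, uniformly over a real parameter. -/
lemma measure_exists_vecAverage_gt_le [CompleteSpace H] (hY : ∀ i, HasLaw (Y i) (ν i) P)
    (hind : iIndepFun Y P)
    {e : Fin n → H} {κ σ p q a₀ : ℝ} (hκ : 0 < κ) (hσ : 0 < σ) (he : ∀ i, ‖e i‖ ^ 2 ≤ κ)
    (hn : 0 < n) (ha₀ : a₀ ∈ Icc p q) {ξ ζ : Fin n → ℝ → ℝ → ℝ} {G : Fin n → ℝ → ℝ}
    (hξm : ∀ i, Measurable (ξ i a₀)) (hζm : ∀ i, Measurable (Function.uncurry (ζ i)))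
    (hderiv : ∀ i, ∀ a ∈ Icc p q, ∀ y, HasDerivAt (fun a => ξ i a y) (ζ i a y) a)
    (hξ0 : ∀ i, ∫ y, ξ i a₀ y ∂ν i = 0) (hζ0 : ∀ i, ∀ a ∈ Icc p q, ∫ y, ζ i a y ∂ν i = 0)
    (hGi : ∀ i, Integrable (fun y => G i y ^ 2) (ν i)) (hG2 : ∀ i, ∫ y, G i y ^ 2 ∂ν i ≤ σ)
    (hξG : ∀ i y, |ξ i a₀ y| ≤ G i y) (hζG : ∀ i, ∀ a ∈ Icc p q, ∀ y, |ζ i a y| ≤ G i y)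
    {x : ℝ} (hx : 0 < x) :
    P {ω | ∃ a ∈ Icc p q, x ≤ ‖vecAverage e fun i => ξ i a (Y i ω)‖} ≤
      ENNReal.ofReal ((1 + (q - p)) * √(σ * κ / n) / x) := by
  have hpq : p ≤ q := ha₀.1.trans ha₀.2
  have hζma : ∀ i a, Measurable (ζ i a) := fun i a => (hζm i).of_uncurry_left
  have sq_le : ∀ {u v : ℝ}, |u| ≤ v → u ^ 2 ≤ v ^ 2 := fun h =>
    sq_le_sq.2 (h.trans (le_abs_self _))
  have b₀ : ∫⁻ ω, ‖vecAverage e fun i => ξ i a₀ (Y i ω)‖ₑ ∂P ≤ ENNReal.ofReal (√(σ * κ / n)) := by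
    have hi : ∀ i, Integrable (fun y => ξ i a₀ y ^ 2) (ν i) := fun i =>
      (hGi i).mono' ((hξm i).pow_const 2).aestronglyMeasurable (ae_of_all _ fun y => by
        rw [Real.norm_eq_abs, abs_of_nonneg (sq_nonneg _)]; exact sq_le (hξG i y))
    exact lintegral_enorm_vecAverage_le hY hind hκ hσ he hn hξm hξ0 hi fun i =>
      (integral_mono (hi i) (hGi i) fun y => sq_le (hξG i y)).trans (hG2 i)
  have b₁ : ∀ a ∈ Icc p q, ∫⁻ ω, ‖vecAverage e fun i => ζ i a (Y i ω)‖ₑ ∂P ≤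
      ENNReal.ofReal (√(σ * κ / n)) := by
    intro a ha
    have hi : ∀ i, Integrable (fun y => ζ i a y ^ 2) (ν i) := fun i =>
      (hGi i).mono' ((hζma i a).pow_const 2).aestronglyMeasurable (ae_of_all _ fun y => by
        rw [Real.norm_eq_abs, abs_of_nonneg (sq_nonneg _)]; exact sq_le (hζG i a ha y))
    exact lintegral_enorm_vecAverage_le hY hind hκ hσ he hn (fun i => hζma i a)
      (fun i => hζ0 i a ha) hi fun i =>
      (integral_mono (hi i) (hGi i) fun y => sq_le (hζG i a ha y)).trans (hG2 i)
  have hjoint : AEMeasurable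
      (Function.uncurry fun ω a => ‖vecAverage e fun i => ζ i a (Y i ω)‖ₑ)
      (P.prod (volume.restrict (Icc p q))) := by
    refine aemeasurable_vecAverage e fun i => ?_
    exact (hζm i).comp_aemeasurable
      (measurable_snd.aemeasurable.prodMk (hY i).aemeasurable.comp_fst)
  -- A majorant independent of `a`: the norm at `a₀` plus the integrated norm of the derivative in
  -- the exponent. Tonelli bounds its mean, and Markov's inequality then covers the possibly
  -- nonmeasurable event.
  set S : Ω → ENNReal := fun ω => ‖vecAverage e fun i => ξ i a₀ (Y i ω)‖ₑ +
    ∫⁻ a in Icc p q, ‖vecAverage e fun i => ζ i a (Y i ω)‖ₑ with hS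
  have m₀ : AEMeasurable (fun ω => ‖vecAverage e fun i => ξ i a₀ (Y i ω)‖ₑ) P :=
    aemeasurable_vecAverage e fun i => (hξm i).comp_aemeasurable (hY i).aemeasurable
  have hSm : AEMeasurable S P := m₀.add hjoint.lintegral_prod_right'
  have hSint : ∫⁻ ω, S ω ∂P ≤ ENNReal.ofReal ((1 + (q - p)) * √(σ * κ / n)) := by
    rw [hS, lintegral_add_left' m₀, lintegral_lintegral_swap hjoint]
    have : ∫⁻ a in Icc p q, ∫⁻ ω, ‖vecAverage e fun i => ζ i a (Y i ω)‖ₑ ∂P ≤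
        ENNReal.ofReal (√(σ * κ / n)) * ENNReal.ofReal (q - p) := by
      refine (setLIntegral_mono' measurableSet_Icc b₁).trans ?_
      rw [setLIntegral_const, Real.volume_Icc]
    refine (add_le_add b₀ this).trans_eq ?_
    rw [← ENNReal.ofReal_mul (Real.sqrt_nonneg _), ← ENNReal.ofReal_add (Real.sqrt_nonneg _)
      (mul_nonneg (Real.sqrt_nonneg _) (sub_nonneg.2 hpq))]
    congr 1; ring
  have hSge : ∀ ω, ∀ a ∈ Icc p q, ‖vecAverage e fun i => ξ i a (Y i ω)‖ₑ ≤ S ω := by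
    intro ω a ha
    have hd : ∀ b ∈ uIcc a₀ a, HasDerivAt (fun a => vecAverage e fun i => ξ i a (Y i ω))
        (vecAverage e fun i => ζ i b (Y i ω)) b := by
      intro b hb
      have hb' := uIcc_subset_Icc ha₀ ha hb
      unfold vecAverage
      refine HasDerivAt.const_smul _ (HasDerivAt.fun_sum fun i _ => ?_)
      exact (hderiv i b hb' (Y i ω)).smul_const (e i)
    have hmeas : StronglyMeasurable fun b => vecAverage e fun i => ζ i b (Y i ω) := by
      refine (continuous_vecAverage e).comp_stronglyMeasurable
        (measurable_pi_lambda _ fun i => ?_).stronglyMeasurable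
      exact (hζm i).comp (measurable_id.prodMk measurable_const)
    have hbound : ∀ b ∈ Icc p q, ‖vecAverage e fun i => ζ i b (Y i ω)‖ ≤
        1 / (n : ℝ) * ∑ i, G i (Y i ω) * ‖e i‖ := by
      intro b hb
      rw [vecAverage, norm_smul, Real.norm_of_nonneg (by positivity)]
      gcongr
      refine (norm_sum_le _ _).trans (Finset.sum_le_sum fun i _ => ?_)
      rw [norm_smul]
      gcongr
      exact hζG i b hb _
    have hii : IntervalIntegrable (fun b => vecAverage e fun i => ζ i b (Y i ω)) volume a₀ a := by
      rw [intervalIntegrable_iff]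
      refine Measure.integrableOn_of_bounded (by simp) hmeas.aestronglyMeasurable
        (M := 1 / (n : ℝ) * ∑ i, G i (Y i ω) * ‖e i‖) ?_
      rw [ae_restrict_iff' measurableSet_uIoc]
      exact ae_of_all _ fun b hb => hbound b (uIcc_subset_Icc ha₀ ha (uIoc_subset_uIcc hb))
    have h1 := intervalIntegral.integral_eq_sub_of_hasDerivAt hd hii
    have h2 : vecAverage e (fun i => ξ i a (Y i ω)) = vecAverage e (fun i => ξ i a₀ (Y i ω)) +
        ∫ b in a₀..a, vecAverage e fun i => ζ i b (Y i ω) := by rw [h1]; abel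
    rw [h2]
    refine (enorm_add_le _ _).trans (add_le_add le_rfl ?_)
    have h3 : ‖∫ b in a₀..a, vecAverage e fun i => ζ i b (Y i ω)‖ₑ =
        ‖∫ b in uIoc a₀ a, vecAverage e fun i => ζ i b (Y i ω)‖ₑ := by
      rw [← ofReal_norm, ← ofReal_norm, intervalIntegral.norm_intervalIntegral_eq]
    rw [h3]
    refine (enorm_integral_le_lintegral_enorm _).trans ?_
    exact lintegral_mono_set (uIoc_subset_uIcc.trans (uIcc_subset_Icc ha₀ ha))
  have h2 := meas_ge_le_lintegral_div (μ := P) hSm (ε := ENNReal.ofReal x) (by simpa using hx)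
    ENNReal.ofReal_ne_top
  rw [ENNReal.ofReal_div_of_pos hx]
  refine le_trans (measure_mono ?_) (h2.trans (ENNReal.div_le_div_right hSint _))
  rintro ω ⟨a, ha, hxa⟩
  refine le_trans ?_ (hSge ω a ha)
  rw [← ofReal_norm]
  exact ENNReal.ofReal_le_ofReal hxa

end RandomVectors

/-! ### Tail bounds for scores, second derivatives and weights. -/

namespace ExponentialFamily

variable (F : ExponentialFamily)

lemma hasDerivAt_powScore {a : ℝ} (ha : 0 < a) (θ y : ℝ) :
    HasDerivAt (fun a => F.powScore a θ y) (F.powScoreDeriv a θ y) a := by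
  by_cases hy : y ∈ F.carrier
  · exact (F.hasDerivAt_rpow_exponent hy a θ).mul_const _
  · have h0 : F.powScoreDeriv a θ y = 0 := by
      simp [powScoreDeriv, F.density_rpow_of_notMem hy θ ha]
    rw [h0]
    refine (hasDerivAt_const a (0 : ℝ)).congr_of_eventuallyEq ?_
    filter_upwards [lt_mem_nhds ha] with b hb
    simp [powScore, F.density_rpow_of_notMem hy θ hb]

lemma integrable_weight_law (θ : ℝ) : Integrable weight (F.law θ) := F.integrable_pow_law 3 θ

lemma integrable_weight_sq_law (θ : ℝ) : Integrable (fun y => weight y ^ 2) (F.law θ) := by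
  simpa only [weight, ← pow_mul] using F.integrable_pow_law 6 θ

lemma integrable_of_abs_le_weight {f : ℝ → ℝ} (hf : Measurable f) {C : ℝ}
    (h : ∀ y, |f y| ≤ C * weight y) (θ : ℝ) : Integrable f (F.law θ) :=
  ((F.integrable_weight_law θ).const_mul C).mono' hf.aestronglyMeasurable (ae_of_all _ h)

lemma abs_sub_integral_le {f : ℝ → ℝ} {C m θ : ℝ} (hC : 0 ≤ C)
    (h : ∀ y, |f y| ≤ C * weight y) (hm : ∫ y, weight y ∂F.law θ ≤ m) (y : ℝ) :
    |f y - ∫ x, f x ∂F.law θ| ≤ C * (1 + m) * weight y := by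
  have h1 : |∫ x, f x ∂F.law θ| ≤ C * m := by
    rw [← Real.norm_eq_abs]
    refine (norm_integral_le_of_norm_le ((F.integrable_weight_law θ).const_mul C)
      (ae_of_all _ h)).trans ?_
    rw [integral_const_mul]
    gcongr
  have hm0 : 0 ≤ m := (integral_nonneg fun y => weight_nonneg y).trans hm
  have h2 : C * m ≤ C * m * weight y := le_mul_of_one_le_right (by positivity) (one_le_weight y)
  have := abs_sub (f y) (∫ x, f x ∂F.law θ)
  linarith [h y]

lemma measurable_powScoreDeriv (a θ : ℝ) : Measurable (F.powScoreDeriv a θ) :=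
  (F.measurable_powScoreDeriv_uncurry θ).comp (measurable_const.prodMk measurable_id)

/-- Differentiation under the integral shows that the exponent derivative of a centred score is
again centred. -/
lemma hasDerivAt_integral_powScore {B : ℝ} (hB : ∀ θ y, F.density θ y ≤ B) {a : ℝ} (ha : 0 < a)
    (θ : ℝ) : HasDerivAt (fun a => ∫ y, F.powScore a θ y ∂F.law θ)
      (∫ y, F.powScoreDeriv a θ y ∂F.law θ) a := by
  obtain ⟨C, hC0, hC⟩ := F.exists_weight_bounds hB θ θ (half_pos ha) (a + 1)
  have hmem : Icc (a / 2) (a + 1) ∈ 𝓝 a := Icc_mem_nhds (by linarith) (by linarith)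
  have hθ : θ ∈ Icc θ θ := ⟨le_rfl, le_rfl⟩
  exact (hasDerivAt_integral_of_dominated_loc_of_deriv_le (bound := fun y => C * weight y)
    hmem (Eventually.of_forall fun b => (F.measurable_powScore b θ).aestronglyMeasurable)
    (F.integrable_of_abs_le_weight (F.measurable_powScore a θ)
      (fun y => (hC θ hθ a (mem_of_mem_nhds hmem) y).1) θ)
    (F.measurable_powScoreDeriv a θ).aestronglyMeasurable
    (ae_of_all _ fun y b hb => (hC θ hθ b hb y).2.1)
    ((F.integrable_weight_law θ).const_mul C)
    (ae_of_all _ fun y b hb => F.hasDerivAt_powScore (by linarith [hb.1]) θ y)).2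

/-- The centred version of `f` under `F_θ`. -/
def centered (θ : ℝ) (f : ℝ → ℝ) (y : ℝ) : ℝ := f y - ∫ x, f x ∂F.law θ

lemma integral_centered {f : ℝ → ℝ} {θ : ℝ} (hf : Integrable f (F.law θ)) :
    ∫ y, F.centered θ f y ∂F.law θ = 0 := by
  simp only [centered]
  rw [integral_sub hf (integrable_const _)]
  simp

/-- Tail bounds for the averages of the centred weighted scores (uniformly in the exponent),
second derivatives of the loss, and weights. -/
theorem exists_tail_bounds {B : ℝ} (hB : ∀ θ y, F.density θ y ≤ B) (A₁ A₂ : ℝ) {p q a₀ : ℝ}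
    (hp : 0 < p) (ha₀ : a₀ ∈ Icc p q) : ∃ σ : ℝ, 0 < σ ∧
    ∀ {Ω : Type*} [MeasurableSpace Ω] (P : Measure Ω) [IsProbabilityMeasure P] (n : ℕ)
      (θ : Fin n → ℝ) (Y : Fin n → Ω → ℝ) (e : Fin n → L2Pair) (κ x : ℝ), 0 < n →
      (∀ i, θ i ∈ Icc A₁ A₂) → (∀ i, HasLaw (Y i) (F.law (θ i)) P) → iIndepFun Y P →
      0 < κ → (∀ i, ‖e i‖ ^ 2 ≤ κ) → 0 < x →
      P {ω | ∃ a ∈ Icc p q, x ≤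
        ‖vecAverage e fun i => F.centered (θ i) (F.powScore a (θ i)) (Y i ω)‖} ≤
          ENNReal.ofReal ((1 + (q - p)) * √(σ * κ / n) / x) ∧
      P {ω | x ≤ ‖vecAverage e fun i => F.centered (θ i) (F.lossDeriv₂ a₀ (θ i)) (Y i ω)‖} ≤
        ENNReal.ofReal (√(σ * κ / n) / x) ∧
      P {ω | x ≤ ‖vecAverage e fun i => F.centered (θ i) weight (Y i ω)‖} ≤
        ENNReal.ofReal (√(σ * κ / n) / x) := by
  obtain ⟨C, hC0, hC⟩ := F.exists_weight_bounds hB A₁ A₂ hp q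
  obtain ⟨m, hm0, hm⟩ := F.exists_moment_le A₁ A₂ 3
  obtain ⟨m', hm'0, hm'⟩ := F.exists_moment_le A₁ A₂ 6
  -- `C + 1` instead of `C` lets the same envelope cover the weight itself, whose coefficient is
  -- one; `1 + m` pays for centring.
  set D := (C + 1) * (1 + m) with hD
  have hD0 : 0 ≤ D := by positivity
  refine ⟨D ^ 2 * m' + 1, by positivity,
    fun P _ n θ Y e κ x hn hθ hY hind hκ he hx => ?_⟩
  have hσ : 0 < D ^ 2 * m' + 1 := by positivity
  have hm3 : ∀ i, ∫ y, weight y ∂F.law (θ i) ≤ m := fun i => hm _ (hθ i)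
  have hG : ∀ i, Integrable (fun y => (D * weight y) ^ 2) (F.law (θ i)) := fun i => by
    simp only [mul_pow]
    exact (F.integrable_weight_sq_law _).const_mul _
  have hG2 : ∀ i, ∫ y, (D * weight y) ^ 2 ∂F.law (θ i) ≤ D ^ 2 * m' + 1 := fun i => by
    simp only [mul_pow]
    rw [integral_const_mul]
    have : ∫ y, weight y ^ 2 ∂F.law (θ i) ≤ m' := by
      simpa only [weight, ← pow_mul] using hm' _ (hθ i)
    have := mul_le_mul_of_nonneg_left this (sq_nonneg D)
    linarith
  have hcen : ∀ (i : Fin n) {f : ℝ → ℝ}, (∀ y, |f y| ≤ (C + 1) * weight y) → ∀ y,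
      |F.centered (θ i) f y| ≤ D * weight y := fun i f hf y =>
    F.abs_sub_integral_le (by linarith) hf (hm3 i) y
  have weaken : ∀ {f : ℝ → ℝ}, (∀ y, |f y| ≤ C * weight y) →
      ∀ y, |f y| ≤ (C + 1) * weight y := fun hf y =>
    (hf y).trans (mul_le_mul_of_nonneg_right (by linarith) (weight_nonneg y))
  have single : ∀ f : Fin n → ℝ → ℝ, (∀ i, Measurable (f i)) →
      (∀ i y, |f i y| ≤ (C + 1) * weight y) →
      P {ω | x ≤ ‖vecAverage e fun i => F.centered (θ i) (f i) (Y i ω)‖} ≤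
        ENNReal.ofReal (√((D ^ 2 * m' + 1) * κ / n) / x) := by
    intro f hfm hf
    have hsq : ∀ i y, F.centered (θ i) (f i) y ^ 2 ≤ (D * weight y) ^ 2 := fun i y =>
      sq_le_sq.2 ((hcen i (hf i) y).trans (le_abs_self _))
    have hcm : ∀ i, Measurable (F.centered (θ i) (f i)) := fun i => (hfm i).sub_const _
    have hci : ∀ i, Integrable (fun y => F.centered (θ i) (f i) y ^ 2) (F.law (θ i)) := fun i =>
      (hG i).mono' ((hcm i).pow_const 2).aestronglyMeasurable (ae_of_all _ fun y => by
        rw [Real.norm_eq_abs, abs_of_nonneg (sq_nonneg _)]; exact hsq i y)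
    exact measure_vecAverage_ge_le hY hind hκ hσ he hn hcm
      (fun i => F.integral_centered (F.integrable_of_abs_le_weight (hfm i) (hf i) _)) hci
      (fun i => (integral_mono (hci i) (hG i) (hsq i)).trans (hG2 i)) hx
  refine ⟨?_, single _ (fun i => F.measurable_lossDeriv₂ _ _) fun i =>
    weaken fun y => (hC _ (hθ i) a₀ ha₀ y).2.2, single _ (fun _ => measurable_weight)
    fun i y => ?_⟩
  · have hpos : ∀ a ∈ Icc p q, 0 < a := fun a ha => hp.trans_le ha.1
    refine measure_exists_vecAverage_gt_le hY hind hκ hσ he hn ha₀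
      (ξ := fun i a => F.centered (θ i) (F.powScore a (θ i)))
      (ζ := fun i a => F.centered (θ i) (F.powScoreDeriv a (θ i)))
      (G := fun _ y => D * weight y)
      (fun i => (F.measurable_powScore _ _).sub_const _) (fun i => ?_)
      (fun i a ha y => (F.hasDerivAt_powScore (hpos a ha) _ y).sub
        (F.hasDerivAt_integral_powScore hB (hpos a ha) _))
      (fun i => F.integral_centered (F.integrable_of_abs_le_weight (F.measurable_powScore _ _)
        (fun y => (hC _ (hθ i) a₀ ha₀ y).1) _))
      (fun i a ha => F.integral_centered (F.integrable_of_abs_le_weight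
        (F.measurable_powScoreDeriv _ _) (fun y => (hC _ (hθ i) a ha y).2.1) _))
      hG hG2 (fun i => hcen i (weaken fun y => (hC _ (hθ i) a₀ ha₀ y).1))
      (fun i a ha => hcen i (weaken fun y => (hC _ (hθ i) a ha y).2.1)) hx
    have h1 := F.measurable_powScoreDeriv_uncurry (θ i)
    have h2 : Measurable fun a => ∫ y, F.powScoreDeriv a (θ i) y ∂F.law (θ i) :=
      (h1.stronglyMeasurable.integral_prod_right').measurable
    exact h1.sub (h2.comp measurable_fst)
  · rw [abs_of_nonneg (weight_nonneg y)]
    exact le_mul_of_one_le_left (weight_nonneg y) (by linarith)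

end ExponentialFamily

/-! ### Lower bound for the increment of the penalized criterion. -/

lemma HasL2Deriv.memSobolev_one_one {f p : ℝ → ℝ} (h : HasL2Deriv f p) : MemSobolev 1 1 f := by
  refine ⟨by simpa using (contDiffOn_zero (𝕜 := ℝ)).2 h.continuousOn,
    by simpa [derivOn_zero] using h.ac, ?_⟩
  exact h.self_derivOn.memLp.mono_exponent (by norm_num)

/-- Quadrature error for the squares of functions in `W^{1,2}([0,1])`. -/
lemma abs_average_sq_sub_le {n : ℕ} {t : Fin n → ℝ} {K : ℝ} {h p : ℝ → ℝ} (hh : HasL2Deriv h p)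
    (hq : ∀ f : ℝ → ℝ, MemSobolev 1 1 f →
      |(1 / (n : ℝ)) * ∑ i, f (t i) - ∫ x in Icc (0 : ℝ) 1, f x| ≤
        K / n * ∫ x in Icc (0 : ℝ) 1, |derivOn 1 f x|) {s : ℝ} (hs : 0 < s) :
    |(1 / (n : ℝ)) * ∑ i, h (t i) ^ 2 - sqNorm h| ≤
      |K| / (n * s) * (sqNorm h + s ^ 2 * sqNorm p) := by
  have h1 := hq _ hh.sq.memSobolev_one_one
  have h2 : ∫ x in Icc (0 : ℝ) 1, |derivOn 1 (fun x => h x ^ 2) x| =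
      2 * ∫ x in Icc (0 : ℝ) 1, |h x * p x| := by
    rw [← integral_const_mul]
    refine integral_congr_ae ?_
    filter_upwards [hh.sq.derivOn_ae_eq] with x hx
    rw [← hx, abs_mul, abs_two]
  have h3 := hh.two_mul_integral_abs_mul_le hs
  rw [h2] at h1
  refine h1.trans ?_
  calc K / n * (2 * ∫ x in Icc (0 : ℝ) 1, |h x * p x|)
      ≤ |K| / n * ((sqNorm h + s ^ 2 * sqNorm p) / s) := by
        have h4 : 0 ≤ ∫ x in Icc (0 : ℝ) 1, |h x * p x| := integral_nonneg fun x => abs_nonneg _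
        gcongr
        exact le_abs_self K
    _ = _ := by rw [div_mul_div_comm, mul_div_right_comm]

/-- Vectors representing point evaluation in the norm `(‖q‖² + s² ‖q'‖²)^{1/2}`. -/
def RepresentsEvaluation {n : ℕ} (s : ℝ) (t : Fin n → ℝ) (e : Fin n → L2Pair) : Prop :=
  ∀ q p : ℝ → ℝ, HasL2Deriv q p → ∃ v : L2Pair, ‖v‖ ^ 2 = sqNorm q + s ^ 2 * sqNorm p ∧
    ∀ i, inner ℝ (e i) v = q (t i)

/-- Cauchy–Schwarz after moving the sum into the inner product: all functions `h` are handled by one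
random norm. -/
lemma RepresentsEvaluation.abs_average_le {n : ℕ} {s : ℝ} {t : Fin n → ℝ} {e : Fin n → L2Pair}
    (he : RepresentsEvaluation s t e) {h p : ℝ → ℝ} (hh : HasL2Deriv h p) (c : Fin n → ℝ) :
    |(1 / (n : ℝ)) * ∑ i, c i * h (t i)| ≤
      ‖vecAverage e c‖ * √(sqNorm h + s ^ 2 * sqNorm p) := by
  obtain ⟨v, hv, hev⟩ := he h p hh
  have := abs_real_inner_le_norm (vecAverage e c) v
  rw [inner_vecAverage] at this
  simp only [hev] at this
  rwa [← hv, Real.sqrt_sq (norm_nonneg v)]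

/-- The linear bound applied to `h²`. Its first-order norm is controlled through `(h²)' = 2hh'` and
the sup bound of `h` at scale `s`, whence the factor `√(8/s)`. -/
lemma RepresentsEvaluation.abs_average_sq_le {n : ℕ} {s : ℝ} {t : Fin n → ℝ} {e : Fin n → L2Pair}
    (he : RepresentsEvaluation s t e) (hs : 0 < s) (hs1 : s ≤ 1) {h p : ℝ → ℝ}
    (hh : HasL2Deriv h p) (c : Fin n → ℝ) :
    |(1 / (n : ℝ)) * ∑ i, c i * h (t i) ^ 2| ≤
      ‖vecAverage e c‖ * √(8 / s) * (sqNorm h + s ^ 2 * sqNorm p) := by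
  set N := sqNorm h + s ^ 2 * sqNorm p with hN
  have hN0 : 0 ≤ N := add_nonneg (sqNorm_nonneg h) (mul_nonneg (sq_nonneg s) (sqNorm_nonneg p))
  have hsup : ∀ x ∈ Icc (0 : ℝ) 1, h x ^ 2 ≤ 2 / s * N := fun x hx => hh.sq_le_of_scale hx hs hs1
  have b1 : sqNorm (fun x => h x ^ 2) ≤ 2 / s * N * sqNorm h := by
    simp only [sqNorm]
    rw [← integral_const_mul]
    refine integral_mono_ae (hh.sq.memLp_self 2).integrable_sq
      ((hh.memLp_self 2).integrable_sq.const_mul _) (ae_unit_of_forall fun x hx => ?_)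
    simp only
    rw [pow_two (h x ^ 2)]
    exact mul_le_mul_of_nonneg_right (hsup x hx) (sq_nonneg _)
  have b2 : sqNorm (fun x => 2 * (h x * p x)) ≤ 4 * (2 / s * N) * sqNorm p := by
    simp only [sqNorm]
    rw [← integral_const_mul]
    refine integral_mono_ae hh.sq.memLp.integrable_sq
      (hh.memLp.integrable_sq.const_mul _) (ae_unit_of_forall fun x hx => ?_)
    simp only
    rw [show (2 * (h x * p x)) ^ 2 = 4 * h x ^ 2 * p x ^ 2 by ring]
    exact mul_le_mul_of_nonneg_right (mul_le_mul_of_nonneg_left (hsup x hx) (by norm_num))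
      (sq_nonneg _)
  refine (he.abs_average_le hh.sq c).trans ?_
  rw [mul_assoc]
  refine mul_le_mul_of_nonneg_left ?_ (norm_nonneg _)
  rw [Real.sqrt_le_left (by positivity), mul_pow, Real.sq_sqrt (by positivity)]
  have h2s : 0 ≤ 2 / s * N := by positivity
  calc sqNorm (fun x => h x ^ 2) + s ^ 2 * sqNorm (fun x => 2 * (h x * p x))
      ≤ 2 / s * N * sqNorm h + s ^ 2 * (4 * (2 / s * N) * sqNorm p) := by gcongr
    _ ≤ 4 * (2 / s * N) * (sqNorm h + s ^ 2 * sqNorm p) := by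
        nlinarith [mul_nonneg h2s (sqNorm_nonneg h)]
    _ = 8 / s * N ^ 2 := by rw [← hN]; ring

/-- Expand the square of the derivative of `g₀ + (g - g₀)` and bound the cross term by
Cauchy–Schwarz, half of the factor `lam` going to the norm of the difference. -/
lemma penalty_sub_ge {m : ℕ} (hm : 1 ≤ m) {lam : ℝ} (hl : 0 ≤ lam) {g g₀ : ℝ → ℝ}
    (hg : MemSobolev m 2 g) (hg₀ : MemSobolev m 2 g₀) :
    lam * sqNorm (derivOn m fun x => g x - g₀ x) -
        2 * √lam * √(sqNorm (derivOn m g₀)) * sobolevNorm m lam (fun x => g x - g₀ x) ≤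
      lam * sqNorm (derivOn m g) - lam * sqNorm (derivOn m g₀) := by
  set d := derivOn m fun x => g x - g₀ x with hd
  have hdL : MemLp d 2 unitVolume := (hg.sub hm hg₀).memLp_derivOn
  have h0L := hg₀.memLp_derivOn
  have e1 : sqNorm (derivOn m g) = sqNorm d + 2 * (∫ x in Icc (0 : ℝ) 1, d x * derivOn m g₀ x) +
      sqNorm (derivOn m g₀) := by
    have i1 : Integrable (fun x => d x ^ 2) unitVolume := hdL.integrable_sq
    have i2 : Integrable (fun x => 2 * (d x * derivOn m g₀ x)) unitVolume :=
      (hdL.mul_integrable h0L).const_mul 2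
    have i3 : Integrable (fun x => derivOn m g₀ x ^ 2) unitVolume := h0L.integrable_sq
    have i4 : Integrable (fun x => d x ^ 2 + 2 * (d x * derivOn m g₀ x)) unitVolume := i1.add i2
    simp only [sqNorm]
    rw [← integral_const_mul, ← integral_add i1 i2, ← integral_add i4 i3]
    refine integral_congr_ae ?_
    filter_upwards [derivOn_sub hm hg hg₀] with x hx
    rw [hd, hx]; ring
  have e2 := (abs_le.1 (abs_integral_mul_le hdL h0L)).1
  have e3 : √lam * √(sqNorm d) ≤ sobolevNorm m lam (fun x => g x - g₀ x) := by
    rw [← Real.sqrt_mul hl]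
    exact Real.sqrt_le_sqrt (le_add_of_nonneg_left (sqNorm_nonneg _))
  have e4 := mul_le_mul_of_nonneg_left e2 hl
  have e5 : lam = √lam * √lam := (Real.mul_self_sqrt hl).symm
  have e6 := mul_le_mul_of_nonneg_left e3
    (by positivity : 0 ≤ √lam * √(sqNorm (derivOn m g₀)))
  have e7 : √lam * √(sqNorm (derivOn m g₀)) * (√lam * √(sqNorm d)) =
      lam * (√(sqNorm d) * √(sqNorm (derivOn m g₀))) := by
    calc _ = √lam * √lam * (√(sqNorm d) * √(sqNorm (derivOn m g₀))) := by ring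
      _ = _ := by rw [← e5]
  rw [e1]
  linarith

lemma dpdCriterion_eq (F : ExponentialFamily) (m : ℕ) (lam α : ℝ) {n : ℕ} (t y : Fin n → ℝ)
    (g : ℝ → ℝ) : dpdCriterion F m lam α t y g =
      (1 / (n : ℝ)) * ∑ i, F.dpdLoss α (y i) (g (t i)) + lam * sqNorm (derivOn m g) := by
  simp only [dpdCriterion, sqNorm, sq_abs]

/-- Lower bound for the increment of the penalized criterion, in terms of the norms of the averages
of the centred derivatives of the loss. -/
theorem dpdCriterion_sub_ge {F : ExponentialFamily} {m n : ℕ} (hm : 1 ≤ m)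
    {s lam : ℝ} (hs : 0 < s) (hs1 : s ≤ 1) (hlam : 0 ≤ lam) {g g₀ : ℝ → ℝ}
    (hg : MemSobolev m 2 g) (hg₀ : MemSobolev m 2 g₀) {t y : Fin n → ℝ}
    {e : Fin n → L2Pair} (he : RepresentsEvaluation s t e)
    {α α₀ C cV mW ρ κ C₁ : ℝ} {Z V₁ V₂ W₁ W₂ : Fin n → ℝ} (hα0 : 0 < α) (hC : 0 ≤ C)
    (hcV : 0 < cV) (hC₁ : 0 ≤ C₁) (hκ : 0 ≤ κ)
    (hloss : ∀ i, -((1 + α) * Z i * (g (t i) - g₀ (t i))) +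
      (V₁ i + V₂ i) / 2 * (g (t i) - g₀ (t i)) ^ 2 -
      C * ExponentialFamily.weight (y i) * (|g (t i) - g₀ (t i)| + |α - α₀|) * (g (t i) - g₀ (t i)) ^ 2 ≤
        F.dpdLoss α (y i) (g (t i)) - F.dpdLoss α (y i) (g₀ (t i)))
    (hρ : ∀ i, |g (t i) - g₀ (t i)| ≤ ρ) (hα : |α - α₀| ≤ ρ) (hV₂ : ∀ i, cV ≤ V₂ i)
    (hW : ∀ i, ExponentialFamily.weight (y i) = W₁ i + W₂ i) (hW₂ : ∀ i, W₂ i ≤ mW)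
    (hsmall : 2 * C * ρ * mW ≤ cV / 4)
    (hdesign : |(1 / (n : ℝ)) * ∑ i, (g (t i) - g₀ (t i)) ^ 2 - sqNorm (fun x => g x - g₀ x)| ≤
      κ * (sqNorm (fun x => g x - g₀ x) + s ^ 2 * sqNorm (derivOn 1 fun x => g x - g₀ x)))
    (hN : sqNorm (fun x => g x - g₀ x) + s ^ 2 * sqNorm (derivOn 1 fun x => g x - g₀ x) ≤
      C₁ * sobolevNorm m lam (fun x => g x - g₀ x) ^ 2) :
    min (cV / 4) 1 * sobolevNorm m lam (fun x => g x - g₀ x) ^ 2 -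
        (cV / 4 * κ + (‖vecAverage e V₁‖ / 2 + 2 * C * ρ * ‖vecAverage e W₁‖) * √(8 / s)) *
          (C₁ * sobolevNorm m lam (fun x => g x - g₀ x) ^ 2) -
        ((1 + α) * ‖vecAverage e Z‖ * √C₁ + 2 * √lam * √(sqNorm (derivOn m g₀))) *
          sobolevNorm m lam (fun x => g x - g₀ x) ≤
      dpdCriterion F m lam α t y g - dpdCriterion F m lam α t y g₀ := by
  have hh := (hg.sub hm hg₀).hasL2Deriv hm
  set h : ℝ → ℝ := fun x => g x - g₀ x with hhdef
  set R := sobolevNorm m lam h with hR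
  set N := sqNorm h + s ^ 2 * sqNorm (derivOn 1 h) with hNdef
  have hR0 : 0 ≤ R := sobolevNorm_nonneg _ _ _
  have hR2 : R ^ 2 = sqNorm h + lam * sqNorm (derivOn m h) := sobolevNorm_sq hlam h
  have hN0 : 0 ≤ N := add_nonneg (sqNorm_nonneg h) (mul_nonneg (sq_nonneg s) (sqNorm_nonneg _))
  have hρ0 : 0 ≤ ρ := (abs_nonneg _).trans hα
  have bZ := (abs_le.1 (he.abs_average_le hh Z)).2
  have bV := (abs_le.1 (he.abs_average_sq_le hs hs1 hh V₁)).1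
  have bW := (abs_le.1 (he.abs_average_sq_le hs hs1 hh W₁)).2
  rw [← hNdef] at bZ bV bW
  set Q := (1 / (n : ℝ)) * ∑ i, h (t i) ^ 2 with hQ
  have hn0 : (0 : ℝ) ≤ 1 / n := by positivity
  have bZ' : ‖vecAverage e Z‖ * √N ≤ ‖vecAverage e Z‖ * (√C₁ * R) := by
    gcongr
    rw [← Real.sqrt_sq hR0, ← Real.sqrt_mul hC₁]
    exact Real.sqrt_le_sqrt hN
  -- Means are replaced by their bounds `cV` and `mW`, and `|h| + |α - α₀|` by `2ρ`, so that only
  -- centred sums remain random.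
  have hsum : (1 / (n : ℝ)) * ∑ i, (-((1 + α) * (Z i * h (t i))) +
      (V₁ i * h (t i) ^ 2 + cV * h (t i) ^ 2) / 2 -
      2 * C * ρ * (W₁ i * h (t i) ^ 2 + mW * h (t i) ^ 2)) ≤
      (1 / (n : ℝ)) * ∑ i, (F.dpdLoss α (y i) (g (t i)) - F.dpdLoss α (y i) (g₀ (t i))) := by
    refine mul_le_mul_of_nonneg_left (Finset.sum_le_sum fun i _ => ?_) hn0
    refine le_trans ?_ (hloss i)
    have hh2 : 0 ≤ h (t i) ^ 2 := sq_nonneg _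
    change _ ≤ -((1 + α) * Z i * h (t i)) + (V₁ i + V₂ i) / 2 * h (t i) ^ 2 -
      C * ExponentialFamily.weight (y i) * (|h (t i)| + |α - α₀|) * h (t i) ^ 2
    have a1 : cV * h (t i) ^ 2 ≤ V₂ i * h (t i) ^ 2 := mul_le_mul_of_nonneg_right (hV₂ i) hh2
    have a2 : C * ExponentialFamily.weight (y i) * (|h (t i)| + |α - α₀|) * h (t i) ^ 2 ≤
        C * ExponentialFamily.weight (y i) * (2 * ρ) * h (t i) ^ 2 := by
      have := ExponentialFamily.weight_nonneg (y i)
      have h3 : |h (t i)| + |α - α₀| ≤ 2 * ρ := by linarith [hρ i]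
      gcongr
    have a3 : C * ExponentialFamily.weight (y i) * (2 * ρ) * h (t i) ^ 2 ≤
        2 * C * ρ * (W₁ i * h (t i) ^ 2 + mW * h (t i) ^ 2) := by
      have : C * ExponentialFamily.weight (y i) * (2 * ρ) * h (t i) ^ 2 =
        2 * C * ρ * (ExponentialFamily.weight (y i) * h (t i) ^ 2) := by ring
      rw [this, hW i, ← add_mul]
      have := hW₂ i
      gcongr
    linarith
  have hexp : (1 / (n : ℝ)) * ∑ i, (-((1 + α) * (Z i * h (t i))) +
      (V₁ i * h (t i) ^ 2 + cV * h (t i) ^ 2) / 2 -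
      2 * C * ρ * (W₁ i * h (t i) ^ 2 + mW * h (t i) ^ 2)) =
      -((1 + α) * ((1 / (n : ℝ)) * ∑ i, Z i * h (t i))) +
      ((1 / (n : ℝ)) * ∑ i, V₁ i * h (t i) ^ 2 + cV * Q) / 2 -
      2 * C * ρ * ((1 / (n : ℝ)) * ∑ i, W₁ i * h (t i) ^ 2 + mW * Q) := by
    rw [hQ, Finset.sum_sub_distrib, Finset.sum_add_distrib, Finset.sum_neg_distrib,
      ← Finset.mul_sum, ← Finset.sum_div, ← Finset.mul_sum, Finset.sum_add_distrib,
      Finset.sum_add_distrib, ← Finset.mul_sum, ← Finset.mul_sum]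
    ring
  have hpen := penalty_sub_ge hm hlam hg hg₀
  rw [← hhdef, ← hR] at hpen
  have hQd := (abs_le.1 hdesign).1
  have hQ0 : 0 ≤ Q := mul_nonneg hn0 (Finset.sum_nonneg fun i _ => sq_nonneg _)
  have hκN : κ * N ≤ κ * (C₁ * R ^ 2) := mul_le_mul_of_nonneg_left hN hκ
  have c1 := mul_le_mul_of_nonneg_left (bZ.trans bZ') (by linarith : 0 ≤ 1 + α)
  have c2 : ‖vecAverage e V₁‖ * √(8 / s) * N ≤ ‖vecAverage e V₁‖ * √(8 / s) * (C₁ * R ^ 2) := by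
    gcongr
  have c3 : ‖vecAverage e W₁‖ * √(8 / s) * N ≤ ‖vecAverage e W₁‖ * √(8 / s) * (C₁ * R ^ 2) := by
    gcongr
  have c4 := mul_le_mul_of_nonneg_left (bW.trans c3) (by positivity : 0 ≤ 2 * C * ρ)
  -- The mean part of the remainder consumes at most half of the curvature `cV / 2`, leaving `cV /
  -- 4`.
  have c5 := mul_le_mul_of_nonneg_right hsmall hQ0
  have c6 : cV / 4 * (sqNorm h - κ * (C₁ * R ^ 2)) ≤ cV / 4 * Q :=
    mul_le_mul_of_nonneg_left (by linarith) (by positivity)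
  have c7 : min (cV / 4) 1 * R ^ 2 ≤ cV / 4 * sqNorm h + lam * sqNorm (derivOn m h) := by
    rw [hR2, mul_add]
    refine add_le_add (mul_le_mul_of_nonneg_right (min_le_left _ _) (sqNorm_nonneg h)) ?_
    exact mul_le_of_le_one_left (mul_nonneg hlam (sqNorm_nonneg _)) (min_le_right _ _)
  rw [dpdCriterion_eq, dpdCriterion_eq]
  rw [hexp, Finset.sum_sub_distrib, mul_sub] at hsum
  linarith

/-! ### Local minimizers on the favourable event. -/

lemma ExponentialFamily.le_integral_lossDeriv₂ {F : ExponentialFamily} {B : ℝ}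
    (hB : ∀ θ y, F.density θ y ≤ B) {Ω : Type*} [MeasurableSpace Ω] {P : Measure Ω} {θ α c : ℝ}
    {Y : Ω → ℝ} (hY : HasLaw Y (F.law θ) P) (hα : 0 < α)
    (hc : c ≤ ∫ ω, F.density θ (Y ω) ^ α * |F.score θ (Y ω)| ^ 2 ∂P) :
    (1 + α) * c ≤ ∫ y, F.lossDeriv₂ α θ y ∂F.law θ := by
  rw [F.integral_lossDeriv₂ hB hα]
  refine mul_le_mul_of_nonneg_left (hc.trans_eq ?_) (by linarith)
  have h1 : (fun ω => F.density θ (Y ω) ^ α * |F.score θ (Y ω)| ^ 2) =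
      (fun y => F.density θ y ^ α * (y - F.b₁ θ) ^ 2) ∘ Y := by
    funext ω
    -- Off the carrier the score need not be `y - b'`, but the positive power of the density
    -- vanishes there.
    by_cases hy : Y ω ∈ F.carrier
    · simp [F.score_of_mem hy]
    · simp [F.density_rpow_of_notMem hy θ hα]
  rw [h1, hY.integral_comp]
  have := F.measurable_density θ
  exact Measurable.aestronglyMeasurable (by fun_prop)

/-- If the criterion exceeds its value at `g₀` on a sphere around `g₀`, it has a local minimizer
inside the ball. -/
lemma exists_isSobolevLocalMin_of_lt_on_sphere {F : ExponentialFamily} {B : ℝ}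
    (hB : ∀ θ y, F.density θ y ≤ B) {m n : ℕ} (hm : 1 ≤ m) {lam R α : ℝ} (hl : 0 < lam)
    (hR : 0 ≤ R) (hα : 0 < α) {g₀ : ℝ → ℝ} (hg₀ : MemSobolev m 2 g₀) {t y : Fin n → ℝ}
    (ht : ∀ i, t i ∈ Icc (0 : ℝ) 1)
    (hpos : ∀ g, MemSobolev m 2 g → sobolevNorm m lam (fun x => g x - g₀ x) = R →
      dpdCriterion F m lam α t y g₀ < dpdCriterion F m lam α t y g) :
    ∃ g, IsSobolevLocalMin m lam (dpdCriterion F m lam α t y) g ∧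
      sobolevNorm m lam (fun x => g x - g₀ x) ≤ R := by
  have hΦ : Continuous fun v : Fin n → ℝ => (1 / (n : ℝ)) * ∑ i, F.dpdLoss α (y i) (v i) :=
    continuous_const.mul (continuous_finsetSum _ fun i _ =>
      (F.continuous_dpdLoss hB hα (y i)).comp (continuous_apply i))
  obtain ⟨g, hg, hgR, hmin⟩ := exists_isMinOn_sobolev_ball hm hl hR hg₀ ht hΦ
  simp only [← dpdCriterion_eq] at hmin
  have hlt : sobolevNorm m lam (fun x => g x - g₀ x) < R := by
    refine lt_of_le_of_ne hgR fun h => ?_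
    have h1 := hpos g hg h
    have h2 := hmin g₀ hg₀ (by rw [sobolevNorm_self_sub hm hl.le hg₀]; exact hR)
    linarith
  refine ⟨g, ⟨hg, R - sobolevNorm m lam (fun x => g x - g₀ x), sub_pos.2 hlt,
    fun h hh hhr => hmin h hh ?_⟩, hgR⟩
  have := sobolevNorm_sub_le hm hl.le hh hg hg₀
  linarith

/-- Existence of a local minimizer near `g₀` on the event where the averages of the centred
derivatives of the loss are small. -/
lemma exists_isSobolevLocalMin_of_vecAverage_lt {F : ExponentialFamily} {B : ℝ}
    (hB : ∀ θ y, F.density θ y ≤ B) {m n : ℕ} (hm : 1 ≤ m) {s lam R : ℝ} (hs : 0 < s)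
    (hs1 : s ≤ 1) (hsl : s ^ (2 * m) = lam) (hR : 0 < R) {g₀ : ℝ → ℝ} (hg₀ : MemSobolev m 2 g₀)
    {t y : Fin n → ℝ} (ht : ∀ i, t i ∈ Icc (0 : ℝ) 1) {e : Fin n → L2Pair}
    (he : RepresentsEvaluation s t e) {A₁ A₂ p q α α₀ C C₁ K cV mW ρ x z : ℝ}
    (hp : 0 < p) (hα : α ∈ Icc p q) (hα₀ : α₀ ∈ Icc p q) (hαρ : |α - α₀| ≤ ρ)
    (hC : 0 ≤ C) (hC₁0 : 0 ≤ C₁) (hcV : 0 < cV)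
    (hloss : ∀ θ ∈ Icc A₁ A₂, ∀ θ₀ ∈ Icc A₁ A₂, ∀ α ∈ Icc p q, ∀ α₀ ∈ Icc p q, ∀ y,
      -((1 + α) * (F.powScore α θ₀ y - ∫ x, F.powScore α θ₀ x ∂F.law θ₀) * (θ - θ₀)) +
          F.lossDeriv₂ α₀ θ₀ y / 2 * (θ - θ₀) ^ 2 -
          C * ExponentialFamily.weight y * (|θ - θ₀| + |α - α₀|) * (θ - θ₀) ^ 2 ≤
        F.dpdLoss α y θ - F.dpdLoss α y θ₀)
    (hA : ∀ i u, |u - g₀ (t i)| ≤ ρ → u ∈ Icc A₁ A₂)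
    (hinfo : ∀ i, cV ≤ ∫ y, F.lossDeriv₂ α₀ (g₀ (t i)) y ∂F.law (g₀ (t i)))
    (hmW : ∀ i, ∫ y, ExponentialFamily.weight y ∂F.law (g₀ (t i)) ≤ mW)
    (hsmall : 2 * C * ρ * mW ≤ cV / 4)
    (hC₁ : ∀ f : ℝ → ℝ, MemSobolev m 2 f → ∀ s : ℝ, 0 < s → s ≤ 1 →
      sqNorm f + s ^ 2 * sqNorm (derivOn 1 f) ≤
        C₁ * (sqNorm f + s ^ (2 * m) * sqNorm (derivOn m f)))
    (hdesign : ∀ f : ℝ → ℝ, MemSobolev 1 1 f →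
      |(1 / (n : ℝ)) * ∑ i, f (t i) - ∫ x in Icc (0 : ℝ) 1, f x| ≤
        K / n * ∫ x in Icc (0 : ℝ) 1, |derivOn 1 f x|)
    (hRρ : 2 / s * (C₁ * R ^ 2) ≤ ρ ^ 2)
    (hx : ‖vecAverage e fun i => F.centered (g₀ (t i)) (F.powScore α (g₀ (t i))) (y i)‖ < x)
    (hzV : ‖vecAverage e fun i => F.centered (g₀ (t i)) (F.lossDeriv₂ α₀ (g₀ (t i))) (y i)‖ < z)
    (hzW : ‖vecAverage e fun i => F.centered (g₀ (t i)) ExponentialFamily.weight (y i)‖ < z)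
    (hquad : (cV / 4 * (|K| / (n * s)) + (z / 2 + 2 * C * ρ * z) * √(8 / s)) * C₁ ≤
      min (cV / 4) 1 / 2)
    (hlin : (1 + q) * x * √C₁ + 2 * √lam * √(sqNorm (derivOn m g₀)) < min (cV / 4) 1 / 2 * R) :
    ∃ g, IsSobolevLocalMin m lam (dpdCriterion F m lam α t y) g ∧
      sobolevNorm m lam (fun x => g x - g₀ x) ≤ R := by
  have hl : 0 < lam := hsl ▸ pow_pos hs _
  have hα0 : 0 < α := hp.trans_le hα.1
  have hρ0 : 0 ≤ ρ := (abs_nonneg _).trans hαρ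
  refine exists_isSobolevLocalMin_of_lt_on_sphere hB hm hl hR.le hα0 hg₀ ht fun g hg hgR => ?_
  have hh := hg.sub hm hg₀
  have hN := hC₁ _ hh s hs hs1
  rw [hsl, ← sobolevNorm_sq hl.le] at hN
  -- `hRρ` keeps the values of `g` at the design points within `ρ` of those of `g₀`, where the local
  -- expansion is available.
  have hsup : ∀ i, |g (t i) - g₀ (t i)| ≤ ρ := fun i => by
    refine abs_le_of_sq_le_sq ?_ hρ0
    refine ((hh.hasL2Deriv hm).sq_le_of_scale (ht i) hs hs1).trans (le_trans ?_ hRρ)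
    rw [← hgR]
    exact mul_le_mul_of_nonneg_left hN (by positivity)
  have key := dpdCriterion_sub_ge (y := y) hm hs hs1 hl.le hg hg₀ he
    (V₂ := fun i => ∫ y, F.lossDeriv₂ α₀ (g₀ (t i)) y ∂F.law (g₀ (t i)))
    (V₁ := fun i => F.centered (g₀ (t i)) (F.lossDeriv₂ α₀ (g₀ (t i))) (y i))
    (W₁ := fun i => F.centered (g₀ (t i)) ExponentialFamily.weight (y i))
    (W₂ := fun i => ∫ y, ExponentialFamily.weight y ∂F.law (g₀ (t i)))
    (Z := fun i => F.centered (g₀ (t i)) (F.powScore α (g₀ (t i))) (y i))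
    (κ := |K| / (n * s)) hα0 hC hcV hC₁0 (by positivity)
    (fun i => by
      have := hloss (g (t i)) (hA i _ (hsup i)) (g₀ (t i)) (hA i _ (by simpa using hρ0)) α hα α₀
        hα₀ (y i)
      simpa [ExponentialFamily.centered] using this)
    hsup hαρ hinfo (fun i => by simp [ExponentialFamily.centered]) hmW hsmall
    (abs_average_sq_sub_le (hh.hasL2Deriv hm) hdesign hs) hN
  rw [hgR] at key
  set V := ‖vecAverage e fun i => F.centered (g₀ (t i)) (F.lossDeriv₂ α₀ (g₀ (t i))) (y i)‖
  set W := ‖vecAverage e fun i => F.centered (g₀ (t i)) ExponentialFamily.weight (y i)‖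
  set Z := ‖vecAverage e fun i => F.centered (g₀ (t i)) (F.powScore α (g₀ (t i))) (y i)‖
  have h1 : (cV / 4 * (|K| / (n * s)) + (V / 2 + 2 * C * ρ * W) * √(8 / s)) * (C₁ * R ^ 2) ≤
      min (cV / 4) 1 / 2 * R ^ 2 := by
    rw [← mul_assoc]
    refine mul_le_mul_of_nonneg_right (le_trans ?_ hquad) (sq_nonneg R)
    have := hzV.le
    have := hzW.le
    gcongr
  have h2 : (1 + α) * Z * √C₁ ≤ (1 + q) * x * √C₁ := by
    have := hα.2
    have : 0 ≤ Z := norm_nonneg _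
    have := hx.le
    gcongr
    linarith
  -- Quadratic errors take at most half of the gain `min (cV / 4) 1 * R ^ 2`, and linear ones
  -- strictly less than the other half.
  have h3 : ((1 + α) * Z * √C₁ + 2 * √lam * √(sqNorm (derivOn m g₀))) * R <
      min (cV / 4) 1 / 2 * R * R := mul_lt_mul_of_pos_right (by linarith) hR
  have h4 : min (cV / 4) 1 / 2 * R * R = min (cV / 4) 1 / 2 * R ^ 2 := by ring
  linarith

/-! ### Arithmetic of the rates. -/

section Rates

variable {m : ℕ} {lam : ℕ → ℝ}

lemma rpow_one_div_two_mul_pow (hm : 1 ≤ m) {l : ℝ} (hl : 0 < l) :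
    (l ^ (1 / (2 * (m : ℝ)))) ^ (2 * m) = l := by
  have : (m : ℝ) ≠ 0 := by positivity
  rw [← Real.rpow_natCast, ← Real.rpow_mul hl.le]
  push_cast
  rw [one_div_mul_cancel (by positivity), Real.rpow_one]

lemma rpow_one_div_two_mul_sq {l : ℝ} (hl : 0 < l) :
    (l ^ (1 / (2 * (m : ℝ)))) ^ 2 = l ^ (1 / (m : ℝ)) := by
  rw [← Real.rpow_natCast, ← Real.rpow_mul hl.le]
  congr 1
  push_cast
  rw [one_div, mul_inv]
  ring

lemma tendsto_rpow_one_div_two_mul (hm : 1 ≤ m) (hlam : Tendsto lam atTop (𝓝 0)) :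
    Tendsto (fun n => lam n ^ (1 / (2 * (m : ℝ)))) atTop (𝓝 0) := by
  have h0 : (0 : ℝ) < 1 / (2 * (m : ℝ)) := by positivity
  have := hlam.rpow_const (p := 1 / (2 * (m : ℝ))) (Or.inr h0.le)
  rwa [Real.zero_rpow h0.ne'] at this

/-- The scale `lam ^ (1 / (2 m))` compared to the rate of convergence. -/
lemma two_div_mul_rate_le (hm : 1 ≤ m) {s N C D : ℝ} (hs : 0 < s) (hs1 : s ≤ 1) (hN : 0 < N)
    (hC : 0 ≤ C) (hD : 0 ≤ D) :
    2 / s * (C * (D * (N⁻¹ * s⁻¹ + s ^ (2 * m)))) ≤ 2 * C * D * ((N * s ^ 2)⁻¹ + s) := by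
  have h1 : s ^ (2 * m) ≤ s ^ 2 := pow_le_pow_of_le_one hs.le hs1 (by omega)
  calc 2 / s * (C * (D * (N⁻¹ * s⁻¹ + s ^ (2 * m))))
      ≤ 2 / s * (C * (D * (N⁻¹ * s⁻¹ + s ^ 2))) := by gcongr
    _ = 2 * C * D * ((N * s ^ 2)⁻¹ + s) := by field_simp

/-- A threshold `τ √s` for the random norms compensates the factor `√(8/s)` exactly, leaving a
constant that is small with `τ`. -/
lemma quadratic_coefficient_le {A N s C b τ d : ℝ} (hs : 0 < s) (hs1 : s ≤ 1) (hN : 0 < N)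
    (hA : 0 ≤ A) (hC : 0 ≤ C) {K : ℝ} (h1 : A * |K| * C * (N * s ^ 2)⁻¹ ≤ d / 4)
    (h2 : (1 / 2 + 2 * b) * τ * √8 * C ≤ d / 4) :
    (A * (|K| / (N * s)) + (τ * √s / 2 + 2 * b * (τ * √s)) * √(8 / s)) * C ≤ d / 2 := by
  have e1 : √s * √(8 / s) = √8 := by
    rw [← Real.sqrt_mul hs.le, mul_div_cancel₀ _ hs.ne']
  have e2 : (τ * √s / 2 + 2 * b * (τ * √s)) * √(8 / s) = (1 / 2 + 2 * b) * τ * √8 := by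
    rw [← e1]; ring
  have e3 : |K| / (N * s) ≤ |K| * (N * s ^ 2)⁻¹ := by
    rw [div_eq_mul_inv]
    refine mul_le_mul_of_nonneg_left (inv_anti₀ (by positivity) ?_) (abs_nonneg K)
    exact mul_le_mul_of_nonneg_left (by nlinarith) hN.le
  rw [e2, add_mul]
  have e4 : A * (|K| / (N * s)) * C ≤ A * (|K| * (N * s ^ 2)⁻¹) * C := by gcongr
  linarith

/-- The stochastic term and the bias are each at most a constant times the square root of the rate,
so a large `D` dominates both. -/
lemma linear_coefficient_lt {q T N s C l G d D : ℝ} (hs : 0 < s) (hN : 0 < N) (hl : 0 < l)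
    (hq : 0 ≤ q) (hT : 0 ≤ T) (hG : 0 ≤ G) (hD : 0 ≤ D)
    (h : (1 + q) * T * √C + 2 * G < d / 2 * √D) :
    (1 + q) * (T / √(N * s)) * √C + 2 * √l * G < d / 2 * √(D * (N⁻¹ * s⁻¹ + l)) := by
  set r := N⁻¹ * s⁻¹ + l with hr
  have hr0 : 0 < r := by positivity
  have h1 : T / √(N * s) ≤ T * √r := by
    rw [div_eq_mul_inv, ← Real.sqrt_inv, mul_inv]
    exact mul_le_mul_of_nonneg_left (Real.sqrt_le_sqrt (by linarith)) hT
  have h2 : √l ≤ √r := Real.sqrt_le_sqrt (by rw [hr]; have : 0 < N⁻¹ * s⁻¹ := by positivity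
                                             linarith)
  rw [Real.sqrt_mul hD, ← mul_assoc]
  calc (1 + q) * (T / √(N * s)) * √C + 2 * √l * G
      ≤ (1 + q) * (T * √r) * √C + 2 * √r * G := by gcongr
    _ = ((1 + q) * T * √C + 2 * G) * √r := by ring
    _ < d / 2 * √D * √r := mul_lt_mul_of_pos_right h (Real.sqrt_pos.2 hr0)

/-- For the scores the threshold has the order of the standard deviation, so the tail bound does not
depend on the sample size. -/
lemma sqrt_variance_div_eq {σ s N T : ℝ} (hs : 0 < s) (hN : 0 < N) :
    √(σ * (2 / s) / N) / (T / √(N * s)) = √(2 * σ) / T := by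
  have h1 : σ * (2 / s) / N = 2 * σ / (N * s) := by field_simp
  have h2 : √(N * s) ≠ 0 := (Real.sqrt_pos.2 (by positivity)).ne'
  rw [h1, Real.sqrt_div' _ (by positivity)]
  field_simp

/-- For second derivatives and weights the threshold is larger than the standard deviation by the
order `(N s²)^{1/2}`, so the tail bound vanishes. -/
lemma sqrt_variance_div_mul_sqrt_eq {σ s N τ : ℝ} (hs : 0 < s) :
    √(σ * (2 / s) / N) / (τ * √s) = √(2 * σ * (N * s ^ 2)⁻¹) / τ := by
  have h1 : 2 * σ * (N * s ^ 2)⁻¹ = σ * (2 / s) / N / s := by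
    rw [mul_inv, pow_two, mul_inv]; ring
  rw [h1, Real.sqrt_div' _ hs.le, div_div, mul_comm τ]

end Rates

/-! ### Inner probabilities. -/

lemma innerProb_le_one {Ω : Type*} [MeasurableSpace Ω] (P : Measure Ω) (E : Set Ω) :
    innerProb P E ≤ 1 := tsub_le_self

/-- Criterion for inner probabilities of events depending on a sample size and a constant to tend
to one. -/
lemma tendsto_liminf_innerProb {Ω : Type*} [MeasurableSpace Ω] {P : Measure Ω}
    {E : ℝ → ℕ → Set Ω}
    (h : ∀ ε : ℝ, 0 < ε → ∃ D₀, ∀ D ≥ D₀, ∀ᶠ n in atTop, P (E D n)ᶜ ≤ ENNReal.ofReal ε) :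
    Tendsto (fun D => liminf (fun n => innerProb P (E D n)) atTop) atTop (𝓝 1) := by
  refine (ENNReal.tendsto_nhds ENNReal.one_ne_top).2 fun ε hε => ?_
  -- Capping at one makes the extended tolerance finite.
  have hε' : 0 < min ε 1 := lt_min hε one_pos
  have htop : min ε 1 ≠ ⊤ := ne_top_of_le_ne_top ENNReal.one_ne_top (min_le_right _ _)
  obtain ⟨D₀, hD₀⟩ := h (min ε 1).toReal (ENNReal.toReal_pos hε'.ne' htop)
  filter_upwards [eventually_ge_atTop D₀] with D hD
  refine ⟨?_, ?_⟩
  · refine le_liminf_of_le (by isBoundedDefault) ?_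
    filter_upwards [hD₀ D hD] with n hn
    rw [ENNReal.ofReal_toReal htop] at hn
    exact tsub_le_tsub_left (hn.trans (min_le_left _ _)) 1
  · refine le_trans ?_ le_self_add
    exact liminf_le_of_frequently_le'
      (Frequently.of_forall fun n => innerProb_le_one P _)

end

/-! ### Choice of constants and the favourable event. -/

theorem theorem1
    {Ω : Type*} [MeasurableSpace Ω] (P : Measure Ω) [IsProbabilityMeasure P]
    (F : ExponentialFamily) (m : ℕ) (hm : 1 ≤ m)
    (g₀ : ℝ → ℝ) (hg₀ : MemSobolev m 2 g₀)
    -- design points, independent responses, and the possibly data-driven tuning parameter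
    (t : (n : ℕ) → Fin n → ℝ) (ht : ∀ n i, t n i ∈ Icc (0 : ℝ) 1)
    (Y : (n : ℕ) → Fin n → Ω → ℝ)
    (hY_law : ∀ n i, HasLaw (Y n i) (F.law (g₀ (t n i))) P)
    (hY_indep : ∀ n, iIndepFun (Y n) P)
    (αhat : ℕ → Ω → ℝ) (hαhat : ∀ n, AEMeasurable (αhat n) P)
    -- the regularity assumptions on the model, the tuning parameter and the design
    (S : Set ℝ) (hA1 : F.CommonSupport S)
    (α₀ : ℝ) (hα₀ : 0 < α₀) (hA2 : TendstoInMeasure P αhat atTop (fun _ => α₀))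
    (δ : ℝ) (hδ : 0 < δ)
    (hA3 : F.FirstOrderRegular S g₀ α₀ δ)
    (hA4 : F.SecondOrderRegular S g₀ α₀ δ)
    (hA5 : F.InformationBounds P t Y g₀ α₀ δ)
    (hA6 : QuasiUniformDesign t)
    -- the smoothing parameter
    (lam : ℕ → ℝ) (hlam_pos : ∀ n, 0 < lam n) (hlam : Tendsto lam atTop (𝓝 0))
    (hlam₁ : Tendsto (fun n : ℕ => (n : ℝ) * lam n ^ (1 / (m : ℝ))) atTop atTop)
    (hlam₂ : Tendsto (fun n : ℕ => (n : ℝ) * lam n ^ (1 / (2 * (m : ℝ))) *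
      Real.exp (-(lam n ^ (-(1 / (m : ℝ)))))) atTop (𝓝 0)) :
    Tendsto (fun D : ℝ => liminf (fun n : ℕ => innerProb P {ω | ∃ g : ℝ → ℝ,
        IsSobolevLocalMin m (lam n)
          (dpdCriterion F m (lam n) (αhat n ω) (t n) (fun i => Y n i ω)) g ∧
        sobolevNorm m (lam n) (fun x => g x - g₀ x) ^ 2 ≤
          D * ((n : ℝ)⁻¹ * lam n ^ (-(1 / (2 * (m : ℝ)))) + lam n)}) atTop)
      atTop (𝓝 1) := by
  obtain ⟨B, hB⟩ := hA3.1
  obtain ⟨c₀, C₀, hc₀, -, hinf⟩ := hA5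
  obtain ⟨G, hG⟩ := isCompact_Icc.exists_bound_of_continuousOn hg₀.1.continuousOn
  -- `G` bounds `|g₀|`, and the margin one leaves room for deviations up to `ρ ≤ 1`; exponents are
  -- confined to a compact interval around `α₀` away from zero.
  obtain ⟨C, hC, hloss⟩ := F.exists_dpdLoss_sub_ge hB (-G - 1) (G + 1) (half_pos hα₀) (3 * α₀ / 2)
  obtain ⟨mW, hmW0, hmW⟩ := F.exists_moment_le (-G - 1) (G + 1) 3
  have hα₀m : α₀ ∈ Icc (α₀ / 2) (3 * α₀ / 2) := ⟨by linarith, by linarith⟩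
  obtain ⟨σ, hσ, htail⟩ := F.exists_tail_bounds hB (-G - 1) (G + 1) (half_pos hα₀) hα₀m
  obtain ⟨C₁, hC₁1, hC₁⟩ := exists_sobolev_one_le hm
  obtain ⟨n₀, K, hK⟩ := hA6
  set cV := (1 + α₀) * c₀ with hcVdef
  have hcV : 0 < cV := by positivity
  -- The radius keeps parameters and exponents in their compact sets and makes the remainder small
  -- against the curvature; the `+ 1` guards against a zero denominator.
  set ρ := min (min 1 (α₀ / 2)) (cV / (8 * (C * mW + 1))) with hρdef
  have hρ : 0 < ρ := by positivity
  have hρ1 : ρ ≤ 1 := (min_le_left _ _).trans (min_le_left _ _)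
  have hρα : ρ ≤ α₀ / 2 := (min_le_left _ _).trans (min_le_right _ _)
  have hsmall : 2 * C * ρ * mW ≤ cV / 4 := by
    have h1 : ρ * (8 * (C * mW + 1)) ≤ cV := (le_div_iff₀ (by positivity)).1 (min_le_right _ _)
    nlinarith
  have hA : ∀ n i u, |u - g₀ (t n i)| ≤ ρ → u ∈ Icc (-G - 1) (G + 1) := fun n i u hu => by
    have h1 := abs_le.1 (hG _ (ht n i))
    have h2 := abs_le.1 hu
    exact ⟨by linarith, by linarith⟩
  have hA' : ∀ n i, g₀ (t n i) ∈ Icc (-G - 1) (G + 1) := fun n i =>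
    hA n i _ (by simpa using hρ.le)
  set d := min (cV / 4) 1 with hd
  have hd0 : 0 < d := by positivity
  have hC₁0 : 0 < C₁ := by linarith
  set τ := d / 4 / ((1 / 2 + 2 * (C * ρ)) * √8 * C₁) with hτdef
  have hτ : 0 < τ := by positivity
  have hτ' : (1 / 2 + 2 * (C * ρ)) * τ * √8 * C₁ ≤ d / 4 := by
    rw [hτdef]
    refine le_of_eq ?_
    field_simp
  set s : ℕ → ℝ := fun n => lam n ^ (1 / (2 * (m : ℝ))) with hsdef
  have hs : ∀ n, 0 < s n := fun n => Real.rpow_pos_of_pos (hlam_pos n) _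
  have hsl : ∀ n, s n ^ (2 * m) = lam n := fun n => rpow_one_div_two_mul_pow hm (hlam_pos n)
  have hs0 : Tendsto s atTop (𝓝 0) := tendsto_rpow_one_div_two_mul hm hlam
  have hinv : Tendsto (fun n : ℕ => ((n : ℝ) * s n ^ 2)⁻¹) atTop (𝓝 0) := by
    refine tendsto_inv_atTop_zero.comp (hlam₁.congr fun n => ?_)
    rw [hsdef, rpow_one_div_two_mul_sq (hlam_pos n)]
  refine tendsto_liminf_innerProb fun ε hε => ?_
  -- Chosen so that the uniform tail bound for the scores equals `ε / 4`; it depends neither on `n`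
  -- nor on `D`.
  set T := (1 + (3 * α₀ / 2 - α₀ / 2)) * √(2 * σ) * 4 / ε with hTdef
  have hw : 0 < 1 + (3 * α₀ / 2 - α₀ / 2) := by linarith
  have hT : 0 < T := by positivity
  set H := (1 + 3 * α₀ / 2) * T * √C₁ + 2 * √(sqNorm (derivOn m g₀)) with hHdef
  have hH : 0 < H := by positivity
  -- This threshold makes `√D` exceed `2H/d`, which is what the linear terms require.
  refine ⟨(2 * H / d) ^ 2 + 1, fun D hD => ?_⟩
  have hD0 : 0 < D := by nlinarith [sq_nonneg (2 * H / d)]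
  have hHD : H < d / 2 * √D := by
    have h1 : 2 * H / d < √D := Real.lt_sqrt_of_sq_lt (by linarith)
    have h2 := mul_lt_mul_of_pos_right h1 (half_pos hd0)
    have h3 : 2 * H / d * (d / 2) = H := by field_simp
    linarith
  have ev1 : ∀ᶠ n : ℕ in atTop, 2 * C₁ * D * (((n : ℝ) * s n ^ 2)⁻¹ + s n) < ρ ^ 2 := by
    have := (hinv.add hs0).const_mul (2 * C₁ * D)
    simp only [add_zero, mul_zero] at this
    exact this.eventually_lt_const (by positivity)
  have ev2 : ∀ᶠ n : ℕ in atTop, cV / 4 * |K| * C₁ * ((n : ℝ) * s n ^ 2)⁻¹ < d / 4 := by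
    have := hinv.const_mul (cV / 4 * |K| * C₁)
    simp only [mul_zero] at this
    exact this.eventually_lt_const (by positivity)
  have ev3 : ∀ᶠ n : ℕ in atTop, √(2 * σ * ((n : ℝ) * s n ^ 2)⁻¹) / τ < ε / 4 := by
    have := ((hinv.const_mul (2 * σ)).sqrt).div_const τ
    simp only [mul_zero, Real.sqrt_zero, zero_div] at this
    exact this.eventually_lt_const (by positivity)
  have ev4 : ∀ᶠ n in atTop, P {ω | ρ ≤ ‖αhat n ω - α₀‖} < ENNReal.ofReal (ε / 4) :=
    (tendstoInMeasure_iff_norm.1 hA2 ρ hρ).eventually_lt_const (by simpa using hε)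
  filter_upwards [ev1, ev2, ev3, ev4, eventually_ge_atTop n₀, eventually_gt_atTop 0,
    hs0.eventually_lt_const one_pos] with n h1 h2 h3 h4 hn₀ hn hsn
  have hN : (0 : ℝ) < n := by exact_mod_cast hn
  obtain ⟨e, he, hev⟩ := exists_evaluation_vectors (hs n) hsn.le
  set e' : Fin n → L2Pair := fun i => e (t n i) with he'
  have hrep : RepresentsEvaluation (s n) (t n) e' := fun q p hqp => by
    obtain ⟨v, hv, hv'⟩ := hev q p hqp
    exact ⟨v, hv, fun i => hv' _ (ht n i)⟩
  have hκ : 0 < 2 / s n := div_pos two_pos (hs n)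
  have hb : ∀ i, ‖e' i‖ ^ 2 ≤ 2 / s n := fun i => he _ (ht n i)
  have hNs : 0 < √(n * s n) := Real.sqrt_pos.2 (mul_pos hN (hs n))
  have hz : 0 < τ * √(s n) := mul_pos hτ (Real.sqrt_pos.2 (hs n))
  obtain ⟨hZ, -, -⟩ := htail P n (fun i => g₀ (t n i)) (Y n) e' (2 / s n) (T / √(n * s n)) hn
    (hA' n) (hY_law n) (hY_indep n) hκ hb (div_pos hT hNs)
  obtain ⟨-, hV, hW⟩ := htail P n (fun i => g₀ (t n i)) (Y n) e' (2 / s n) (τ * √(s n)) hn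
    (hA' n) (hY_law n) (hY_indep n) hκ hb hz
  rw [mul_div_assoc (1 + (3 * α₀ / 2 - α₀ / 2)), sqrt_variance_div_eq (hs n) hN] at hZ
  rw [sqrt_variance_div_mul_sqrt_eq (hs n)] at hV hW
  have hTε : (1 + (3 * α₀ / 2 - α₀ / 2)) * (√(2 * σ) / T) = ε / 4 := by
    have : √(2 * σ) ≠ 0 := (Real.sqrt_pos.2 (by positivity)).ne'
    rw [hTdef]
    field_simp
  rw [hTε] at hZ
  have hV' := hV.trans (ENNReal.ofReal_le_ofReal h3.le)
  have hW' := hW.trans (ENNReal.ofReal_le_ofReal h3.le)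
  -- Four bad events, each of probability at most `ε / 4`: the exponent estimate, the scores
  -- uniformly in the exponent, the second derivatives and the weights.
  refine le_trans (measure_mono (t := {ω | ρ ≤ ‖αhat n ω - α₀‖} ∪ (_ ∪ (_ ∪ _))) ?_)
    ((measure_union_le _ _).trans ((add_le_add h4.le ((measure_union_le _ _).trans
      (add_le_add hZ ((measure_union_le _ _).trans (add_le_add hV' hW'))))).trans ?_))
  · intro ω hω
    by_contra hbad
    simp only [mem_union, mem_ofPred_eq, not_or, not_le, not_exists, not_and] at hbad
    obtain ⟨b1, b2, b3, b4⟩ := hbad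
    refine hω ?_
    rw [Real.norm_eq_abs] at b1
    have hαI : αhat n ω ∈ Icc (α₀ / 2) (3 * α₀ / 2) := by
      have := abs_lt.1 b1
      exact ⟨by linarith, by linarith⟩
    have hr : 0 < D * ((n : ℝ)⁻¹ * (s n)⁻¹ + lam n) := by
      have := hs n
      have := hlam_pos n
      positivity
    obtain ⟨g, hg, hgR⟩ := exists_isSobolevLocalMin_of_vecAverage_lt hB hm (hs n) hsn.le (hsl n)
      (Real.sqrt_pos.2 hr) hg₀ (ht n) hrep (half_pos hα₀) hαI hα₀m b1.le hC hC₁0.le hcV hloss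
      (hA n)
      (fun i => ExponentialFamily.le_integral_lossDeriv₂ hB (hY_law n i) hα₀ (hinf α₀ (by simpa using hδ) n i).1)
      (fun i => hmW _ (hA' n i)) hsmall hC₁ (hK n hn₀)
      (by
        rw [Real.sq_sqrt hr.le, ← hsl n]
        exact (two_div_mul_rate_le hm (hs n) hsn.le hN hC₁0.le hD0.le).trans h1.le)
      (b2 _ hαI) b3 b4
      (by
        have := quadratic_coefficient_le (b := C * ρ) (τ := τ) (hs n) hsn.le hN
          (by positivity : 0 ≤ cV / 4) hC₁0.le h2.le hτ'
        rwa [← mul_assoc 2 C ρ] at this)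
      (linear_coefficient_lt (hs n) hN (hlam_pos n) (by positivity) hT.le (Real.sqrt_nonneg _)
        hD0.le hHD)
    refine ⟨g, hg, ?_⟩
    have h5 := pow_le_pow_left₀ (sobolevNorm_nonneg _ _ _) hgR 2
    rwa [Real.sq_sqrt hr.le, hsdef, ← Real.rpow_neg (hlam_pos n).le] at h5
  · rw [← ENNReal.ofReal_add (by positivity) (by positivity),
      ← ENNReal.ofReal_add (by positivity) (by positivity),
      ← ENNReal.ofReal_add (by positivity) (by positivity)]
    exact ENNReal.ofReal_le_ofReal (by linarith)
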